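/- **Setting.** Let $A\in GL_d(\mathbb R)$, $\Omega=A[0,1)^d$, $\mathbb L=A\mathbb Z^d$, $\mathbb L^*=2\pi A^{-T}\mathbb Z^d$, and $e_G(r)=|\Omega|^{-1/2}e^{iG\cdot r}$ for $G\in\mathbb L^*$. For $E>0$ let $n(E)$ be the number of $G\in\mathbb L^*$ with $|G|^2\le 2E$. Fix $\beta>0$ and put $f_\mu(x)=(1+e^{\beta(x-\mu)})^{-1}$. Let $0<E_c^{(0)}<\dots<E_c^{(L)}=E_c$ be energy cutoffs, $n=n(E_c)$, and let $P\in\mathbb C^{n\times n}$ be a density matrix: $P=P^h$, $0\preceq P\preceq I$, $\operatorname{Tr}P=N\in\mathbb N$. Its density is $\rho_P=\sum_{G,G'}P_{GG'}\overline{e_G}e_{G'}$. The Kohn–Sham Hamiltonian is $\mathcal H[\rho]=-\tfrac12\Delta+V[\rho]$, $V[\rho]=v_{\rm ext}+v_{\rm H}[\rho]+v_{\rm xc}(\rho)$, where $v_{\rm H}[\rho]$ is the periodic Coulomb potential of $\rho$ (zero Fourier mode dropped, and $v_{\rm H}=0$ if $d=1$). Its matrix at level $\ell$ is $K^{(\ell)}_{GG'}=\int_\Omega\overline{e_G}\,\mathcal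 H[\rho_P]e_{G'}$ with $|G|^2,|G'|^2\le 2E_c^{(\ell)}$, and $K=K^{(L)}$. The potential is smooth in the following sense: for some $c$ and $\sigma>0$, $V[\rho_P]$ extends to an $\mathbb L$-periodic holomorphic function on $\{z\in\mathbb C^d:|\operatorname{Im}z|<\sigma\}$ bounded by $c$. The Fermi level $\mu$ satisfies $\operatorname{Tr}f_\mu(K)=N$. Let $a\neq0$ and $b$ be real numbers such that $H=a(K-bI)$ has spectrum in $[-1,1]$, put $H^{(\ell)}=a(K^{(\ell)}-bI)$ and $g(x)=f_\mu(x/a+b)^{1/2}$, and let $p_M=\sum_{m\le M}c_mT_m$ be the truncated Chebyshev series of $g$ on $[-1,1]$. Let $Q^{(\ell)}\in\mathbb C^{n\times n}$ be $p_M(H^{(\ell)})$ extended by zero. Let $\chi\in\mathbb C^n$ have independent random entries with $\mathbb E[\chi\chi^h]=I$, $\mathbb E[\chi_i^2]=0$ and $\mathbb E|\chi_i|^4=1$. Put $\varphi^{(\ell)}_\chi=(Q^{(\ell)}\chi)(Q^{(\ell)}\chi)^h$ and, for $1\le\ell\le L$, $\mathcal V_\ell=\operatorname{Var}[\varphi_\chi^{(\ell)}-\varphi_\chi^{(\ell-1)}]$,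 the sum of the variances of the entries. **Theorem.** (i) For every $a\ne0$ there are $\kappa,\alpha>0$, depending only on $\beta$ and $a$, such that for all $\mu,b\in\mathbb R$ $$\|p_M-g\|_{L^\infty([-1,1])}\le\kappa e^{-\alpha M}\qquad\text{for all }M\ge0.\tag{1}$$ (ii) There are constants $C,\gamma>0$ depending only on $\beta$ and on the physical system, that is, on $d$, $A$, $N$, $c$ and $\sigma$ (and not on $L$, the cutoffs, $n$, $M$, $v_{\rm ext}$, $v_{\rm xc}$, $P$, $\mu$, $a$, $b$ or the law of $\chi$), such that, whenever (1) holds with some $\kappa$ and some $\alpha>0$, for all $M\ge0$ and all $1\le\ell\le L$ $$\mathcal V_\ell\le C\,N\Big(\exp\big(-2\gamma\sqrt{E_c^{(\ell-1)}}\big)+\kappa^2n(1+\kappa^2n)\exp(-2\alpha M)\Big).$$ -/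

import Mathlib

open MeasureTheory ProbabilityTheory
open scoped ComplexOrder ComplexConjugate Polynomial

noncomputable section

namespace StochDFT

/-! ### Lattices and plane waves -/

/-- The point `A s` of `ℝ^d`. -/
def latticeMap {d : ℕ} (A : Matrix.GeneralLinearGroup (Fin d) ℝ) (s : Fin d → ℝ) :
    EuclideanSpace ℝ (Fin d) :=
  WithLp.toLp 2 ((A : Matrix (Fin d) (Fin d) ℝ).mulVec s)

/-- The unit cell `Ω = A [0,1)^d`. -/
def unitCell {d : ℕ} (A : Matrix.GeneralLinearGroup (Fin d) ℝ) :
    Set (EuclideanSpace ℝ (Fin d)) :=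
  latticeMap A '' (Set.univ.pi fun _ => Set.Ico (0 : ℝ) 1)

/-- The volume `|Ω| = |det A|`. -/
def cellVolume {d : ℕ} (A : Matrix.GeneralLinearGroup (Fin d) ℝ) : ℝ :=
  |(A : Matrix (Fin d) (Fin d) ℝ).det|

/-- The vector `G = 2π A^{-T} k` of the dual lattice with integer coordinates `k`. -/
def dualVec {d : ℕ} (A : Matrix.GeneralLinearGroup (Fin d) ℝ) (k : Fin d → ℤ) :
    EuclideanSpace ℝ (Fin d) :=
  WithLp.toLp 2 ((2 * Real.pi) •
    ((A⁻¹ : Matrix.GeneralLinearGroup (Fin d) ℝ) : Matrix (Fin d) (Fin d) ℝ).transpose.mulVec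
      (fun i => (k i : ℝ)))

/-- The plane wave `e_G(r) = |Ω|^{-1/2} exp(i G · r)` with `G = dualVec A k`. -/
def planeWave {d : ℕ} (A : Matrix.GeneralLinearGroup (Fin d) ℝ) (k : Fin d → ℤ)
    (r : EuclideanSpace ℝ (Fin d)) : ℂ :=
  ((1 / Real.sqrt (cellVolume A) : ℝ) : ℂ) *
    Complex.exp (Complex.I * ((inner ℝ (dualVec A k) r : ℝ) : ℂ))

/-- Integer coordinates of the dual lattice vectors with `|G|² ≤ 2 E`. -/
def cutoffSet {d : ℕ} (A : Matrix.GeneralLinearGroup (Fin d) ℝ) (E : ℝ) : Set (Fin d → ℤ) :=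
  {k | ‖dualVec A k‖ ^ 2 ≤ 2 * E}

theorem cutoffSet_finite {d : ℕ} (A : Matrix.GeneralLinearGroup (Fin d) ℝ) (E : ℝ) :
    (cutoffSet A E).Finite := by
  have hcont : Continuous fun x : EuclideanSpace ℝ (Fin d) =>
      (2 * Real.pi)⁻¹ • ((A : Matrix (Fin d) (Fin d) ℝ).transpose.mulVec (WithLp.ofLp x)) := by
    fun_prop
  have hk : ∀ k : Fin d → ℤ, (2 * Real.pi)⁻¹ • ((A : Matrix (Fin d) (Fin d) ℝ).transpose.mulVec
      (WithLp.ofLp (dualVec A k))) = fun i => (k i : ℝ) := by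
    intro k
    have hA : (A : Matrix (Fin d) (Fin d) ℝ).transpose *
        ((A⁻¹ : Matrix.GeneralLinearGroup (Fin d) ℝ) : Matrix (Fin d) (Fin d) ℝ).transpose = 1 := by
      rw [← Matrix.transpose_mul, ← Units.val_mul, inv_mul_cancel, Units.val_one,
        Matrix.transpose_one]
    simp only [dualVec, Matrix.mulVec_smul, Matrix.mulVec_mulVec, hA, Matrix.one_mulVec]
    rw [smul_smul, inv_mul_cancel₀ (by positivity), one_smul]
  obtain ⟨R, hR⟩ := ((isCompact_closedBall (0 : EuclideanSpace ℝ (Fin d))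
    (Real.sqrt (2 * E))).image hcont).isBounded.exists_norm_le
  refine (Set.Finite.pi' (fun _ : Fin d => Set.finite_Icc (-⌈R⌉) ⌈R⌉)).subset ?_
  intro k hkE i
  have h1 : ‖fun i => (k i : ℝ)‖ ≤ R := by
    rw [← hk k]
    refine hR _ ⟨_, ?_, rfl⟩
    rw [mem_closedBall_zero_iff]
    exact Real.le_sqrt_of_sq_le hkE
  have h2 : |(k i : ℝ)| ≤ R := (norm_le_pi_norm (fun i => (k i : ℝ)) i).trans h1
  rw [abs_le] at h2
  have h3 := Int.le_ceil R
  constructor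
  · have : ((-⌈R⌉ : ℤ) : ℝ) ≤ (k i : ℝ) := by push_cast; linarith
    exact_mod_cast this
  · have : (k i : ℝ) ≤ ((⌈R⌉ : ℤ) : ℝ) := by linarith
    exact_mod_cast this

/-- The index set of the plane-wave basis with energy cutoff `E`. -/
abbrev PW {d : ℕ} (A : Matrix.GeneralLinearGroup (Fin d) ℝ) (E : ℝ) : Type :=
  ↥(cutoffSet A E)

instance instFintypePW {d : ℕ} (A : Matrix.GeneralLinearGroup (Fin d) ℝ) (E : ℝ) :
    Fintype ↥(cutoffSet A E) :=
  (cutoffSet_finite A E).fintype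

/-! ### The Kohn-Sham Hamiltonian -/

/-- The admissible set `𝒟_N` of density matrices. -/
def IsDensityMatrix {ι : Type*} [Fintype ι] [DecidableEq ι] (N : ℕ) (P : Matrix ι ι ℂ) : Prop :=
  P.IsHermitian ∧ P.PosSemidef ∧ (1 - P).PosSemidef ∧ P.trace = (N : ℂ)

/-- The electron density `ρ_P = ∑_{G,G'} P_{GG'} conj(e_G) e_{G'}` (real for Hermitian `P`). -/
def density {d : ℕ} (A : Matrix.GeneralLinearGroup (Fin d) ℝ) {E : ℝ}
    (P : Matrix (PW A E) (PW A E) ℂ) (r : EuclideanSpace ℝ (Fin d)) : ℝ :=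
  (∑ G : PW A E, ∑ G' : PW A E,
    P G G' * (conj (planeWave A G.1 r) * planeWave A G'.1 r)).re

/-- The Fourier transform `2^{d-1} π^{(d-1)/2} Γ((d-1)/2) / |K|^{d-1}` of the Coulomb kernel
`1 / |r|` on `ℝ^d` (so `4π / |K|²` for `d = 3`), with the zero mode dropped as usual for
periodic systems. For `d = 1`, where the kernel is not locally integrable, the value is `0`. -/
def coulombSymbol {d : ℕ} (K : EuclideanSpace ℝ (Fin d)) : ℝ :=
  if K = 0 then 0 else
    (2 : ℝ) ^ ((d : ℝ) - 1) * Real.pi ^ (((d : ℝ) - 1) / 2) * Real.Gamma (((d : ℝ) - 1) / 2) /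
      ‖K‖ ^ ((d : ℝ) - 1)

/-- The periodic Hartree potential of the density `ρ`: the convolution of `ρ` with the
periodic Coulomb kernel, written in the plane-wave basis. -/
def hartree {d : ℕ} (A : Matrix.GeneralLinearGroup (Fin d) ℝ)
    (ρ : EuclideanSpace ℝ (Fin d) → ℝ) (r : EuclideanSpace ℝ (Fin d)) : ℝ :=
  (∑' k : Fin d → ℤ, (coulombSymbol (dualVec A k) : ℂ) *
    (∫ r' in unitCell A, conj (planeWave A k r') * (ρ r' : ℂ)) * planeWave A k r).re

/-- The total potential `v_ext + v_H[ρ] + v_xc(ρ)`. -/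
def totalPotential {d : ℕ} (A : Matrix.GeneralLinearGroup (Fin d) ℝ)
    (vext : EuclideanSpace ℝ (Fin d) → ℝ) (vxc : ℝ → ℝ)
    (ρ : EuclideanSpace ℝ (Fin d) → ℝ) (r : EuclideanSpace ℝ (Fin d)) : ℝ :=
  vext r + hartree A ρ r + vxc (ρ r)

/-- The Kohn-Sham operator `-½ Δ + v_ext + v_H[ρ] + v_xc(ρ)`. -/
def ksOperator {d : ℕ} (A : Matrix.GeneralLinearGroup (Fin d) ℝ)
    (vext : EuclideanSpace ℝ (Fin d) → ℝ) (vxc : ℝ → ℝ)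
    (ρ : EuclideanSpace ℝ (Fin d) → ℝ) (ψ : EuclideanSpace ℝ (Fin d) → ℂ)
    (r : EuclideanSpace ℝ (Fin d)) : ℂ :=
  -(1 / 2 : ℂ) * Laplacian.laplacian ψ r + (totalPotential A vext vxc ρ r : ℂ) * ψ r

/-- The Kohn-Sham Hamiltonian matrix on the plane waves with cutoff `E`,
`∫_Ω conj(e_G) H^KS[ρ] e_{G'}`. -/
def ksMatrix {d : ℕ} (A : Matrix.GeneralLinearGroup (Fin d) ℝ)
    (vext : EuclideanSpace ℝ (Fin d) → ℝ) (vxc : ℝ → ℝ)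
    (ρ : EuclideanSpace ℝ (Fin d) → ℝ) (E : ℝ) : Matrix (PW A E) (PW A E) ℂ :=
  fun G G' => ∫ r in unitCell A,
    conj (planeWave A G.1 r) * ksOperator A vext vxc ρ (planeWave A G'.1) r

/-- The shifted and rescaled matrix `a (K - b I)`. -/
def rescale {ι : Type*} [DecidableEq ι] (a b : ℝ) (K : Matrix ι ι ℂ) : Matrix ι ι ℂ :=
  (a : ℂ) • (K - (b : ℂ) • (1 : Matrix ι ι ℂ))

/-- Coordinatewise inclusion `ℝ^d → ℂ^d`. -/
def toComplex {d : ℕ} (r : EuclideanSpace ℝ (Fin d)) : EuclideanSpace ℂ (Fin d) :=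
  WithLp.toLp 2 fun i => (r i : ℂ)

/-- The strip `{z ∈ ℂ^d : |Im z| < σ}`. -/
def strip (d : ℕ) (σ : ℝ) : Set (EuclideanSpace ℂ (Fin d)) :=
  {z | Real.sqrt (∑ i, (z i).im ^ 2) < σ}

/-- Smoothness of a periodic potential: `V` is the restriction to `ℝ^d` of a holomorphic,
lattice-periodic function on the strip `|Im z| < σ` that is bounded by `c`. -/
def IsAnalyticPotential {d : ℕ} (A : Matrix.GeneralLinearGroup (Fin d) ℝ) (c σ : ℝ)
    (V : EuclideanSpace ℝ (Fin d) → ℝ) : Prop :=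
  ∃ F : EuclideanSpace ℂ (Fin d) → ℂ,
    DifferentiableOn ℂ F (strip d σ) ∧
    (∀ z ∈ strip d σ, ‖F z‖ ≤ c) ∧
    (∀ z ∈ strip d σ, ∀ k : Fin d → ℤ,
      F (z + toComplex (latticeMap A fun i => (k i : ℝ))) = F z) ∧
    ∀ r, F (toComplex r) = (V r : ℂ)

/-! ### Smearing function and Chebyshev expansion -/

/-- The Fermi-Dirac function `f_μ`. -/
def fermiDirac (β μ x : ℝ) : ℝ := 1 / (1 + Real.exp (β * (x - μ)))

/-- The square root of the rescaled smearing function, `x ↦ f_μ(x / a + b)^{1/2}`. -/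
def sqrtSmear (β μ a b x : ℝ) : ℝ := Real.sqrt (fermiDirac β μ (x / a + b))

/-- The `m`-th Chebyshev coefficient of `g` on `[-1,1]`. -/
def chebCoeff (g : ℝ → ℝ) (m : ℕ) : ℝ :=
  (if m = 0 then 1 else 2) / Real.pi *
    ∫ θ in (0 : ℝ)..Real.pi, g (Real.cos θ) * Real.cos (m * θ)

/-- The Chebyshev expansion `p_M = ∑_{m ≤ M} c_m T_m` of `g`. -/
def chebPoly (g : ℝ → ℝ) (M : ℕ) : ℝ[X] :=
  ∑ m ∈ Finset.range (M + 1), Polynomial.C (chebCoeff g m) * Polynomial.Chebyshev.T ℝ (m : ℤ)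

/-- `‖p_M - g‖_{L^∞([-1,1])} ≤ κ exp(-α M)` for all orders `M`. -/
def ChebRate (g : ℝ → ℝ) (κ α : ℝ) : Prop :=
  ∀ M : ℕ, ∀ x ∈ Set.Icc (-1 : ℝ) 1, |(chebPoly g M).eval x - g x| ≤ κ * Real.exp (-α * M)

/-! ### Random orbitals and the multilevel scheme -/

/-- A random orbital: independent entries with `E[χ χ^h] = I`. -/
def IsRandomOrbital {ι S : Type*} [DecidableEq ι] [MeasurableSpace S] (Pr : Measure S)
    (χ : ι → S → ℂ) : Prop :=
  (∀ i, Measurable (χ i)) ∧ iIndepFun χ Pr ∧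
    ∀ i j, ∫ ω, χ i ω * conj (χ j ω) ∂Pr = (1 : Matrix ι ι ℂ) i j

/-- The additional moment conditions `E[χ_i²] = 0` and `E[|χ_i|⁴] = 1`. -/
def HasOrbitalMoments {ι S : Type*} [MeasurableSpace S] (Pr : Measure S)
    (χ : ι → S → ℂ) : Prop :=
  ∀ i, ∫ ω, χ i ω ^ 2 ∂Pr = 0 ∧ ∫ ω, ‖χ i ω‖ ^ 4 ∂Pr = 1

/-- The variance of a random matrix, the sum of the variances of its entries. -/
def matrixVariance {ι S : Type*} [Fintype ι] [MeasurableSpace S] (Pr : Measure S)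
    (X : S → Matrix ι ι ℂ) : ℝ :=
  ∑ i, ∑ j, ∫ ω, ‖X ω i j - ∫ ω', X ω' i j ∂Pr‖ ^ 2 ∂Pr

/-- The rank-one matrix `(Q χ)(Q χ)^h`. -/
def orbitalMatrix {ι : Type*} [Fintype ι] (Q : Matrix ι ι ℂ) (x : ι → ℂ) : Matrix ι ι ℂ :=
  Matrix.vecMulVec (Q.mulVec x) (star (Q.mulVec x))

open Classical in
/-- Zero-padding of a matrix over the plane waves with cutoff `E'` to those with cutoff `E`. -/
def zeroPad {d : ℕ} (A : Matrix.GeneralLinearGroup (Fin d) ℝ) (E' E : ℝ)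
    (B : Matrix (PW A E') (PW A E') ℂ) : Matrix (PW A E) (PW A E) ℂ :=
  fun G G' =>
    if h : G.1 ∈ cutoffSet A E' ∧ G'.1 ∈ cutoffSet A E' then B ⟨G.1, h.1⟩ ⟨G'.1, h.2⟩ else 0

/-- The approximation of `p_M(H[P])` from the cutoff `E'`: the zero-padded `p_M` of the
rescaled Hamiltonian with cutoff `E'`, where `p_M` is the Chebyshev expansion of
`f_μ(· / a + b)^{1/2}`. -/
def levelApprox {d : ℕ} (A : Matrix.GeneralLinearGroup (Fin d) ℝ)
    (vext : EuclideanSpace ℝ (Fin d) → ℝ) (vxc : ℝ → ℝ) (ρ : EuclideanSpace ℝ (Fin d) → ℝ)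
    (β μ a b : ℝ) (M : ℕ) (E' E : ℝ) : Matrix (PW A E) (PW A E) ℂ :=
  zeroPad A E' E
    (Polynomial.aeval (rescale a b (ksMatrix A vext vxc ρ E')) (chebPoly (sqrtSmear β μ a b) M))

/-- The variance `Var[φ_χ^{(ℓ)} - φ_χ^{(ℓ-1)}]` between two levels with cutoffs `E₁ = E_c^{(ℓ)}`
and `E₀ = E_c^{(ℓ-1)}`, the finest cutoff being `E`. -/
def levelVariance {d : ℕ} (A : Matrix.GeneralLinearGroup (Fin d) ℝ)
    (vext : EuclideanSpace ℝ (Fin d) → ℝ) (vxc : ℝ → ℝ) (ρ : EuclideanSpace ℝ (Fin d) → ℝ)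
    (β μ a b : ℝ) (M : ℕ) (E₁ E₀ E : ℝ) {S : Type*} [MeasurableSpace S] (Pr : Measure S)
    (χ : PW A E → S → ℂ) : ℝ :=
  matrixVariance Pr fun ω =>
    orbitalMatrix (levelApprox A vext vxc ρ β μ a b M E₁ E) (fun G => χ G ω) -
      orbitalMatrix (levelApprox A vext vxc ρ β μ a b M E₀ E) (fun G => χ G ω)

end StochDFT

end

/-!
The two moment conditions force `|χ_i| = 1` almost surely, so `χ` is a vector of independent random
phases and distinct off-diagonal entries of `χ χ^h` are uncorrelated. Hence
`Var[(Qχ)(Qχ)^h - (Rχ)(Rχ)^h] ≤ 2 ‖Q - R‖² (‖Q‖² + ‖R‖²)` in the Frobenius norm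
(`matrixVariance_orbitalMatrix_sub_le`), and it remains to estimate these norms independently of the
size of the basis. Up to Chebyshev errors, `Q` and `R` are the zero-padded matrices
`F_ℓ = f_μ(K_ℓ)^{1/2}`, where `K_ℓ` is the compression of `K` to the smaller plane-wave basis.

The norm of `F_ℓ` is at most `√N` by Cauchy interlacing, since `‖F_ℓ‖² = Tr f_μ(K_ℓ)` and `f_μ` is
decreasing. Interlacing is used as a matching of eigenvalues
(`exists_injective_le_of_compression`), which carries over to sums of any decreasing function.

The difference `F_ℓ - F_{ℓ-1}` is small because all `F_ℓ` are bounded in a norm with weight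
`exp (δ |G|)` on one side (`frobSq_weight_mul_cfc_le`). Shifting contours shows that the Fourier
coefficients of a potential holomorphic in a strip decay exponentially
(`exists_norm_cellFourier_le_exp`), so by Schur's test the potential stays bounded after conjugation
with the weight, and an Agmon estimate bounds the weighted eigenvectors by `exp (β λ / 4)` up to
constants (`sum_weight_sq_mul_eigenvector_sq_le`). This growth is absorbed by the decay of `f_μ`.
The remaining factor `exp (β μ)` is bounded because `Tr f_μ(K) = N` while the lowest `N + 1` eigenvalues
of `K` are bounded independently of the basis (`exp_mul_fermiLevel_le`). To pass from weighted
bounds to differences, let `J` be the inclusion of the smaller basis: in the eigenbases of the two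
Hamiltonians the entries of `F_ℓ J - J F_{ℓ-1}` are divided differences of the square root of `f_μ`,
which is log-Lipschitz with constant `β / 2`, times the entries of `K_ℓ J - J K_{ℓ-1}`; the latter
matrix lives outside of the smaller basis, where the weight is at least `exp (δ √(2 E))` for the
smaller cutoff `E` (`frobSq_cfc_mul_sub_mul_cfc_le`, `frobSq_cfc_sub_pad_cfc_le`).

The Chebyshev rate holds since the Chebyshev series of `g` is the Fourier series of `g ∘ cos`, and
the square root of `f_μ` is holomorphic and bounded by `1` on the strip `|Im z| < π / (2 β)`,
whatever the Fermi level (`exists_chebRate_sqrtSmear`).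
-/

namespace StochDFT

/-! ### Frobenius norms -/

open Matrix in
/-- The squared Frobenius norm of a matrix. -/
noncomputable def frobSq {m n : Type*} [Fintype m] [Fintype n] (X : Matrix m n ℂ) : ℝ :=
  ∑ i, ∑ j, ‖X i j‖ ^ 2

section Frobenius

open Matrix

variable {l m n : Type*} [Fintype l] [Fintype m] [Fintype n]

theorem frobSq_nonneg (X : Matrix m n ℂ) : 0 ≤ frobSq X := by
  unfold frobSq; positivity

theorem frobSq_conjTranspose (X : Matrix m n ℂ) : frobSq Xᴴ = frobSq X := by
  unfold frobSq
  rw [Finset.sum_comm]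
  simp [conjTranspose_apply]

theorem trace_conjTranspose_mul_self (X : Matrix m n ℂ) :
    (Xᴴ * X).trace = (frobSq X : ℂ) := by
  unfold frobSq
  rw [Finset.sum_comm]
  simp [trace, mul_apply, conjTranspose_apply, Complex.conj_mul']

theorem frobSq_isometry_mul [DecidableEq m] {J : Matrix l m ℂ} (hJ : Jᴴ * J = 1)
    (X : Matrix m n ℂ) : frobSq (J * X) = frobSq X := by
  have h : (J * X)ᴴ * (J * X) = Xᴴ * X := by
    rw [conjTranspose_mul, Matrix.mul_assoc, ← Matrix.mul_assoc Jᴴ, hJ, Matrix.one_mul]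
  have := trace_conjTranspose_mul_self (J * X)
  rw [h, trace_conjTranspose_mul_self] at this
  exact_mod_cast this.symm

theorem frobSq_mul_conjTranspose_isometry [DecidableEq n] {J : Matrix l n ℂ} (hJ : Jᴴ * J = 1)
    (X : Matrix m n ℂ) : frobSq (X * Jᴴ) = frobSq X := by
  rw [← frobSq_conjTranspose, conjTranspose_mul, conjTranspose_conjTranspose,
    frobSq_isometry_mul hJ, frobSq_conjTranspose]

theorem norm_add_sq_le_two_mul (x y : ℂ) : ‖x + y‖ ^ 2 ≤ 2 * ‖x‖ ^ 2 + 2 * ‖y‖ ^ 2 := by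
  nlinarith [norm_add_le x y, norm_nonneg (x + y), sq_nonneg (‖x‖ - ‖y‖)]

theorem frobSq_add_le (X Y : Matrix m n ℂ) : frobSq (X + Y) ≤ 2 * frobSq X + 2 * frobSq Y := by
  unfold frobSq
  simp_rw [Finset.mul_sum, ← Finset.sum_add_distrib]
  gcongr
  exact norm_add_sq_le_two_mul _ _

theorem frobSq_neg (X : Matrix m n ℂ) : frobSq (-X) = frobSq X := by
  simp [frobSq]

theorem frobSq_sub_le (X Y : Matrix m n ℂ) : frobSq (X - Y) ≤ 2 * frobSq X + 2 * frobSq Y := by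
  rw [sub_eq_add_neg, ← frobSq_neg Y]
  exact frobSq_add_le _ _

theorem frobSq_le_of_norm_le {X Y : Matrix m n ℂ} {c : ℝ}
    (h : ∀ i j, ‖X i j‖ ≤ c * ‖Y i j‖) : frobSq X ≤ c ^ 2 * frobSq Y := by
  unfold frobSq
  simp_rw [Finset.mul_sum, ← mul_pow]
  gcongr with i _ j _
  exact h i j

/-- Schur's test for matrices dominated by a summable convolution kernel. -/
theorem sum_norm_mulVec_sq_le {Λ : Type*} [AddCommGroup Λ] {t : Λ → ℝ} (ht : Summable t)
    (ht0 : ∀ k, 0 ≤ t k) {p : m → Λ} {q : n → Λ} (hp : Function.Injective p)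
    (hq : Function.Injective q) {A : Matrix m n ℂ} (hA : ∀ i j, ‖A i j‖ ≤ t (p i - q j))
    (x : n → ℂ) : ∑ i, ‖(A *ᵥ x) i‖ ^ 2 ≤ (∑' k, t k) ^ 2 * ∑ j, ‖x j‖ ^ 2 := by
  have hrow : ∀ i, ∑ j, t (p i - q j) ≤ ∑' k, t k := fun i => by
    have hinj : Function.Injective fun j => p i - q j := fun a b h => hq (sub_right_injective h)
    simpa [tsum_fintype] using (tsum_comp_le_tsum_of_inj ht ht0 hinj)
  have hcol : ∀ j, ∑ i, t (p i - q j) ≤ ∑' k, t k := fun j => by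
    have hinj : Function.Injective fun i => p i - q j := fun a b h => hp (sub_left_injective h)
    simpa [tsum_fintype] using (tsum_comp_le_tsum_of_inj ht ht0 hinj)
  have hS : 0 ≤ ∑' k, t k := tsum_nonneg ht0
  have key : ∀ i, ‖(A *ᵥ x) i‖ ^ 2 ≤ (∑' k, t k) * ∑ j, t (p i - q j) * ‖x j‖ ^ 2 := fun i => by
    have h1 : ‖(A *ᵥ x) i‖ ≤ ∑ j, t (p i - q j) * ‖x j‖ := by
      refine (norm_sum_le _ _).trans (Finset.sum_le_sum fun j _ => ?_)
      rw [norm_mul]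
      exact mul_le_mul_of_nonneg_right (hA i j) (norm_nonneg _)
    have h2 : (∑ j, t (p i - q j) * ‖x j‖) ^ 2 ≤
        (∑ j, t (p i - q j)) * ∑ j, t (p i - q j) * ‖x j‖ ^ 2 := by
      refine Finset.sum_sq_le_sum_mul_sum_of_sq_le_mul _ (fun j _ => ht0 _)
        (fun j _ => mul_nonneg (ht0 _) (sq_nonneg _)) fun j _ => le_of_eq (by ring)
    calc ‖(A *ᵥ x) i‖ ^ 2 ≤ (∑ j, t (p i - q j) * ‖x j‖) ^ 2 := by gcongr
      _ ≤ _ := h2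
      _ ≤ _ := by
        refine mul_le_mul_of_nonneg_right (hrow i) (Finset.sum_nonneg fun j _ => ?_)
        exact mul_nonneg (ht0 _) (sq_nonneg _)
  calc ∑ i, ‖(A *ᵥ x) i‖ ^ 2
      ≤ ∑ i, (∑' k, t k) * ∑ j, t (p i - q j) * ‖x j‖ ^ 2 := Finset.sum_le_sum fun i _ => key i
    _ = (∑' k, t k) * ∑ j, (∑ i, t (p i - q j)) * ‖x j‖ ^ 2 := by
        rw [← Finset.mul_sum, Finset.sum_comm]
        simp_rw [Finset.sum_mul]
    _ ≤ (∑' k, t k) * ∑ j, (∑' k, t k) * ‖x j‖ ^ 2 := by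
        gcongr with j _
        exact hcol j
    _ = _ := by rw [← Finset.mul_sum]; ring

theorem frobSq_mul_le {Λ : Type*} [AddCommGroup Λ] {t : Λ → ℝ} (ht : Summable t)
    (ht0 : ∀ k, 0 ≤ t k) {p : m → Λ} {q : n → Λ} (hp : Function.Injective p)
    (hq : Function.Injective q) {A : Matrix m n ℂ} (hA : ∀ i j, ‖A i j‖ ≤ t (p i - q j))
    (X : Matrix n l ℂ) : frobSq (A * X) ≤ (∑' k, t k) ^ 2 * frobSq X := by
  unfold frobSq
  rw [Finset.sum_comm, Finset.sum_comm (s := (Finset.univ : Finset n)), Finset.mul_sum]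
  exact Finset.sum_le_sum fun c _ =>
    sum_norm_mulVec_sq_le ht ht0 hp hq hA fun j => X j c

end Frobenius

/-! ### Interlacing of eigenvalues -/

section Interlacing

open Matrix

variable {ι κ : Type*} [Fintype ι] [Fintype κ]

theorem star_dotProduct_self (x : ι → ℂ) : star x ⬝ᵥ x = ((∑ i, ‖x i‖ ^ 2 : ℝ) : ℂ) := by
  simp [dotProduct, Complex.conj_mul']

theorem sum_le_sum_of_injective_le {lam : ι → ℝ} {nu : κ → ℝ} {f : κ → ι}
    (hf : Function.Injective f) (hle : ∀ k, lam (f k) ≤ nu k) {h : ℝ → ℝ} (hanti : Antitone h)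
    (hpos : ∀ x, 0 ≤ h x) : ∑ k, h (nu k) ≤ ∑ i, h (lam i) := by
  classical
  calc ∑ k, h (nu k) ≤ ∑ k, h (lam (f k)) := Finset.sum_le_sum fun k _ => hanti (hle k)
    _ = ∑ i ∈ Finset.univ.image f, h (lam i) := by
        rw [Finset.sum_image fun a _ b _ hab => hf hab]
    _ ≤ ∑ i, h (lam i) :=
        Finset.sum_le_sum_of_subset_of_nonneg (Finset.subset_univ _) fun i _ _ => hpos _

theorem sum_norm_mulVec_sq_of_isometry [DecidableEq κ] {W : Matrix ι κ ℂ} (hW : Wᴴ * W = 1)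
    (x : κ → ℂ) :
    ∑ i, ‖(W *ᵥ x) i‖ ^ 2 = ∑ k, ‖x k‖ ^ 2 := by
  have h : star (W *ᵥ x) ⬝ᵥ (W *ᵥ x) = star x ⬝ᵥ x := by
    rw [star_mulVec, ← dotProduct_mulVec, mulVec_mulVec, hW, one_mulVec]
  rw [star_dotProduct_self, star_dotProduct_self] at h
  exact_mod_cast h

variable [DecidableEq ι] [DecidableEq κ]

theorem star_dotProduct_diagonal_mulVec (v : ι → ℝ) (x : ι → ℂ) :
    star x ⬝ᵥ (diagonal (fun i => (v i : ℂ)) *ᵥ x) = ((∑ i, v i * ‖x i‖ ^ 2 : ℝ) : ℂ) := by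
  simp only [dotProduct, mulVec_diagonal, Pi.star_apply, RCLike.star_def]
  push_cast
  refine Finset.sum_congr rfl fun i _ => ?_
  rw [← Complex.conj_mul']; ring

/-- The counting form of the min-max principle: a form `diagonal lam` restricted along an isometry
and dominated by `diagonal nu` has at least as many values below any level. The eigenspace of
`nu` below `t` cannot be mapped into the one of `lam` above `t`. -/
theorem card_le_card_of_compression {W : Matrix ι κ ℂ} (hW : Wᴴ * W = 1) {lam : ι → ℝ}
    {nu : κ → ℝ}
    (h : (diagonal (fun k => (nu k : ℂ)) - Wᴴ * diagonal (fun i => (lam i : ℂ)) * W).PosSemidef)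
    (t : ℝ) : Fintype.card {k // nu k ≤ t} ≤ Fintype.card {i // lam i ≤ t} := by
  classical
  by_contra! hlt
  let E : ({k // nu k ≤ t} → ℂ) →ₗ[ℂ] (κ → ℂ) :=
    { toFun := fun x k => if hk : nu k ≤ t then x ⟨k, hk⟩ else 0
      map_add' := fun x y => by ext k; by_cases hk : nu k ≤ t <;> simp [hk]
      map_smul' := fun c x => by ext k; by_cases hk : nu k ≤ t <;> simp [hk] }
  let R : (ι → ℂ) →ₗ[ℂ] ({i // lam i ≤ t} → ℂ) := LinearMap.funLeft ℂ ℂ Subtype.val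
  obtain ⟨x, hx, hx0⟩ := (Submodule.ne_bot_iff _).1
    (LinearMap.ker_ne_bot_of_finrank_lt (f := R ∘ₗ W.mulVecLin ∘ₗ E) (by simpa using hlt))
  have hE0 : E x ≠ 0 := by
    intro hE
    refine hx0 (funext fun k => ?_)
    have := congrFun hE k.1
    simpa [E, k.2] using this
  have hlow : ∀ i, lam i ≤ t → (W *ᵥ E x) i = 0 := fun i hi => by
    have := congrFun (LinearMap.mem_ker.1 hx) ⟨i, hi⟩
    simpa [R, LinearMap.funLeft_apply] using this
  have hquad : ∑ i, lam i * ‖(W *ᵥ E x) i‖ ^ 2 ≤ ∑ k, nu k * ‖E x k‖ ^ 2 := by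
    have h1 := h.dotProduct_mulVec_nonneg (E x)
    rw [sub_mulVec, dotProduct_sub, star_dotProduct_diagonal_mulVec, ← mulVec_mulVec,
      ← mulVec_mulVec, dotProduct_mulVec, ← star_mulVec, star_dotProduct_diagonal_mulVec] at h1
    have h2 : (0 : ℂ) ≤ ((∑ k, nu k * ‖E x k‖ ^ 2 - ∑ i, lam i * ‖(W *ᵥ E x) i‖ ^ 2 : ℝ) : ℂ) := by
      rw [Complex.ofReal_sub]; exact h1
    have := Complex.zero_le_real.1 h2
    linarith
  have hup : ∑ k, nu k * ‖E x k‖ ^ 2 ≤ t * ∑ k, ‖E x k‖ ^ 2 := by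
    rw [Finset.mul_sum]
    refine Finset.sum_le_sum fun k _ => ?_
    by_cases hk : nu k ≤ t
    · gcongr
    · simp [E, hk]
  have hne : ∃ i, (W *ᵥ E x) i ≠ 0 := by
    by_contra! hall
    have h0 := sum_norm_mulVec_sq_of_isometry hW (E x)
    simp only [hall, norm_zero, ne_eq, OfNat.ofNat_ne_zero, not_false_eq_true, zero_pow,
      Finset.sum_const_zero] at h0
    refine hE0 (funext fun k => ?_)
    have := (Finset.sum_eq_zero_iff_of_nonneg (fun k _ => sq_nonneg ‖E x k‖)).1 h0.symm k
      (Finset.mem_univ k)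
    simpa using this
  obtain ⟨i₀, hi₀⟩ := hne
  have hdown : t * ∑ i, ‖(W *ᵥ E x) i‖ ^ 2 < ∑ i, lam i * ‖(W *ᵥ E x) i‖ ^ 2 := by
    rw [Finset.mul_sum]
    refine Finset.sum_lt_sum (fun i _ => ?_) ⟨i₀, Finset.mem_univ _, ?_⟩
    · by_cases hi : lam i ≤ t
      · simp [hlow i hi]
      · push Not at hi; gcongr
    · have hi : t < lam i₀ := by
        by_contra! hi; exact hi₀ (hlow i₀ hi)
      have : 0 < ‖(W *ᵥ E x) i₀‖ := norm_pos_iff.2 hi₀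
      gcongr
  rw [sum_norm_mulVec_sq_of_isometry hW] at hdown
  linarith

/-- Cauchy interlacing, in the form of a matching of the eigenvalues; the matching is provided by
Hall's theorem from the counting form of the min-max principle. -/
theorem exists_injective_le_of_compression {W : Matrix ι κ ℂ} (hW : Wᴴ * W = 1) {lam : ι → ℝ}
    {nu : κ → ℝ}
    (h : (diagonal (fun k => (nu k : ℂ)) -
      Wᴴ * diagonal (fun i => (lam i : ℂ)) * W).PosSemidef) :
    ∃ f : κ → ι, Function.Injective f ∧ ∀ k, lam (f k) ≤ nu k := by
  classical
  let T : κ → Finset ι := fun k => Finset.univ.filter fun i => lam i ≤ nu k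
  have hall : ∀ s : Finset κ, s.card ≤ (s.biUnion T).card := by
    intro s
    rcases s.eq_empty_or_nonempty with rfl | hs
    · simp
    obtain ⟨k₀, hk₀, hmax⟩ := s.exists_max_image nu hs
    calc s.card ≤ (Finset.univ.filter fun k => nu k ≤ nu k₀).card :=
          Finset.card_le_card fun k hk => by simpa using hmax k hk
      _ = Fintype.card {k // nu k ≤ nu k₀} := (Fintype.card_subtype _).symm
      _ ≤ Fintype.card {i // lam i ≤ nu k₀} := card_le_card_of_compression hW h _
      _ = (T k₀).card := Fintype.card_subtype _
      _ ≤ (s.biUnion T).card := Finset.card_le_card (Finset.subset_biUnion_of_mem T hk₀)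
  obtain ⟨f, hf, hfT⟩ := (Finset.all_card_le_biUnion_card_iff_exists_injective T).1 hall
  exact ⟨f, hf, fun k => by simpa [T] using hfT k⟩

end Interlacing

/-! ### Functions of Hermitian matrices -/

section Spectral

open Matrix

variable {ι κ : Type*} [Fintype ι] [Fintype κ] [DecidableEq ι]

theorem norm_star_dotProduct_mulVec_le {ι : Type*} [Fintype ι] {V : Matrix ι ι ℂ} {c : ℝ}
    (hc : 0 ≤ c) {x : ι → ℂ}
    (hV : ∑ i, ‖(V *ᵥ x) i‖ ^ 2 ≤ c ^ 2 * ∑ i, ‖x i‖ ^ 2) :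
    ‖star x ⬝ᵥ V *ᵥ x‖ ≤ c * ∑ i, ‖x i‖ ^ 2 := by
  have h1 : ‖star x ⬝ᵥ V *ᵥ x‖ ≤ ∑ i, ‖x i‖ * ‖(V *ᵥ x) i‖ := by
    refine (norm_sum_le _ _).trans (le_of_eq ?_)
    simp
  have h2 := Finset.sum_mul_sq_le_sq_mul_sq Finset.univ (fun i => ‖x i‖) fun i => ‖(V *ᵥ x) i‖
  have h3 : 0 ≤ ∑ i, ‖x i‖ ^ 2 := by positivity
  refine h1.trans (abs_le_of_sq_le_sq' (h2.trans ?_) (by positivity)).2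
  nlinarith [mul_le_mul_of_nonneg_left hV h3]

theorem posSemidef_of_re_nonneg {ι : Type*} [Fintype ι] {B : Matrix ι ι ℂ} (hB : B.IsHermitian)
    (h : ∀ x : ι → ℂ, 0 ≤ (star x ⬝ᵥ B *ᵥ x).re) : B.PosSemidef := by
  refine PosSemidef.of_dotProduct_mulVec_nonneg hB fun x => ?_
  rw [Complex.nonneg_iff]
  exact ⟨h x, (hB.im_star_dotProduct_mulVec_self x).symm⟩

/-- The unitary matrix of eigenvectors of a Hermitian matrix. -/
noncomputable abbrev eigMat {K : Matrix ι ι ℂ} (hK : K.IsHermitian) : Matrix ι ι ℂ :=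
  (hK.eigenvectorUnitary : Matrix ι ι ℂ)

/-- A real diagonal matrix, with complex entries. -/
noncomputable abbrev rdiag (v : ι → ℝ) : Matrix ι ι ℂ := diagonal fun i => (v i : ℂ)

theorem isHermitian_rdiag {ι : Type*} [DecidableEq ι] (v : ι → ℝ) : (rdiag v).IsHermitian := by
  rw [IsHermitian, rdiag, diagonal_conjTranspose]
  congr 1
  ext i
  simp

variable {K : Matrix ι ι ℂ} (hK : K.IsHermitian)

theorem eigMat_conjTranspose_mul_self : (eigMat hK)ᴴ * eigMat hK = 1 :=
  Unitary.coe_star_mul_self hK.eigenvectorUnitary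

theorem eigMat_mul_conjTranspose_self : eigMat hK * (eigMat hK)ᴴ = 1 :=
  Unitary.coe_mul_star_self hK.eigenvectorUnitary

theorem cfc_eq_conj_rdiag (f : ℝ → ℝ) :
    hK.cfc f = eigMat hK * rdiag (fun j => f (hK.eigenvalues j)) * (eigMat hK)ᴴ := by
  rw [IsHermitian.cfc, Unitary.conjStarAlgAut_apply]
  rfl

theorem eq_conj_rdiag : K = eigMat hK * rdiag hK.eigenvalues * (eigMat hK)ᴴ := by
  conv_lhs => rw [hK.spectral_theorem, Unitary.conjStarAlgAut_apply]
  rfl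

theorem conj_eigMat_cfc (f : ℝ → ℝ) :
    (eigMat hK)ᴴ * hK.cfc f = rdiag (fun j => f (hK.eigenvalues j)) * (eigMat hK)ᴴ := by
  rw [cfc_eq_conj_rdiag, ← Matrix.mul_assoc, ← Matrix.mul_assoc,
    eigMat_conjTranspose_mul_self, Matrix.one_mul]

theorem cfc_mul_eigMat (f : ℝ → ℝ) :
    hK.cfc f * eigMat hK = eigMat hK * rdiag (fun j => f (hK.eigenvalues j)) := by
  rw [cfc_eq_conj_rdiag, Matrix.mul_assoc, eigMat_conjTranspose_mul_self, Matrix.mul_one]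

theorem conj_eigMat_mul :
    (eigMat hK)ᴴ * K = rdiag hK.eigenvalues * (eigMat hK)ᴴ := by
  conv_lhs => arg 2; rw [eq_conj_rdiag hK]
  rw [← Matrix.mul_assoc, ← Matrix.mul_assoc, eigMat_conjTranspose_mul_self, Matrix.one_mul]

theorem mul_eigMat : K * eigMat hK = eigMat hK * rdiag hK.eigenvalues := by
  conv_lhs => arg 1; rw [eq_conj_rdiag hK]
  rw [Matrix.mul_assoc, eigMat_conjTranspose_mul_self, Matrix.mul_one]

theorem conj_eigMat_mul_mul_eigMat :
    (eigMat hK)ᴴ * K * eigMat hK = rdiag hK.eigenvalues := by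
  rw [conj_eigMat_mul, Matrix.mul_assoc, eigMat_conjTranspose_mul_self, Matrix.mul_one]

theorem cfc_conjTranspose (f : ℝ → ℝ) : (hK.cfc f)ᴴ = hK.cfc f := by
  rw [cfc_eq_conj_rdiag, conjTranspose_mul, conjTranspose_mul, conjTranspose_conjTranspose,
    (isHermitian_rdiag _).eq,
    Matrix.mul_assoc]

theorem trace_cfc (f : ℝ → ℝ) : (hK.cfc f).trace = ((∑ j, f (hK.eigenvalues j) : ℝ) : ℂ) := by
  rw [cfc_eq_conj_rdiag, trace_mul_comm, ← Matrix.mul_assoc, eigMat_conjTranspose_mul_self,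
    Matrix.one_mul]
  simp [trace]

theorem frobSq_mul_eigMat (X : Matrix κ ι ℂ) : frobSq (X * eigMat hK) = frobSq X := by
  have h : ((eigMat hK)ᴴ)ᴴ * (eigMat hK)ᴴ = 1 := by
    rw [conjTranspose_conjTranspose, eigMat_mul_conjTranspose_self]
  simpa using frobSq_mul_conjTranspose_isometry h X

theorem frobSq_conj_eigMat_mul (X : Matrix ι κ ℂ) : frobSq ((eigMat hK)ᴴ * X) = frobSq X := by
  refine frobSq_isometry_mul ?_ X
  rw [conjTranspose_conjTranspose, eigMat_mul_conjTranspose_self]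

theorem frobSq_rdiag (v : ι → ℝ) : frobSq (rdiag v) = ∑ i, v i ^ 2 := by
  unfold frobSq
  refine Finset.sum_congr rfl fun i _ => ?_
  rw [Finset.sum_eq_single i]
  · simp
  · intro j _ hj; simp [diagonal_apply_ne' _ hj]
  · simp

theorem frobSq_cfc (f : ℝ → ℝ) : frobSq (hK.cfc f) = ∑ j, f (hK.eigenvalues j) ^ 2 := by
  rw [← frobSq_conj_eigMat_mul hK, ← frobSq_mul_eigMat hK, Matrix.mul_assoc, cfc_mul_eigMat,
    ← Matrix.mul_assoc, eigMat_conjTranspose_mul_self, Matrix.one_mul, frobSq_rdiag]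

theorem frobSq_mul_cfc (f : ℝ → ℝ) (X : Matrix κ ι ℂ) :
    frobSq (X * hK.cfc f) =
      ∑ j, f (hK.eigenvalues j) ^ 2 * ∑ i, ‖(X * eigMat hK) i j‖ ^ 2 := by
  rw [← frobSq_mul_eigMat hK, Matrix.mul_assoc, cfc_mul_eigMat, ← Matrix.mul_assoc]
  unfold frobSq
  rw [Finset.sum_comm]
  refine Finset.sum_congr rfl fun j _ => ?_
  rw [Finset.mul_sum]
  refine Finset.sum_congr rfl fun i _ => ?_
  rw [mul_diagonal, norm_mul, mul_pow, mul_comm]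
  simp

theorem exists_injective_eigenvalues_le [DecidableEq κ] {B : Matrix κ κ ℂ} (hB : B.IsHermitian)
    {J : Matrix ι κ ℂ} (hJ : Jᴴ * J = 1) (h : (B - Jᴴ * K * J).PosSemidef) :
    ∃ f : κ → ι, Function.Injective f ∧ ∀ k, hK.eigenvalues (f k) ≤ hB.eigenvalues k := by
  refine exists_injective_le_of_compression (W := (eigMat hK)ᴴ * J * eigMat hB) ?_ ?_
  · rw [conjTranspose_mul, conjTranspose_mul, conjTranspose_conjTranspose]
    calc (eigMat hB)ᴴ * (Jᴴ * eigMat hK) * ((eigMat hK)ᴴ * J * eigMat hB)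
        = (eigMat hB)ᴴ * (Jᴴ * (eigMat hK * (eigMat hK)ᴴ) * J) * eigMat hB := by
          simp only [Matrix.mul_assoc]
      _ = 1 := by
          rw [eigMat_mul_conjTranspose_self, Matrix.mul_one, hJ, Matrix.mul_one,
            eigMat_conjTranspose_mul_self]
  · have := h.conjTranspose_mul_mul_same (eigMat hB)
    rw [Matrix.mul_sub, Matrix.sub_mul, conj_eigMat_mul_mul_eigMat] at this
    convert this using 2
    rw [conjTranspose_mul, conjTranspose_mul, conjTranspose_conjTranspose]
    conv_rhs => rw [eq_conj_rdiag hK]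
    simp only [Matrix.mul_assoc]

theorem exists_injective_eigenvalues_le_of_rdiag {nu : ι → ℝ}
    (h : (rdiag nu - K).PosSemidef) :
    ∃ f : ι → ι, Function.Injective f ∧ ∀ k, hK.eigenvalues (f k) ≤ nu k := by
  refine exists_injective_le_of_compression (W := (eigMat hK)ᴴ) ?_ ?_
  · rw [conjTranspose_conjTranspose, eigMat_mul_conjTranspose_self]
  · rwa [conjTranspose_conjTranspose, ← eq_conj_rdiag hK]

theorem exists_injective_rdiag_le_eigenvalues {lam : ι → ℝ}
    (h : (K - rdiag lam).PosSemidef) :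
    ∃ f : ι → ι, Function.Injective f ∧ ∀ k, lam (f k) ≤ hK.eigenvalues k := by
  refine exists_injective_le_of_compression (W := eigMat hK)
    (eigMat_conjTranspose_mul_self hK) ?_
  have := h.conjTranspose_mul_mul_same (eigMat hK)
  rwa [Matrix.mul_sub, Matrix.sub_mul, conj_eigMat_mul_mul_eigMat] at this

theorem posSemidef_rdiag_add_sub {T : ι → ℝ} {V : Matrix ι ι ℂ} (hV : V.IsHermitian) {c : ℝ}
    (hc : 0 ≤ c) (hVc : ∀ x : ι → ℂ, ∑ i, ‖(V *ᵥ x) i‖ ^ 2 ≤ c ^ 2 * ∑ i, ‖x i‖ ^ 2) :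
    (rdiag (fun i => T i + c) - (rdiag T + V)).PosSemidef ∧
      (rdiag T + V - rdiag (fun i => T i - c)).PosSemidef := by
  have e1 : rdiag (fun i => T i + c) - (rdiag T + V) = rdiag (fun _ => c) - V := by
    have : rdiag (fun i => T i + c) = rdiag T + rdiag (fun _ => c) := by
      simp [rdiag, diagonal_add]
    rw [this]; abel
  have e2 : rdiag T + V - rdiag (fun i => T i - c) = rdiag (fun _ => c) + V := by
    have : rdiag (fun i => T i - c) = rdiag T - rdiag (fun _ => c) := by
      simp [rdiag, diagonal_sub]
    rw [this]; abel
  have hb : ∀ x : ι → ℂ, |(star x ⬝ᵥ V *ᵥ x).re| ≤ c * ∑ i, ‖x i‖ ^ 2 := fun x =>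
    (Complex.abs_re_le_norm _).trans (norm_star_dotProduct_mulVec_le hc (hVc x))
  have hd : ∀ x : ι → ℂ, (star x ⬝ᵥ rdiag (fun _ => c) *ᵥ x).re = c * ∑ i, ‖x i‖ ^ 2 := fun x => by
    rw [star_dotProduct_diagonal_mulVec (fun _ => c), Complex.ofReal_re, Finset.mul_sum]
  rw [e1, e2]
  constructor
  · refine posSemidef_of_re_nonneg ((isHermitian_rdiag _).sub hV) fun x => ?_
    rw [sub_mulVec, dotProduct_sub, Complex.sub_re, hd]
    linarith [(abs_le.1 (hb x)).2]
  · refine posSemidef_of_re_nonneg ((isHermitian_rdiag _).add hV) fun x => ?_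
    rw [add_mulVec, dotProduct_add, Complex.add_re, hd]
    linarith [(abs_le.1 (hb x)).1]

/-- Commuting a function of Hermitian matrices with an intertwiner `J`. In the two eigenbases the
entries of `f(K) J - J f(B)` are divided differences of `f` times the entries of `K J - J B`, so a
bound on the divided differences by `f(x) + f(y)` moves the decay of `f` onto the defect. -/
theorem frobSq_cfc_mul_sub_mul_cfc_le [DecidableEq κ] {B : Matrix κ κ ℂ} (hB : B.IsHermitian)
    (J : Matrix ι κ ℂ) {f : ℝ → ℝ} {b : ℝ}
    (hf : ∀ x y, |f x - f y| ≤ b * |x - y| * (f x + f y)) :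
    frobSq (hK.cfc f * J - J * hB.cfc f) ≤
      2 * b ^ 2 * (frobSq (hK.cfc f * (K * J - J * B)) + frobSq ((K * J - J * B) * hB.cfc f)) := by
  set U := eigMat hK
  set W := eigMat hB
  set S := Uᴴ * J * W with hS
  set R := K * J - J * B with hR
  have hr : ∀ i k, (Uᴴ * R * W) i k = ((hK.eigenvalues i : ℂ) - hB.eigenvalues k) * S i k := by
    intro i k
    have : Uᴴ * R * W = rdiag hK.eigenvalues * S - S * rdiag hB.eigenvalues := by
      rw [hR, Matrix.mul_sub, Matrix.sub_mul, ← Matrix.mul_assoc, conj_eigMat_mul hK,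
        ← Matrix.mul_assoc Uᴴ J B, Matrix.mul_assoc (Uᴴ * J) B, mul_eigMat hB]
      simp only [hS, Matrix.mul_assoc]
      rfl
    rw [this, Matrix.sub_apply, diagonal_mul, mul_diagonal]
    ring
  have hl : ∀ i k, (Uᴴ * (hK.cfc f * J - J * hB.cfc f) * W) i k =
      ((f (hK.eigenvalues i) : ℂ) - f (hB.eigenvalues k)) * S i k := by
    intro i k
    have : Uᴴ * (hK.cfc f * J - J * hB.cfc f) * W =
        rdiag (fun j => f (hK.eigenvalues j)) * S - S * rdiag (fun j => f (hB.eigenvalues j)) := by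
      rw [Matrix.mul_sub, Matrix.sub_mul, ← Matrix.mul_assoc, conj_eigMat_cfc hK,
        ← Matrix.mul_assoc Uᴴ J, Matrix.mul_assoc (Uᴴ * J), cfc_mul_eigMat hB]
      simp only [hS, Matrix.mul_assoc]
      rfl
    rw [this, Matrix.sub_apply, diagonal_mul, mul_diagonal]
    ring
  have h1 : frobSq (hK.cfc f * R) =
      ∑ i, ∑ k, f (hK.eigenvalues i) ^ 2 * ‖(Uᴴ * R * W) i k‖ ^ 2 := by
    rw [← frobSq_conj_eigMat_mul hK, ← frobSq_mul_eigMat hB, ← Matrix.mul_assoc,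
      conj_eigMat_cfc hK, Matrix.mul_assoc, Matrix.mul_assoc]
    unfold frobSq
    refine Finset.sum_congr rfl fun i _ => Finset.sum_congr rfl fun k _ => ?_
    rw [diagonal_mul, norm_mul, mul_pow, ← Matrix.mul_assoc]
    simp [U, W]
  have h2 : frobSq (R * hB.cfc f) =
      ∑ i, ∑ k, f (hB.eigenvalues k) ^ 2 * ‖(Uᴴ * R * W) i k‖ ^ 2 := by
    rw [← frobSq_conj_eigMat_mul hK, ← frobSq_mul_eigMat hB, Matrix.mul_assoc, Matrix.mul_assoc,
      cfc_mul_eigMat hB, ← Matrix.mul_assoc, ← Matrix.mul_assoc]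
    unfold frobSq
    refine Finset.sum_congr rfl fun i _ => Finset.sum_congr rfl fun k _ => ?_
    rw [mul_diagonal, norm_mul, mul_pow, mul_comm]
    simp [U, W]
  rw [h1, h2, ← Finset.sum_add_distrib, Finset.mul_sum, ← frobSq_conj_eigMat_mul hK,
    ← frobSq_mul_eigMat hB]
  refine Finset.sum_le_sum fun i _ => ?_
  rw [← Finset.sum_add_distrib, Finset.mul_sum]
  refine Finset.sum_le_sum fun k _ => ?_
  change ‖(Uᴴ * (hK.cfc f * J - J * hB.cfc f) * W) i k‖ ^ 2 ≤ _
  rw [hl, hr, norm_mul, norm_mul, ← Complex.ofReal_sub, ← Complex.ofReal_sub, Complex.norm_real,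
    Complex.norm_real, Real.norm_eq_abs, Real.norm_eq_abs]
  set x := hK.eigenvalues i
  set y := hB.eigenvalues k
  have h3 : |f x - f y| ^ 2 ≤ (b * |x - y| * (f x + f y)) ^ 2 := by
    gcongr
    exact hf x y
  calc (|f x - f y| * ‖S i k‖) ^ 2 = |f x - f y| ^ 2 * ‖S i k‖ ^ 2 := by ring
    _ ≤ (b * |x - y| * (f x + f y)) ^ 2 * ‖S i k‖ ^ 2 := by gcongr
    _ = (b * |x - y| * ‖S i k‖) ^ 2 * (f x + f y) ^ 2 := by ring
    _ ≤ (b * |x - y| * ‖S i k‖) ^ 2 * (2 * (f x ^ 2 + f y ^ 2)) := by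
        gcongr
        nlinarith [sq_nonneg (f x - f y)]
    _ = _ := by ring

end Spectral

/-! ### Decay of eigenvectors and of spectral functions -/

section Decay

open Matrix

variable {ι κ : Type*} [Fintype ι] [Fintype κ] [DecidableEq ι]

/-- Agmon-type estimate: an eigenvector of `T + V` is small where `T` exceeds its eigenvalue, in
every weight `w` for which `w V w⁻¹` is bounded. -/
theorem sum_weight_sq_mul_eigenvector_sq_le {V : Matrix ι ι ℂ} {T w : ι → ℝ} (hw : ∀ i, 0 < w i)
    {c : ℝ} (hc : 0 < c)
    (hV : ∀ x : ι → ℂ, ∑ i, ‖((of fun i j => (w i / w j : ℂ) * V i j) *ᵥ x) i‖ ^ 2 ≤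
      c ^ 2 * ∑ i, ‖x i‖ ^ 2)
    {lam : ℝ} {ψ : ι → ℂ} (hψ : (rdiag T + V) *ᵥ ψ = (lam : ℂ) • ψ)
    (hn : ∑ i, ‖ψ i‖ ^ 2 = 1) {B : ℝ} (hB0 : 0 ≤ B)
    (hB : ∀ i, T i ≤ lam + 2 * c → w i ^ 2 ≤ B) :
    ∑ i, w i ^ 2 * ‖ψ i‖ ^ 2 ≤ 2 * B := by
  set φ : ι → ℂ := fun i => w i * ψ i with hφ
  have hnφ : ∀ i, ‖φ i‖ ^ 2 = w i ^ 2 * ‖ψ i‖ ^ 2 := fun i => by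
    simp [hφ, mul_pow]
  have hrel : ∀ i, ((of fun i j => (w i / w j : ℂ) * V i j) *ᵥ φ) i =
      ((lam - T i : ℝ) : ℂ) * φ i := by
    intro i
    have h1 := congrFun hψ i
    rw [add_mulVec, Pi.add_apply, mulVec_diagonal, Pi.smul_apply, smul_eq_mul] at h1
    have h2 : ((of fun i j => (w i / w j : ℂ) * V i j) *ᵥ φ) i = w i * (V *ᵥ ψ) i := by
      simp only [mulVec, dotProduct, of_apply, hφ, Finset.mul_sum]
      refine Finset.sum_congr rfl fun j _ => ?_
      have : (w j : ℂ) ≠ 0 := by exact_mod_cast (hw j).ne'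
      field_simp
    rw [h2, hφ]
    push_cast
    linear_combination (w i : ℂ) * h1
  have hS := hV φ
  simp only [hrel, norm_mul, mul_pow, Complex.norm_real, Real.norm_eq_abs, sq_abs] at hS
  -- where `T > lam + 2 c`, the factor `(lam - T)²` dominates the squared norm of `w V w⁻¹`
  have hterm : ∀ i, ‖φ i‖ ^ 2 ≤
      B * ‖ψ i‖ ^ 2 + (1 / (4 * c ^ 2)) * ((lam - T i) ^ 2 * ‖φ i‖ ^ 2) := by
    intro i
    by_cases hi : T i ≤ lam + 2 * c
    · have := hB i hi
      calc ‖φ i‖ ^ 2 = w i ^ 2 * ‖ψ i‖ ^ 2 := hnφ i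
        _ ≤ B * ‖ψ i‖ ^ 2 := by gcongr
        _ ≤ _ := le_add_of_nonneg_right (by positivity)
    · push Not at hi
      have h4 : 4 * c ^ 2 ≤ (lam - T i) ^ 2 := by nlinarith
      calc ‖φ i‖ ^ 2 = (1 / (4 * c ^ 2)) * (4 * c ^ 2 * ‖φ i‖ ^ 2) := by field_simp
        _ ≤ (1 / (4 * c ^ 2)) * ((lam - T i) ^ 2 * ‖φ i‖ ^ 2) := by gcongr
        _ ≤ _ := le_add_of_nonneg_left (by positivity)
  have hsum : ∑ i, ‖φ i‖ ^ 2 ≤ B + (1 / (4 * c ^ 2)) * (c ^ 2 * ∑ i, ‖φ i‖ ^ 2) := by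
    calc ∑ i, ‖φ i‖ ^ 2
        ≤ ∑ i, (B * ‖ψ i‖ ^ 2 + (1 / (4 * c ^ 2)) * ((lam - T i) ^ 2 * ‖φ i‖ ^ 2)) :=
          Finset.sum_le_sum fun i _ => hterm i
      _ = B + (1 / (4 * c ^ 2)) * ∑ i, (lam - T i) ^ 2 * ‖φ i‖ ^ 2 := by
          rw [Finset.sum_add_distrib, ← Finset.mul_sum, ← Finset.mul_sum, hn, mul_one]
      _ ≤ _ := by gcongr
  have h5 : (1 / (4 * c ^ 2)) * (c ^ 2 * ∑ i, ‖φ i‖ ^ 2) = (∑ i, ‖φ i‖ ^ 2) / 4 := by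
    field_simp
  rw [h5] at hsum
  simp_rw [← hnφ]
  linarith

end Decay

/-! ### The Fermi-Dirac function -/

section Fermi

variable {β : ℝ} (μ : ℝ)

theorem fermiDirac_pos (β x : ℝ) : 0 < fermiDirac β μ x := by
  unfold fermiDirac; positivity

theorem fermiDirac_lt_one (β x : ℝ) : fermiDirac β μ x < 1 := by
  unfold fermiDirac
  rw [div_lt_one (by positivity)]
  linarith [Real.exp_pos (β * (x - μ))]

theorem fermiDirac_antitone (hβ : 0 < β) : Antitone (fermiDirac β μ) := by
  intro x y hxy
  unfold fermiDirac
  gcongr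

theorem fermiDirac_le_exp (β x : ℝ) :
    fermiDirac β μ x ≤ Real.exp (β * μ) * Real.exp (-(β * x)) := by
  unfold fermiDirac
  rw [← Real.exp_add, div_le_iff₀ (by positivity), mul_add, ← Real.exp_add]
  have : β * μ + -(β * x) + β * (x - μ) = 0 := by ring
  rw [this, Real.exp_zero]
  linarith [Real.exp_pos (β * μ + -(β * x))]

theorem exp_mul_fermiDirac_le (hβ : 0 < β) {x y : ℝ} (hxy : x ≤ y) :
    Real.exp (-(β * (y - x))) * fermiDirac β μ x ≤ fermiDirac β μ y := by
  unfold fermiDirac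
  rw [mul_one_div, div_le_div_iff₀ (by positivity) (by positivity), mul_add, ← Real.exp_add,
    one_mul, mul_one]
  have : -(β * (y - x)) + β * (y - μ) = β * (x - μ) := by ring
  rw [this]
  have : Real.exp (-(β * (y - x))) ≤ 1 := Real.exp_le_one_iff.2 (by nlinarith)
  linarith

/-- The square root of the Fermi-Dirac function is log-Lipschitz with constant `β / 2`. -/
theorem abs_sqrt_fermiDirac_sub_le (hβ : 0 < β) (x y : ℝ) :
    |√(fermiDirac β μ x) - √(fermiDirac β μ y)| ≤
      β / 2 * |x - y| * (√(fermiDirac β μ x) + √(fermiDirac β μ y)) := by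
  wlog hxy : x ≤ y generalizing x y
  · have := this y x (le_of_not_ge hxy)
    rwa [abs_sub_comm, abs_sub_comm y x, add_comm (√(fermiDirac β μ y))] at this
  have h1 : √(fermiDirac β μ y) ≤ √(fermiDirac β μ x) :=
    Real.sqrt_le_sqrt (fermiDirac_antitone μ hβ hxy)
  have h2 : Real.exp (-(β * (y - x)) / 2) * √(fermiDirac β μ x) ≤ √(fermiDirac β μ y) := by
    rw [Real.exp_half, ← Real.sqrt_mul (Real.exp_pos _).le]
    exact Real.sqrt_le_sqrt (exp_mul_fermiDirac_le μ hβ hxy)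
  have h3 := Real.add_one_le_exp (-(β * (y - x)) / 2)
  have h4 := Real.sqrt_nonneg (fermiDirac β μ x)
  have h5 := Real.sqrt_nonneg (fermiDirac β μ y)
  have h6 := mul_le_mul_of_nonneg_right h3 h4
  have h7 : 0 ≤ β / 2 * (y - x) * √(fermiDirac β μ y) := by
    have : 0 ≤ y - x := by linarith
    positivity
  rw [abs_of_nonneg (by linarith), abs_of_nonpos (by linarith)]
  linarith

end Fermi

/-! ### Exponential localisation and compression to a smaller basis -/

section Kernel

open Matrix

variable {Λ : Type*} [AddCommGroup Λ] {nm : Λ → ℝ} {δ a β : ℝ}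
  {ι κ : Type*} [Fintype ι] [Fintype κ] {p : ι → Λ} {V : Matrix ι ι ℂ}

/-- The bound, by Schur's test, of the norm of a matrix with entries at most
`a exp (-2 δ |i - j|)`, conjugated with the weight `exp (δ |i|)`. The summand `1` keeps it
positive. -/
noncomputable def kernelBound {Λ : Type*} (nm : Λ → ℝ) (δ a : ℝ) : ℝ :=
  a * ∑' k, Real.exp (-(δ * nm k)) + 1

theorem tsum_kernel_le {Λ : Type*} (nm : Λ → ℝ) (δ a : ℝ) :
    ∑' k, a * Real.exp (-(δ * nm k)) ≤ kernelBound nm δ a := by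
  rw [tsum_mul_left, kernelBound]; linarith

theorem kernelBound_pos {Λ : Type*} {nm : Λ → ℝ} {δ a : ℝ} (ha : 0 ≤ a) :
    0 < kernelBound nm δ a := by
  have : 0 ≤ ∑' k, Real.exp (-(δ * nm k)) := tsum_nonneg fun k => (Real.exp_pos _).le
  unfold kernelBound; positivity

theorem kernel_le {Λ : Type*} {nm : Λ → ℝ} {δ a : ℝ} (hnm : ∀ k, 0 ≤ nm k) (hδ : 0 ≤ δ)
    (ha : 0 ≤ a) (k : Λ) :
    a * Real.exp (-(2 * δ * nm k)) ≤ a * Real.exp (-(δ * nm k)) := by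
  refine mul_le_mul_of_nonneg_left (Real.exp_le_exp.2 ?_) ha
  nlinarith [mul_nonneg hδ (hnm k)]

theorem weight_mul_kernel_le (hsub : ∀ k l, nm k ≤ nm (k - l) + nm l) (hδ : 0 ≤ δ) (ha : 0 ≤ a)
    (k l : Λ) :
    Real.exp (δ * nm k) / Real.exp (δ * nm l) * (a * Real.exp (-(2 * δ * nm (k - l)))) ≤
      a * Real.exp (-(δ * nm (k - l))) := by
  rw [← Real.exp_sub, mul_left_comm, ← Real.exp_add]
  gcongr
  nlinarith [mul_le_mul_of_nonneg_left (hsub k l) hδ]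

theorem frobSq_mul_le_kernelBound {m n l : Type*} [Fintype m] [Fintype n] [Fintype l]
    (hsum : Summable fun k => Real.exp (-(δ * nm k))) (ha : 0 ≤ a) {p : m → Λ} {q : n → Λ}
    (hp : Function.Injective p) (hq : Function.Injective q) {A : Matrix m n ℂ}
    (hA : ∀ i j, ‖A i j‖ ≤ a * Real.exp (-(δ * nm (p i - q j)))) (X : Matrix n l ℂ) :
    frobSq (A * X) ≤ kernelBound nm δ a ^ 2 * frobSq X := by
  refine (frobSq_mul_le (hsum.mul_left a) (fun k => by positivity) hp hq hA X).trans ?_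
  have := frobSq_nonneg X
  have h0 : 0 ≤ ∑' k, a * Real.exp (-(δ * nm k)) := tsum_nonneg fun k => by positivity
  gcongr
  exact tsum_kernel_le nm δ a

theorem sum_norm_mulVec_sq_le_kernelBound
    (hsum : Summable fun k => Real.exp (-(δ * nm k))) (ha : 0 ≤ a)
    (hp : Function.Injective p) {A : Matrix ι ι ℂ}
    (hA : ∀ i j, ‖A i j‖ ≤ a * Real.exp (-(δ * nm (p i - p j)))) (x : ι → ℂ) :
    ∑ i, ‖(A *ᵥ x) i‖ ^ 2 ≤ kernelBound nm δ a ^ 2 * ∑ j, ‖x j‖ ^ 2 := by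
  refine (sum_norm_mulVec_sq_le (hsum.mul_left a) (fun k => by positivity) hp hp hA x).trans ?_
  have h0 : 0 ≤ ∑' k, a * Real.exp (-(δ * nm k)) := tsum_nonneg fun k => by positivity
  gcongr
  exact tsum_kernel_le nm δ a

variable [DecidableEq ι] [DecidableEq κ]

/-- The kinetic energies `|G|² / 2`. -/
noncomputable def kinetic {Λ ι : Type*} (nm : Λ → ℝ) (p : ι → Λ) (i : ι) : ℝ := nm (p i) ^ 2 / 2

theorem posSemidef_kinetic_comparison (hsum : Summable fun k => Real.exp (-(δ * nm k)))
    (hnm : ∀ k, 0 ≤ nm k) (hδ : 0 ≤ δ) (ha : 0 ≤ a) (hp : Function.Injective p)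
    (hVh : V.IsHermitian)
    (hV : ∀ i j, ‖V i j‖ ≤ a * Real.exp (-(2 * δ * nm (p i - p j)))) :
    (rdiag (fun i => kinetic nm p i + kernelBound nm δ a) -
        (rdiag (kinetic nm p) + V)).PosSemidef ∧
      (rdiag (kinetic nm p) + V -
        rdiag (fun i => kinetic nm p i - kernelBound nm δ a)).PosSemidef :=
  posSemidef_rdiag_add_sub hVh (kernelBound_pos ha).le
    (sum_norm_mulVec_sq_le_kernelBound hsum ha hp
      fun i j => (hV i j).trans (kernel_le hnm hδ ha _))

/-- The weighted Frobenius norm of the square root of the Fermi-Dirac matrix is bounded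
independently of the basis: the growth of the weighted eigenvectors with the eigenvalue is paid for
by half of the decay of the Fermi-Dirac function, and the other half is summed by comparison with
the free kinetic energies. -/
theorem frobSq_weight_mul_cfc_le (hβ : 0 < β)
    (hsum : Summable fun k => Real.exp (-(δ * nm k)))
    (hnm : ∀ k, 0 ≤ nm k) (hsub : ∀ k l, nm k ≤ nm (k - l) + nm l) (hδ : 0 ≤ δ) (ha : 0 ≤ a)
    (hp : Function.Injective p) (hVh : V.IsHermitian)
    (hV : ∀ i j, ‖V i j‖ ≤ a * Real.exp (-(2 * δ * nm (p i - p j))))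
    (hK : (rdiag (kinetic nm p) + V).IsHermitian) (μ : ℝ) :
    frobSq (rdiag (fun i => Real.exp (δ * nm (p i))) *
        hK.cfc fun x => √(fermiDirac β μ x)) ≤
      2 * Real.exp (3 / 2 * β * kernelBound nm δ a + 5 * δ ^ 2 / β) *
        (∑' k, Real.exp (-(δ * nm k))) * Real.exp (β * μ) := by
  set c := kernelBound nm δ a with hc
  have hc0 : 0 < c := kernelBound_pos ha
  set w : ι → ℝ := fun i => Real.exp (δ * nm (p i)) with hw
  have hvec : ∀ j, ∑ i, w i ^ 2 * ‖eigMat hK i j‖ ^ 2 ≤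
      2 * Real.exp (β * (hK.eigenvalues j + 2 * c) / 2 + 4 * δ ^ 2 / β) := by
    intro j
    refine sum_weight_sq_mul_eigenvector_sq_le (V := V) (T := kinetic nm p)
      (ψ := fun i => eigMat hK i j) (lam := hK.eigenvalues j) (fun i => Real.exp_pos _) hc0 ?_ ?_ ?_
      (Real.exp_pos _).le ?_
    · refine sum_norm_mulVec_sq_le_kernelBound hsum ha hp fun i k => ?_
      refine le_trans ?_ (weight_mul_kernel_le hsub hδ ha (p i) (p k))
      rw [of_apply, norm_mul, norm_div, Complex.norm_real, Complex.norm_real, Real.norm_eq_abs,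
        Real.norm_eq_abs, Real.abs_exp, Real.abs_exp]
      gcongr
      exact hV i k
    · ext i
      have := congrFun (congrFun (mul_eigMat hK) i) j
      rw [mul_diagonal, mul_comm] at this
      exact this
    · have := congrFun (congrFun (eigMat_conjTranspose_mul_self hK) j) j
      rw [mul_apply, one_apply_eq] at this
      simp only [conjTranspose_apply, RCLike.star_def, Complex.conj_mul'] at this
      exact_mod_cast this
    · intro i hi
      rw [← Real.exp_nat_mul]
      refine Real.exp_le_exp.2 ?_
      have h1 : β * (nm (p i) ^ 2 / 2) ≤ β * (hK.eigenvalues j + 2 * c) :=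
        mul_le_mul_of_nonneg_left hi hβ.le
      -- Young's inequality: the exponent of the weight costs half of the kinetic energy
      have h2 : 2 * (δ * nm (p i)) ≤ β * nm (p i) ^ 2 / 4 + 4 * δ ^ 2 / β := by
        have : 0 ≤ (β * nm (p i) / 2 - 2 * δ) ^ 2 / β := by positivity
        have e : (β * nm (p i) / 2 - 2 * δ) ^ 2 / β =
            β * nm (p i) ^ 2 / 4 + 4 * δ ^ 2 / β - 2 * (δ * nm (p i)) := by
          field_simp; ring
        linarith
      push_cast
      linarith
  obtain ⟨f, hf, hfle⟩ := exists_injective_rdiag_le_eigenvalues hK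
    (posSemidef_kinetic_comparison hsum hnm hδ ha hp hVh hV).2
  have hpart : ∑ j, Real.exp (-(β / 2 * hK.eigenvalues j)) ≤
      ∑ i, Real.exp (-(β / 2 * (kinetic nm p i - c))) :=
    sum_le_sum_of_injective_le (h := fun x => Real.exp (-(β / 2 * x))) hf hfle
      (fun x y hxy => by dsimp only; gcongr) fun x => (Real.exp_pos _).le
  have hfree : ∑ i, Real.exp (-(β / 2 * (kinetic nm p i - c))) ≤
      Real.exp (β * c / 2 + δ ^ 2 / β) * ∑' k, Real.exp (-(δ * nm k)) := by
    calc ∑ i, Real.exp (-(β / 2 * (kinetic nm p i - c)))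
        ≤ ∑ i, Real.exp (β * c / 2 + δ ^ 2 / β) * Real.exp (-(δ * nm (p i))) := by
          refine Finset.sum_le_sum fun i _ => ?_
          rw [← Real.exp_add]
          refine Real.exp_le_exp.2 ?_
          have : 0 ≤ (β * nm (p i) / 2 - δ) ^ 2 / β := by positivity
          have e : (β * nm (p i) / 2 - δ) ^ 2 / β =
              β / 2 * (nm (p i) ^ 2 / 2) + δ ^ 2 / β - δ * nm (p i) := by
            field_simp; ring
          unfold kinetic
          linarith
      _ = Real.exp (β * c / 2 + δ ^ 2 / β) * ∑ i, Real.exp (-(δ * nm (p i))) := by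
          rw [Finset.mul_sum]
      _ ≤ _ := by
          gcongr
          simpa [tsum_fintype] using
            tsum_comp_le_tsum_of_inj hsum (fun k => (Real.exp_pos _).le) hp
  rw [frobSq_mul_cfc]
  calc ∑ j, √(fermiDirac β μ (hK.eigenvalues j)) ^ 2 *
        ∑ i, ‖(rdiag w * eigMat hK) i j‖ ^ 2
      ≤ ∑ j, 2 * Real.exp (β * c + 4 * δ ^ 2 / β) * Real.exp (β * μ) *
          Real.exp (-(β / 2 * hK.eigenvalues j)) := by
        refine Finset.sum_le_sum fun j _ => ?_
        rw [Real.sq_sqrt (fermiDirac_pos μ β _).le]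
        have e1 : ∑ i, ‖(rdiag w * eigMat hK) i j‖ ^ 2 = ∑ i, w i ^ 2 * ‖eigMat hK i j‖ ^ 2 := by
          refine Finset.sum_congr rfl fun i _ => ?_
          rw [diagonal_mul, norm_mul, mul_pow, Complex.norm_real, Real.norm_eq_abs, sq_abs]
        rw [e1]
        calc fermiDirac β μ (hK.eigenvalues j) * ∑ i, w i ^ 2 * ‖eigMat hK i j‖ ^ 2
            ≤ (Real.exp (β * μ) * Real.exp (-(β * hK.eigenvalues j))) *
              (2 * Real.exp (β * (hK.eigenvalues j + 2 * c) / 2 + 4 * δ ^ 2 / β)) := by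
              have : 0 ≤ ∑ i, w i ^ 2 * ‖eigMat hK i j‖ ^ 2 := by positivity
              gcongr
              · exact fermiDirac_le_exp μ β _
              · exact hvec j
          _ = 2 * (Real.exp (-(β * hK.eigenvalues j)) *
                Real.exp (β * (hK.eigenvalues j + 2 * c) / 2 + 4 * δ ^ 2 / β)) *
                Real.exp (β * μ) := by ring
          _ = 2 * (Real.exp (β * c + 4 * δ ^ 2 / β) *
                Real.exp (-(β / 2 * hK.eigenvalues j))) * Real.exp (β * μ) := by
              rw [← Real.exp_add, ← Real.exp_add]
              congr 3
              ring
          _ = _ := by ring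
    _ = 2 * Real.exp (β * c + 4 * δ ^ 2 / β) * Real.exp (β * μ) *
          ∑ j, Real.exp (-(β / 2 * hK.eigenvalues j)) := by rw [Finset.mul_sum]
    _ ≤ 2 * Real.exp (β * c + 4 * δ ^ 2 / β) * Real.exp (β * μ) *
          (Real.exp (β * c / 2 + δ ^ 2 / β) * ∑' k, Real.exp (-(δ * nm k))) := by
        gcongr
        exact hpart.trans hfree
    _ = 2 * (Real.exp (β * c + 4 * δ ^ 2 / β) * Real.exp (β * c / 2 + δ ^ 2 / β)) *
          (∑' k, Real.exp (-(δ * nm k))) * Real.exp (β * μ) := by ring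
    _ = _ := by
        rw [← Real.exp_add]
        congr 4
        ring

/-- Truncation of the basis: if both spectral functions are bounded in the weighted norm, then the
error is at most the square of the inverse weight outside of the smaller basis. -/
theorem frobSq_cfc_sub_pad_cfc_le (hsum : Summable fun k => Real.exp (-(δ * nm k)))
    (hnm : ∀ k, 0 ≤ nm k) (hsub : ∀ k l, nm k ≤ nm (k - l) + nm l) (hδ : 0 ≤ δ) (ha : 0 ≤ a)
    (hp : Function.Injective p) (hVh : V.IsHermitian)
    (hV : ∀ i j, ‖V i j‖ ≤ a * Real.exp (-(2 * δ * nm (p i - p j))))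
    (hK : (rdiag (kinetic nm p) + V).IsHermitian)
    {e : κ → ι} (he : Function.Injective e)
    (hK' : (rdiag (kinetic nm (p ∘ e)) + V.submatrix e e).IsHermitian)
    {f : ℝ → ℝ} {b : ℝ} (hf : ∀ x y, |f x - f y| ≤ b * |x - y| * (f x + f y)) {B : ℝ}
    (hB : frobSq (rdiag (fun i => Real.exp (δ * nm (p i))) * hK.cfc f) ≤ B)
    (hB' : frobSq (rdiag (fun i => Real.exp (δ * nm (p (e i)))) * hK'.cfc f) ≤ B)
    {r : ℝ} (hr : ∀ i, i ∉ Set.range e → r ≤ nm (p i)) :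
    frobSq (hK.cfc f - (1 : Matrix ι ι ℂ).submatrix id e * hK'.cfc f *
        ((1 : Matrix ι ι ℂ).submatrix id e)ᴴ) ≤
      (8 * b ^ 2 * kernelBound nm δ a ^ 2 + 2) * B * Real.exp (-(δ * r)) ^ 2 := by
  classical
  set J : Matrix ι κ ℂ := (1 : Matrix ι ι ℂ).submatrix id e with hJ
  set F := hK.cfc f with hF
  set F' := hK'.cfc f with hF'
  set c := kernelBound nm δ a with hc
  set K := rdiag (kinetic nm p) + V with hKdef
  set K' := rdiag (kinetic nm (p ∘ e)) + V.submatrix e e with hK'def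
  -- the projection onto the complement of the smaller basis
  set Q : Matrix ι ι ℂ := diagonal fun i => if i ∈ Set.range e then 0 else 1 with hQ
  have hJJ : Jᴴ * J = 1 := by
    ext k l
    simp [hJ, mul_apply, one_apply, he.eq_iff, eq_comm]
  have hQJ : 1 - J * Jᴴ = Q := by
    ext i j
    have hJi : (J * Jᴴ) i j = ∑ k, if i = e k then (if j = e k then (1 : ℂ) else 0) else 0 := by
      refine Finset.sum_congr rfl fun k _ => ?_
      simp only [hJ, conjTranspose_apply, submatrix_apply, id, one_apply]
      split_ifs <;> simp
    rw [Matrix.sub_apply, hJi, hQ, diagonal_apply, one_apply]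
    by_cases hi : i ∈ Set.range e
    · rw [if_pos hi]
      obtain ⟨k, rfl⟩ := hi
      simp [he.eq_iff, eq_comm]
    · have : ∀ k, i ≠ e k := fun k h => hi ⟨k, h.symm⟩
      rw [if_neg hi]
      simp [this]
  have hQh : Qᴴ = Q := by
    rw [hQ, diagonal_conjTranspose]
    congr 1; ext i
    by_cases hi : i ∈ Set.range e
    · rw [Pi.star_apply, if_pos hi, star_zero]
    · rw [Pi.star_apply, if_neg hi, star_one]
  -- the compression intertwines `K` and `K'` except for the couplings that leave the smaller basis
  have hR : K * J - J * K' = Q * V.submatrix id e := by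
    ext i k
    rw [Matrix.sub_apply, hQ, diagonal_mul, submatrix_apply]
    have h1 : (K * J) i k = K i (e k) := by
      simp [hJ, mul_apply, one_apply]
    rw [h1]
    by_cases hi : i ∈ Set.range e
    · obtain ⟨l, rfl⟩ := hi
      have h2 : (J * K') (e l) k = K' l k := by
        simp [hJ, mul_apply, one_apply, he.eq_iff]
      rw [h2]
      simp [hKdef, hK'def, diagonal_apply, he.eq_iff, kinetic]
    · have hne : ∀ k, i ≠ e k := fun k h => hi ⟨k, h.symm⟩
      have h2 : (J * K') i k = 0 := by
        simp [hJ, mul_apply, one_apply, hne]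
      rw [h2]
      simp [hKdef, hi, diagonal_apply_ne _ (hne k)]
  have hQF : frobSq (Q * F) ≤ Real.exp (-(δ * r)) ^ 2 * B := by
    refine (frobSq_le_of_norm_le (c := Real.exp (-(δ * r)))
      (Y := rdiag (fun i => Real.exp (δ * nm (p i))) * F) fun i j => ?_).trans (by gcongr)
    rw [hQ, diagonal_mul, diagonal_mul, norm_mul, norm_mul, Complex.norm_real, Real.norm_eq_abs,
      Real.abs_exp, ← mul_assoc, ← Real.exp_add]
    by_cases hi : i ∈ Set.range e
    · simp only [hi, if_true, norm_zero, zero_mul]; positivity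
    · simp only [hi, if_false, norm_one]
      gcongr
      rw [← Real.exp_zero]
      refine Real.exp_le_exp.2 ?_
      nlinarith [mul_le_mul_of_nonneg_left (hr i hi) hδ]
  -- on the left of the defect the projection meets `F` directly
  have hFR : frobSq (F * (K * J - J * K')) ≤ c ^ 2 * (Real.exp (-(δ * r)) ^ 2 * B) := by
    have : (F * (K * J - J * K'))ᴴ = V.submatrix e id * (Q * F) := by
      have hVs : (V.submatrix id e)ᴴ = V.submatrix e id := by
        rw [conjTranspose_submatrix, hVh.eq]
      rw [hR, conjTranspose_mul, conjTranspose_mul, hVs, hQh, hF, cfc_conjTranspose,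
        Matrix.mul_assoc]
    rw [← frobSq_conjTranspose, this]
    refine (frobSq_mul_le_kernelBound hsum ha (hp.comp he) hp (fun k i => ?_) _).trans
      (by gcongr)
    exact (hV (e k) i).trans (kernel_le hnm hδ ha _)
  -- on the right the weight has to be moved through the potential
  have hRF : frobSq ((K * J - J * K') * F') ≤ Real.exp (-(δ * r)) ^ 2 * (c ^ 2 * B) := by
    set A : Matrix ι κ ℂ := of fun i k =>
      ((Real.exp (δ * nm (p i)) / Real.exp (δ * nm (p (e k))) : ℝ) : ℂ) * V i (e k) with hA
    have hAle : frobSq (A * (rdiag (fun i => Real.exp (δ * nm (p (e i)))) * F')) ≤ c ^ 2 * B := by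
      refine (frobSq_mul_le_kernelBound hsum ha hp (hp.comp he) (fun i k => ?_) _).trans
        (by gcongr)
      refine le_trans ?_ (weight_mul_kernel_le hsub hδ ha (p i) (p (e k)))
      rw [hA, of_apply, norm_mul, Complex.norm_real, Real.norm_eq_abs,
        abs_of_nonneg (by positivity)]
      gcongr
      exact hV i (e k)
    refine (frobSq_le_of_norm_le (c := Real.exp (-(δ * r)))
      (Y := A * (rdiag (fun i => Real.exp (δ * nm (p (e i)))) * F'))
      fun i j => ?_).trans (by gcongr)
    have hAF : (A * (rdiag (fun i => Real.exp (δ * nm (p (e i)))) * F')) i j =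
        ((Real.exp (δ * nm (p i)) : ℝ) : ℂ) * (V.submatrix id e * F') i j := by
      rw [mul_apply, mul_apply, Finset.mul_sum]
      refine Finset.sum_congr rfl fun k _ => ?_
      rw [diagonal_mul, hA, of_apply, submatrix_apply, id]
      have : ((Real.exp (δ * nm (p (e k))) : ℝ) : ℂ) ≠ 0 := by
        exact_mod_cast (Real.exp_pos _).ne'
      rw [Complex.ofReal_div]
      field_simp
    rw [hR, hAF, Matrix.mul_assoc, hQ, diagonal_mul, norm_mul, norm_mul, Complex.norm_real,
      Real.norm_eq_abs, Real.abs_exp, ← mul_assoc, ← Real.exp_add]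
    by_cases hi : i ∈ Set.range e
    · simp only [hi, if_true, norm_zero, zero_mul]; positivity
    · simp only [hi, if_false, norm_one]
      gcongr
      rw [← Real.exp_zero]
      refine Real.exp_le_exp.2 ?_
      nlinarith [mul_le_mul_of_nonneg_left (hr i hi) hδ]
  have hsplit : F - J * F' * Jᴴ = (F * J - J * F') * Jᴴ + F * Q := by
    rw [← hQJ, Matrix.sub_mul, Matrix.mul_sub, Matrix.mul_one, Matrix.mul_assoc F]
    abel
  have hFQ : frobSq (F * Q) = frobSq (Q * F) := by
    rw [← frobSq_conjTranspose, conjTranspose_mul, hQh, hF, cfc_conjTranspose]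
  have hcomm := frobSq_cfc_mul_sub_mul_cfc_le hK hK' J hf
  calc frobSq (F - J * F' * Jᴴ)
      ≤ 2 * frobSq (F * J - J * F') + 2 * frobSq (Q * F) := by
        rw [hsplit, ← hFQ, ← frobSq_mul_conjTranspose_isometry hJJ (F * J - J * F')]
        exact frobSq_add_le _ _
    _ ≤ 2 * (2 * b ^ 2 * (c ^ 2 * (Real.exp (-(δ * r)) ^ 2 * B) +
          Real.exp (-(δ * r)) ^ 2 * (c ^ 2 * B))) + 2 * (Real.exp (-(δ * r)) ^ 2 * B) := by
        refine add_le_add (mul_le_mul_of_nonneg_left (hcomm.trans ?_) (by norm_num))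
          (mul_le_mul_of_nonneg_left hQF (by norm_num))
        exact mul_le_mul_of_nonneg_left (add_le_add hFR hRF) (by positivity)
    _ = _ := by ring

end Kernel

/-! ### The variance of a random rank-one matrix -/

section Variance

variable {ι S : Type*} [DecidableEq ι] [MeasurableSpace S] {Pr : Measure S}
  {χ : ι → S → ℂ}

/-- The moment conditions force random phases: `E |χ_i|² = E |χ_i|⁴ = 1` makes `|χ_i|²`
deterministic. -/
theorem IsRandomOrbital.norm_eq_one_ae [IsProbabilityMeasure Pr] (hχ : IsRandomOrbital Pr χ)
    (hm : HasOrbitalMoments Pr χ)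
    (i : ι) : ∀ᵐ ω ∂Pr, ‖χ i ω‖ = 1 := by
  have h4 := (hm i).2
  have h2 : ∫ ω, ‖χ i ω‖ ^ 2 ∂Pr = 1 := by
    have h := hχ.2.2 i i
    simp only [Complex.mul_conj', Matrix.one_apply_eq] at h
    have e : ∀ ω, (‖χ i ω‖ : ℂ) ^ 2 = ((‖χ i ω‖ ^ 2 : ℝ) : ℂ) := fun ω => by push_cast; rfl
    simp only [e, integral_complex_ofReal] at h
    exact_mod_cast h
  have i4 : Integrable (fun ω => ‖χ i ω‖ ^ 4) Pr := by
    by_contra h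
    rw [integral_undef h] at h4
    exact zero_ne_one h4
  have i2 : Integrable (fun ω => ‖χ i ω‖ ^ 2) Pr := by
    by_contra h
    rw [integral_undef h] at h2
    exact zero_ne_one h2
  have i5 : Integrable (fun ω => ‖χ i ω‖ ^ 4 - 2 * ‖χ i ω‖ ^ 2) Pr := i4.sub (i2.const_mul 2)
  have e : ∀ ω, (‖χ i ω‖ ^ 2 - 1) ^ 2 = ‖χ i ω‖ ^ 4 - 2 * ‖χ i ω‖ ^ 2 + 1 := fun ω => by ring
  have h0 : ∫ ω, (‖χ i ω‖ ^ 2 - 1) ^ 2 ∂Pr = 0 := by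
    simp only [e]
    rw [integral_add i5 (integrable_const 1), integral_sub i4 (i2.const_mul 2),
      integral_const_mul, h2, h4]
    simp
    norm_num
  have hint : Integrable (fun ω => (‖χ i ω‖ ^ 2 - 1) ^ 2) Pr := by
    simp only [e]
    exact i5.add (integrable_const 1)
  have := (integral_eq_zero_iff_of_nonneg (fun ω => sq_nonneg _) hint).1 h0
  filter_upwards [this] with ω hω
  have h1 : ‖χ i ω‖ ^ 2 = 1 := by
    have := pow_eq_zero_iff (two_ne_zero) |>.1 hω
    linarith
  exact (pow_eq_one_iff_of_nonneg (norm_nonneg _) two_ne_zero).1 h1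

theorem integral_mul_eq_mul_of_disjoint_pairs (hχ : IsRandomOrbital Pr χ) {i j k l : ι}
    (hik : i ≠ k) (hil : i ≠ l) (hjk : j ≠ k) (hjl : j ≠ l) {φ ψ : ℂ × ℂ → ℂ}
    (hφ : Continuous φ) (hψ : Continuous ψ) :
    ∫ ω, φ (χ i ω, χ j ω) * ψ (χ k ω, χ l ω) ∂Pr =
      (∫ ω, φ (χ i ω, χ j ω) ∂Pr) * ∫ ω, ψ (χ k ω, χ l ω) ∂Pr :=
  (hχ.2.1.indepFun_prodMk_prodMk hχ.1 i j k l hik hil hjk hjl).integral_fun_comp_mul_comp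
    ((hχ.1 i).prodMk (hχ.1 j)).aemeasurable ((hχ.1 k).prodMk (hχ.1 l)).aemeasurable
    hφ.aestronglyMeasurable hψ.aestronglyMeasurable

/-- Distinct off-diagonal entries of `χ χ^h` are uncorrelated. A shared index contributes the
factor `|χ_i|² = 1`; otherwise the indices split into two independent pairs, one of which has mean
zero. -/
theorem integral_offDiag_mul_conj_offDiag [IsProbabilityMeasure Pr] (hχ : IsRandomOrbital Pr χ)
    (hm : HasOrbitalMoments Pr χ) {i j k l : ι} (hij : i ≠ j) (hkl : k ≠ l)
    (hne : (i, j) ≠ (k, l)) :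
    ∫ ω, (χ i ω * conj (χ j ω)) * conj (χ k ω * conj (χ l ω)) ∂Pr = 0 := by
  have hone : ∀ i, ∀ᵐ ω ∂Pr, χ i ω * conj (χ i ω) = 1 := fun i => by
    filter_upwards [hχ.norm_eq_one_ae hm i] with ω hω
    rw [Complex.mul_conj', hω]; simp
  have hmean : ∀ {i j : ι}, i ≠ j → ∫ ω, χ i ω * conj (χ j ω) ∂Pr = 0 := fun {i j} h => by
    rw [hχ.2.2 i j, Matrix.one_apply_ne h]
  have hc1 : Continuous fun z : ℂ × ℂ => z.1 * z.2 := by fun_prop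
  have hc2 : Continuous fun z : ℂ × ℂ => conj (z.1 * z.2) :=
    Complex.continuous_conj.comp hc1
  have hc3 : Continuous fun z : ℂ × ℂ => z.1 * conj z.2 :=
    continuous_fst.mul (Complex.continuous_conj.comp continuous_snd)
  have hc4 : Continuous fun z : ℂ × ℂ => conj (z.1 * conj z.2) :=
    Complex.continuous_conj.comp hc3
  by_cases hik : i = k
  · subst hik
    have hjl : l ≠ j := fun h => hne (by rw [h])
    rw [← hmean hjl]
    refine integral_congr_ae ?_
    filter_upwards [hone i] with ω hω
    rw [map_mul, Complex.conj_conj]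
    linear_combination (χ l ω * conj (χ j ω)) * hω
  by_cases hjl : j = l
  · subst hjl
    rw [← hmean hik]
    refine integral_congr_ae ?_
    filter_upwards [hone j] with ω hω
    rw [map_mul, Complex.conj_conj]
    linear_combination (χ i ω * conj (χ k ω)) * hω
  by_cases hil : i = l
  · subst hil
    have := integral_mul_eq_mul_of_disjoint_pairs hχ hij hik hij hik hc1 hc2 (k := j) (l := k)
    calc _ = ∫ ω, χ i ω * χ i ω * conj (χ j ω * χ k ω) ∂Pr :=
          integral_congr_ae (.of_forall fun ω => by simp only [map_mul, Complex.conj_conj]; ring)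
      _ = 0 := by
          rw [this]
          simp only [← sq, (hm i).1, zero_mul]
  by_cases hjk : j = k
  · subst hjk
    have := integral_mul_eq_mul_of_disjoint_pairs hχ hij hij hkl.symm hkl.symm hc1 hc2
      (i := i) (j := l) (k := j) (l := j)
    calc _ = ∫ ω, χ i ω * χ l ω * conj (χ j ω * χ j ω) ∂Pr :=
          integral_congr_ae (.of_forall fun ω => by simp only [map_mul, Complex.conj_conj]; ring)
      _ = 0 := by
          rw [this, integral_conj]
          simp only [← sq, (hm j).1, map_zero, mul_zero]
  · have := integral_mul_eq_mul_of_disjoint_pairs hχ hik hil hjk hjl hc3 hc4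
    rw [this, hmean hij, zero_mul]

variable [Fintype ι]

/-- The variance of a sesquilinear form in random phases is at most the squared norm of its
coefficients. -/
theorem integral_norm_sesquilinear_sub_mean_sq_le [IsProbabilityMeasure Pr]
    (hχ : IsRandomOrbital Pr χ) (hm : HasOrbitalMoments Pr χ) (M : ι → ι → ℂ) :
    ∫ ω, ‖∑ i, ∑ j, M i j * (χ i ω * conj (χ j ω)) -
        ∫ ω', ∑ i, ∑ j, M i j * (χ i ω' * conj (χ j ω')) ∂Pr‖ ^ 2 ∂Pr ≤
      ∑ i, ∑ j, ‖M i j‖ ^ 2 := by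
  set y : ι × ι → S → ℂ := fun q ω => χ q.1 ω * conj (χ q.2 ω) with hy
  have hmeas : ∀ i, AEStronglyMeasurable (χ i) Pr := fun i => (hχ.1 i).aestronglyMeasurable
  have hym : ∀ q, AEStronglyMeasurable (y q) Pr := fun q =>
    (hmeas q.1).mul (Complex.continuous_conj.comp_aestronglyMeasurable (hmeas q.2))
  have hyn : ∀ q, ∀ᵐ ω ∂Pr, ‖y q ω‖ = 1 := fun q => by
    filter_upwards [hχ.norm_eq_one_ae hm q.1, hχ.norm_eq_one_ae hm q.2] with ω h1 h2
    simp [hy, h1, h2]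
  have hyi : ∀ q, Integrable (y q) Pr := fun q =>
    Integrable.of_bound (hym q) 1 ((hyn q).mono fun ω h => h.le)
  have hyyi : ∀ q r, Integrable (fun ω => y q ω * conj (y r ω)) Pr := fun q r => by
    refine Integrable.of_bound
      ((hym q).mul (Complex.continuous_conj.comp_aestronglyMeasurable (hym r))) 1 ?_
    filter_upwards [hyn q, hyn r] with ω h1 h2
    simp [h1, h2]
  have hmean : ∫ ω', ∑ i, ∑ j, M i j * (χ i ω' * conj (χ j ω')) ∂Pr = ∑ i, M i i := by
    rw [integral_finsetSum _ fun i _ => integrable_finsetSum _ fun j _ => (hyi (i, j)).const_mul _]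
    refine Finset.sum_congr rfl fun i _ => ?_
    rw [integral_finsetSum _ fun j _ => (hyi (i, j)).const_mul _]
    have h : ∀ j, ∫ ω, M i j * y (i, j) ω ∂Pr = M i j * (1 : Matrix ι ι ℂ) i j := fun j => by
      rw [integral_const_mul, ← hχ.2.2 i j]
    rw [Finset.sum_congr rfl fun j _ => h j]
    simp [Matrix.one_apply]
  have hdiag : ∀ᵐ ω ∂Pr, ∑ i, ∑ j, M i j * (χ i ω * conj (χ j ω)) - ∑ i, M i i =
      ∑ q ∈ Finset.univ.offDiag, M q.1 q.2 * y q ω := by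
    have hall : ∀ᵐ ω ∂Pr, ∀ i, ‖χ i ω‖ = 1 := ae_all_iff.2 fun i => hχ.norm_eq_one_ae hm i
    filter_upwards [hall] with ω hω
    rw [← Finset.sum_product', ← Finset.diag_union_offDiag,
      Finset.sum_union (Finset.disjoint_diag_offDiag _), Finset.sum_diag]
    have : ∀ i, M i i * (χ i ω * conj (χ i ω)) = M i i := fun i => by
      rw [Complex.mul_conj', hω]; simp
    simp only [this, hy]
    ring
  have hsq : ∀ᵐ ω ∂Pr, ((‖∑ i, ∑ j, M i j * (χ i ω * conj (χ j ω)) - ∑ i, M i i‖ ^ 2 : ℝ) : ℂ) =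
      ∑ q ∈ Finset.univ.offDiag, ∑ r ∈ Finset.univ.offDiag,
        M q.1 q.2 * conj (M r.1 r.2) * (y q ω * conj (y r ω)) := by
    filter_upwards [hdiag] with ω hω
    rw [hω, Complex.ofReal_pow, ← Complex.mul_conj', map_sum, Finset.sum_mul_sum]
    refine Finset.sum_congr rfl fun q _ => Finset.sum_congr rfl fun r _ => ?_
    rw [map_mul]; ring
  have hint : ∀ q ∈ (Finset.univ : Finset ι).offDiag, ∀ r ∈ (Finset.univ : Finset ι).offDiag,
      ∫ ω, M q.1 q.2 * conj (M r.1 r.2) * (y q ω * conj (y r ω)) ∂Pr =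
        if q = r then ((‖M q.1 q.2‖ ^ 2 : ℝ) : ℂ) else 0 := by
    intro q hq r hr
    rw [integral_const_mul]
    split_ifs with h
    · subst h
      have : ∫ ω, y q ω * conj (y q ω) ∂Pr = 1 := by
        rw [integral_congr_ae (g := fun _ => (1 : ℂ))]
        · simp
        · filter_upwards [hyn q] with ω hω
          rw [Complex.mul_conj', hω]; simp
      rw [this, Complex.mul_conj']
      simp
    · rw [integral_offDiag_mul_conj_offDiag hχ hm (Finset.mem_offDiag.1 hq).2.2
        (Finset.mem_offDiag.1 hr).2.2 h, mul_zero]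
  have key : ((∫ ω, ‖∑ i, ∑ j, M i j * (χ i ω * conj (χ j ω)) - ∑ i, M i i‖ ^ 2 ∂Pr : ℝ) : ℂ) =
      ((∑ q ∈ (Finset.univ : Finset ι).offDiag, ‖M q.1 q.2‖ ^ 2 : ℝ) : ℂ) := by
    rw [← integral_complex_ofReal, integral_congr_ae hsq,
      integral_finsetSum _ fun q _ => integrable_finsetSum _ fun r _ => (hyyi q r).const_mul _]
    rw [Complex.ofReal_sum]
    refine Finset.sum_congr rfl fun q hq => ?_
    rw [integral_finsetSum _ fun r _ => (hyyi q r).const_mul _,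
      Finset.sum_congr rfl fun r hr => hint q hq r hr, Finset.sum_ite_eq, if_pos hq]
  rw [hmean, Complex.ofReal_injective key, ← Finset.sum_product']
  exact Finset.sum_le_sum_of_subset_of_nonneg (Finset.subset_univ _) fun _ _ _ => sq_nonneg _

/-- The coefficients of the entries of `(Qχ)(Qχ)^h - (Rχ)(Rχ)^h` are split as
`Q_{gi} conj (Q - R)_{hj} + (Q - R)_{gi} conj R_{hj}`. -/
theorem matrixVariance_orbitalMatrix_sub_le [IsProbabilityMeasure Pr] (hχ : IsRandomOrbital Pr χ)
    (hm : HasOrbitalMoments Pr χ) (Q R : Matrix ι ι ℂ) :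
    matrixVariance Pr (fun ω => orbitalMatrix Q (fun i => χ i ω) -
        orbitalMatrix R (fun i => χ i ω)) ≤
      2 * frobSq (Q - R) * (frobSq Q + frobSq R) := by
  have hentry : ∀ ω g h, (orbitalMatrix Q (fun i => χ i ω) - orbitalMatrix R (fun i => χ i ω)) g h =
      ∑ i, ∑ j, (Q g i * conj (Q h j) - R g i * conj (R h j)) * (χ i ω * conj (χ j ω)) := by
    intro ω g h
    have : ∀ T : Matrix ι ι ℂ, orbitalMatrix T (fun i => χ i ω) g h =
        ∑ i, ∑ j, (T g i * conj (T h j)) * (χ i ω * conj (χ j ω)) := fun T => by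
      simp only [orbitalMatrix, Matrix.vecMulVec_apply, Pi.star_apply, Matrix.mulVec, dotProduct,
        RCLike.star_def, map_sum, map_mul, Finset.sum_mul_sum]
      refine Finset.sum_congr rfl fun i _ => Finset.sum_congr rfl fun j _ => ?_
      ring
    rw [Matrix.sub_apply, this, this, ← Finset.sum_sub_distrib]
    refine Finset.sum_congr rfl fun i _ => ?_
    rw [← Finset.sum_sub_distrib]
    exact Finset.sum_congr rfl fun j _ => by ring
  have hcoeff : ∀ g h i j, ‖Q g i * conj (Q h j) - R g i * conj (R h j)‖ ^ 2 ≤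
      2 * (‖Q g i‖ ^ 2 * ‖(Q - R) h j‖ ^ 2) + 2 * (‖(Q - R) g i‖ ^ 2 * ‖R h j‖ ^ 2) := by
    intro g h i j
    have e : Q g i * conj (Q h j) - R g i * conj (R h j) =
        Q g i * conj ((Q - R) h j) + (Q - R) g i * conj (R h j) := by
      simp only [Matrix.sub_apply, map_sub]; ring
    rw [e]
    refine (norm_add_sq_le_two_mul _ _).trans (le_of_eq ?_)
    simp only [norm_mul, RCLike.norm_conj, mul_pow]
  have hprod : ∀ X Y : Matrix ι ι ℂ,
      ∑ g, ∑ h, ∑ i, ∑ j, ‖X g i‖ ^ 2 * ‖Y h j‖ ^ 2 = frobSq X * frobSq Y := fun X Y => by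
    unfold frobSq
    rw [Finset.sum_mul_sum]
    refine Finset.sum_congr rfl fun g _ => Finset.sum_congr rfl fun h _ => ?_
    rw [Finset.sum_mul_sum]
  unfold matrixVariance
  simp only [hentry]
  calc _ ≤ ∑ g, ∑ h, ∑ i, ∑ j, ‖Q g i * conj (Q h j) - R g i * conj (R h j)‖ ^ 2 :=
        Finset.sum_le_sum fun g _ => Finset.sum_le_sum fun h _ =>
          integral_norm_sesquilinear_sub_mean_sq_le hχ hm _
    _ ≤ ∑ g, ∑ h, ∑ i, ∑ j, (2 * (‖Q g i‖ ^ 2 * ‖(Q - R) h j‖ ^ 2) +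
          2 * (‖(Q - R) g i‖ ^ 2 * ‖R h j‖ ^ 2)) :=
        Finset.sum_le_sum fun g _ => Finset.sum_le_sum fun h _ => Finset.sum_le_sum fun i _ =>
          Finset.sum_le_sum fun j _ => hcoeff g h i j
    _ = 2 * (frobSq Q * frobSq (Q - R)) + 2 * (frobSq (Q - R) * frobSq R) := by
        rw [← hprod, ← hprod]
        simp only [Finset.sum_add_distrib, Finset.mul_sum]
    _ = _ := by ring

end Variance

/-! ### Fourier coefficients of functions holomorphic in a strip -/

section Strip

open Complex

/-- The Fourier coefficients of a `1`-periodic function that is holomorphic and bounded by `B` for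
`|Im z| < η` decay exponentially: the contour is shifted to `Im z = ± τ`, the vertical sides of the
rectangle cancelling by periodicity. -/
theorem norm_integral_mul_exp_le_of_strip {Φ : ℂ → ℂ} {η B : ℝ}
    (hd : DifferentiableOn ℂ Φ {z | |z.im| < η}) (hper : ∀ z, |z.im| < η → Φ (z + 1) = Φ z)
    (hB : ∀ z, |z.im| < η → ‖Φ z‖ ≤ B) (n : ℤ) {τ : ℝ} (hτ0 : 0 ≤ τ) (hτ : τ < η) :
    ‖∫ x in (0 : ℝ)..1, Φ x * cexp (-(2 * Real.pi * n * x * I))‖ ≤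
      B * Real.exp (-(2 * Real.pi * |(n : ℝ)| * τ)) := by
  obtain ⟨t, ht, hnt⟩ : ∃ t : ℝ, |t| = τ ∧ (n : ℝ) * t = -(|(n : ℝ)| * τ) := by
    rcases le_total 0 (n : ℝ) with h | h
    · exact ⟨-τ, by rw [abs_neg, abs_of_nonneg hτ0], by rw [abs_of_nonneg h]; ring⟩
    · exact ⟨τ, abs_of_nonneg hτ0, by rw [abs_of_nonpos h]; ring⟩
  set Ψ : ℂ → ℂ := fun z => Φ z * cexp (-(2 * Real.pi * n * z * I)) with hΨ
  have hΨd : DifferentiableOn ℂ Ψ {z | |z.im| < η} := hd.mul (by fun_prop)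
  have hmem : ∀ y ∈ Set.uIcc 0 t, |y| < η := fun y hy => by
    refine lt_of_le_of_lt ?_ (ht.trans_lt hτ)
    rcases Set.mem_uIcc.1 hy with h | h
    · rw [abs_of_nonneg h.1, abs_of_nonneg (h.1.trans h.2)]; exact h.2
    · rw [abs_of_nonpos h.2, abs_of_nonpos (h.1.trans h.2)]; linarith [h.1]
  have hrect := integral_boundary_rect_eq_zero_of_differentiableOn Ψ 0 (1 + t * I) (by
    refine hΨd.mono fun z hz => ?_
    have := hz.2
    simp only [zero_im, add_im, one_im, mul_im, ofReal_re, I_im, mul_one, ofReal_im, I_re,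
      mul_zero, add_zero, zero_add, Set.mem_preimage] at this
    exact hmem _ this)
  have hside : ∫ y in (0 : ℝ)..t, Ψ (1 + y * I) = ∫ y in (0 : ℝ)..t, Ψ (0 + y * I) := by
    refine intervalIntegral.integral_congr fun y hy => ?_
    have him : |((y : ℂ) * I).im| < η := by simpa using hmem y hy
    have h1 : cexp (-(2 * Real.pi * n * (1 + y * I) * I)) =
        cexp (-(2 * Real.pi * n * (y * I) * I)) := by
      rw [show -(2 * Real.pi * n * (1 + y * I) * I) =
        -(2 * Real.pi * n * (y * I) * I) + ((-n : ℤ) : ℂ) * (2 * Real.pi * I) by push_cast; ring,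
        Complex.exp_add, Complex.exp_int_mul_two_pi_mul_I, mul_one]
    simp only [hΨ, zero_add]
    rw [h1, add_comm, hper _ him]
  simp only [zero_re, zero_im, add_re, one_re, mul_re, ofReal_re, I_re, mul_zero, ofReal_im, I_im,
    mul_one, sub_self, add_zero, add_im, one_im, mul_im, zero_add, ofReal_zero, zero_mul,
    ofReal_one] at hrect hside
  rw [hside, add_sub_cancel_right, sub_eq_zero] at hrect
  have h0 : ∫ x in (0 : ℝ)..1, Φ x * cexp (-(2 * Real.pi * n * x * I)) =
      ∫ x in (0 : ℝ)..1, Ψ (x + t * I) := hrect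
  rw [h0]
  refine (intervalIntegral.norm_integral_le_of_norm_le_const
    (C := B * Real.exp (-(2 * Real.pi * |(n : ℝ)| * τ))) fun x _ => ?_).trans (by simp)
  have him : |((x : ℂ) + t * I).im| < η := by simpa [ht] using hτ
  simp only [hΨ, norm_mul, Complex.norm_exp]
  have hre : (-(2 * Real.pi * n * (x + t * I) * I)).re = -(2 * Real.pi * |(n : ℝ)| * τ) := by
    have : -(2 * Real.pi * n * (x + t * I) * I) =
        ((2 * Real.pi * (n * t) : ℝ) : ℂ) + ((-(2 * Real.pi * n * x) : ℝ) : ℂ) * I := by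
      push_cast
      linear_combination (-2 * Real.pi * n * t) * I_sq
    rw [this, hnt]
    simp only [add_re, ofReal_re, mul_re, I_re, mul_zero, ofReal_im, I_im, mul_one]
    ring
  rw [hre]
  gcongr
  exact hB _ him

end Strip

/-! ### Lattices and plane waves -/

section Lattice

open Matrix

variable {d : ℕ} (A : Matrix.GeneralLinearGroup (Fin d) ℝ)

theorem dualVec_sub (k l : Fin d → ℤ) : dualVec A (k - l) = dualVec A k - dualVec A l := by
  simp only [dualVec, ← WithLp.toLp_sub, ← smul_sub, ← mulVec_sub]
  congr 3
  ext i
  simp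

theorem inner_dualVec_latticeMap (k : Fin d → ℤ) (s : Fin d → ℝ) :
    inner ℝ (dualVec A k) (latticeMap A s) = 2 * Real.pi * ∑ i, k i * s i := by
  rw [dualVec, latticeMap, EuclideanSpace.inner_toLp_toLp]
  simp only [star_trivial, dotProduct_smul, smul_eq_mul]
  rw [mulVec_transpose, dotProduct_comm, ← dotProduct_mulVec, mulVec_mulVec, ← Units.val_mul,
    inv_mul_cancel, Units.val_one, one_mulVec]
  rfl

/-- The lattice vector with coordinates `k`. -/
noncomputable abbrev latticeVec (k : Fin d → ℤ) : EuclideanSpace ℝ (Fin d) :=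
  latticeMap A fun i => (k i : ℝ)

/-- The linear equivalence given by a real matrix `B` with inverse `B'`. -/
noncomputable def matEquiv (B B' : Matrix (Fin d) (Fin d) ℝ) (h : B * B' = 1) (h' : B' * B = 1) :
    (Fin d → ℝ) ≃ₗ[ℝ] EuclideanSpace ℝ (Fin d) :=
  (Matrix.toLin'OfInv h' h).trans (WithLp.linearEquiv 2 ℝ (Fin d → ℝ)).symm

@[simp]
theorem matEquiv_apply (B B' : Matrix (Fin d) (Fin d) ℝ) (h : B * B' = 1) (h' : B' * B = 1)
    (s : Fin d → ℝ) : matEquiv B B' h h' s = WithLp.toLp 2 (B *ᵥ s) := by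
  rfl

/-- The linear equivalence `s ↦ A s`. -/
noncomputable def cellEquiv : (Fin d → ℝ) ≃ₗ[ℝ] EuclideanSpace ℝ (Fin d) :=
  matEquiv (A : Matrix (Fin d) (Fin d) ℝ)
    ((A⁻¹ : Matrix.GeneralLinearGroup (Fin d) ℝ) : Matrix (Fin d) (Fin d) ℝ)
    (by rw [← Units.val_mul, mul_inv_cancel, Units.val_one])
    (by rw [← Units.val_mul, inv_mul_cancel, Units.val_one])

theorem cellEquiv_apply (s : Fin d → ℝ) : cellEquiv A s = latticeMap A s :=
  matEquiv_apply _ _ _ _ s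

/-- The basis of columns of `A`. -/
noncomputable def cellBasis : Module.Basis (Fin d) ℝ (EuclideanSpace ℝ (Fin d)) :=
  (Pi.basisFun ℝ (Fin d)).map (cellEquiv A)

theorem fundamentalDomain_cellBasis : ZSpan.fundamentalDomain (cellBasis A) = unitCell A := by
  rw [cellBasis, ← ZSpan.map_fundamentalDomain, ZSpan.fundamentalDomain_pi_basisFun]
  exact Set.image_congr fun s _ => cellEquiv_apply A s

theorem volume_unitCell : volume (unitCell A) = ENNReal.ofReal (cellVolume A) := by
  have h1 : unitCell A = (MeasurableEquiv.toLp 2 (Fin d → ℝ)).symm ⁻¹'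
      (Matrix.toLin' (A : Matrix (Fin d) (Fin d) ℝ) ''
        (Set.univ.pi fun _ => Set.Ico (0 : ℝ) 1)) := by
    ext r
    constructor
    · rintro ⟨s, hs, rfl⟩
      exact ⟨s, hs, rfl⟩
    · rintro ⟨s, hs, h⟩
      exact ⟨s, hs, (MeasurableEquiv.toLp 2 (Fin d → ℝ)).symm.injective h⟩
  rw [h1,
    (EuclideanSpace.volume_preserving_symm_measurableEquiv_toLp (Fin d)).measure_preimage_equiv,
    Measure.addHaar_image_linearMap, LinearMap.det_toLin', volume_pi_pi]
  simp [cellVolume]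

theorem cellVolume_pos : 0 < cellVolume A :=
  abs_pos.2 ((Matrix.isUnit_iff_isUnit_det _).1 A.isUnit).ne_zero

theorem volume_real_unitCell : volume.real (unitCell A) = cellVolume A := by
  rw [Measure.real, volume_unitCell, ENNReal.toReal_ofReal (cellVolume_pos A).le]

instance isFiniteMeasure_unitCell : IsFiniteMeasure (volume.restrict (unitCell A)) :=
  ⟨by rw [Measure.restrict_apply_univ, volume_unitCell]; exact ENNReal.ofReal_lt_top⟩

/-- Integrals of periodic functions over the unit cell are invariant under translations. -/
theorem setIntegral_unitCell_add {g : EuclideanSpace ℝ (Fin d) → ℂ}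
    (hg : ∀ r k, g (r + latticeVec A k) = g r) (y : EuclideanSpace ℝ (Fin d)) :
    ∫ r in unitCell A, g (r + y) = ∫ r in unitCell A, g r := by
  have hD := ZSpan.isAddFundamentalDomain (cellBasis A)
    (volume : Measure (EuclideanSpace ℝ (Fin d)))
  have hDy := hD.vadd_of_comm y
  rw [fundamentalDomain_cellBasis] at hD hDy
  have : VAddInvariantMeasure (Submodule.span ℤ (Set.range (cellBasis A)))
      (EuclideanSpace ℝ (Fin d)) volume :=
    inferInstanceAs <| VAddInvariantMeasure
      (Submodule.span ℤ (Set.range (cellBasis A))).toAddSubgroup _ _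
  have hinv : ∀ (v : Submodule.span ℤ (Set.range (cellBasis A))) (r), g (v +ᵥ r) = g r := by
    rintro ⟨v, hv⟩ r
    obtain ⟨k, rfl⟩ := (Submodule.mem_span_range_iff_exists_fun ℤ).1 hv
    have : ∑ i, k i • cellBasis A i = latticeVec A k := by
      rw [latticeVec, ← cellEquiv_apply]
      have hs : (fun i => (k i : ℝ)) = ∑ i, (k i : ℝ) • Pi.basisFun ℝ (Fin d) i := by
        ext j
        simp [Pi.single_apply]
      rw [hs, map_sum]
      refine Finset.sum_congr rfl fun i _ => ?_
      rw [map_smul, Int.cast_smul_eq_zsmul]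
      rfl
    rw [Submodule.vadd_def, vadd_eq_add, add_comm, ← hg r k, ← this]
  rw [hD.setIntegral_eq hDy hinv]
  have hmp := measurePreserving_vadd y (volume : Measure (EuclideanSpace ℝ (Fin d)))
  have := hmp.setIntegral_image_emb (measurableEmbedding_const_vadd y) g (unitCell A)
  rw [← Set.image_vadd, this]
  simp only [vadd_eq_add, add_comm]

end Lattice

/-! ### The dual lattice and Fourier coefficients on the unit cell -/

section DualLattice

open Matrix

variable {d : ℕ} (A : Matrix.GeneralLinearGroup (Fin d) ℝ)

/-- The linear equivalence `s ↦ 2π A^{-T} s`. -/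
noncomputable def dualEquiv : (Fin d → ℝ) ≃ₗ[ℝ] EuclideanSpace ℝ (Fin d) :=
  matEquiv ((2 * Real.pi) •
      ((A⁻¹ : Matrix.GeneralLinearGroup (Fin d) ℝ) : Matrix (Fin d) (Fin d) ℝ)ᵀ)
    ((2 * Real.pi)⁻¹ • (A : Matrix (Fin d) (Fin d) ℝ)ᵀ)
    (by
      rw [smul_mul_smul_comm, ← transpose_mul, ← Units.val_mul, mul_inv_cancel, Units.val_one,
        transpose_one, mul_inv_cancel₀ (by positivity), one_smul])
    (by
      rw [smul_mul_smul_comm, ← transpose_mul, ← Units.val_mul, inv_mul_cancel, Units.val_one,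
        transpose_one, inv_mul_cancel₀ (by positivity), one_smul])

theorem dualEquiv_intCast (k : Fin d → ℤ) : dualEquiv A (fun i => (k i : ℝ)) = dualVec A k := by
  rw [dualEquiv, matEquiv_apply, dualVec, smul_mulVec]

/-- The basis of columns of `2π A^{-T}`. -/
noncomputable def dualBasis : Module.Basis (Fin d) ℝ (EuclideanSpace ℝ (Fin d)) :=
  (Pi.basisFun ℝ (Fin d)).map (dualEquiv A)

theorem dualVec_eq_sum (k : Fin d → ℤ) : dualVec A k = ∑ i, (k i : ℝ) • dualBasis A i := by
  have hs : (fun i => (k i : ℝ)) = ∑ i, (k i : ℝ) • Pi.basisFun ℝ (Fin d) i := by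
    ext j
    simp [Pi.single_apply]
  rw [← dualEquiv_intCast, hs, map_sum]
  refine Finset.sum_congr rfl fun i _ => ?_
  rw [map_smul]
  rfl

theorem dualVec_injective : Function.Injective (dualVec A) := by
  intro k l h
  rw [← dualEquiv_intCast, ← dualEquiv_intCast] at h
  funext i
  exact_mod_cast congrFun ((dualEquiv A).injective h) i

theorem summable_exp_neg_mul_norm_dualVec {δ : ℝ} (hδ : 0 < δ) :
    Summable fun k : Fin d → ℤ => Real.exp (-(δ * ‖dualVec A k‖)) := by
  set L := Submodule.span ℤ (Set.range (dualBasis A)) with hL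
  set n := Module.finrank ℤ L + 1 with hn
  have hmem : ∀ k, dualVec A k ∈ L := fun k => by
    rw [dualVec_eq_sum]
    refine Submodule.sum_mem _ fun i _ => ?_
    rw [Int.cast_smul_eq_zsmul]
    exact Submodule.smul_mem _ _ (Submodule.subset_span ⟨i, rfl⟩)
  have hinj : Function.Injective fun k => (⟨dualVec A k, hmem k⟩ : L) := fun k l h =>
    dualVec_injective A (congrArg Subtype.val h)
  have hs := ((ZLattice.summable_norm_pow_inv L n
    (Nat.lt_succ_self _)).comp_injective hinj).mul_left
    (n.factorial / δ ^ n : ℝ)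
  refine hs.of_norm_bounded_eventually ?_
  refine (Set.finite_singleton (0 : Fin d → ℤ)).subset fun k hk => ?_
  by_contra hk0
  refine hk ?_
  have hpos : 0 < ‖dualVec A k‖ := by
    rw [norm_pos_iff]
    intro h0
    have h00 : dualVec A (0 : Fin d → ℤ) = 0 := by rw [dualVec_eq_sum]; simp
    exact hk0 (dualVec_injective A (h0.trans h00.symm))
  have h1 := Real.pow_div_factorial_le_exp (δ * ‖dualVec A k‖) (by positivity) n
  have h2 : ‖Real.exp (-(δ * ‖dualVec A k‖))‖ ≤
      (n.factorial / δ ^ n : ℝ) * ‖dualVec A k‖⁻¹ ^ n := by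
    rw [Real.norm_eq_abs, Real.abs_exp, Real.exp_neg]
    calc (Real.exp (δ * ‖dualVec A k‖))⁻¹ ≤ ((δ * ‖dualVec A k‖) ^ n / n.factorial)⁻¹ := by
          gcongr
      _ = _ := by
          rw [inv_div, mul_pow, inv_pow]
          field_simp
  exact h2

/-- The Fourier coefficients `|Ω|⁻¹ ∫_Ω V exp(-i G · r)` of a function on the unit cell. -/
noncomputable def cellFourier (V : EuclideanSpace ℝ (Fin d) → ℝ) (k : Fin d → ℤ) : ℂ :=
  (cellVolume A : ℂ)⁻¹ * ∫ r in unitCell A,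
    (V r : ℂ) * Complex.exp (-(Complex.I * ((inner ℝ (dualVec A k) r : ℝ) : ℂ)))

theorem cellFourier_neg (V : EuclideanSpace ℝ (Fin d) → ℝ) (k : Fin d → ℤ) :
    cellFourier A V (-k) = conj (cellFourier A V k) := by
  have hneg : dualVec A (-k) = -dualVec A k := by
    simp [dualVec_eq_sum]
  rw [cellFourier, cellFourier, map_mul, ← integral_conj, map_inv₀, Complex.conj_ofReal]
  congr 2
  ext r
  rw [map_mul, ← Complex.exp_conj, map_neg, map_mul, Complex.conj_ofReal, Complex.conj_ofReal,
    Complex.conj_I, hneg, inner_neg_left]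
  push_cast
  ring_nf

variable {A}

theorem toComplex_mem_strip {σ : ℝ} (r a : EuclideanSpace ℝ (Fin d)) {w : ℂ}
    (hw : |w.im| * ‖a‖ < σ) : toComplex r + w • toComplex a ∈ strip d σ := by
  have h : √(∑ i, ((toComplex r + w • toComplex a) i).im ^ 2) = |w.im| * ‖a‖ := by
    rw [EuclideanSpace.norm_eq, ← Real.sqrt_sq (abs_nonneg w.im), ← Real.sqrt_mul (sq_nonneg _),
      Finset.mul_sum]
    congr 1
    refine Finset.sum_congr rfl fun i _ => ?_
    simp [toComplex, mul_pow]
  rw [strip, Set.mem_ofPred_eq, h]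
  exact hw

theorem toComplex_add_smul (r a : EuclideanSpace ℝ (Fin d)) (t : ℝ) :
    toComplex (r + t • a) = toComplex r + (t : ℂ) • toComplex a := by
  ext i
  simp [toComplex]

variable {c σ : ℝ} {V : EuclideanSpace ℝ (Fin d) → ℝ}

theorem IsAnalyticPotential.continuous (hσ : 0 < σ) (hV : IsAnalyticPotential A c σ V) :
    Continuous V := by
  obtain ⟨F, hF, -, -, hFV⟩ := hV
  have h1 : Continuous (toComplex (d := d)) := by
    unfold toComplex
    fun_prop
  have h2 : Continuous fun r => F (toComplex r) :=
    hF.continuousOn.comp_continuous h1 fun r => by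
      simpa using toComplex_mem_strip r 0 (w := 0) (by simpa using hσ)
  have h3 : Continuous fun r => (F (toComplex r)).re := Complex.continuous_re.comp h2
  simpa [hFV] using h3

theorem IsAnalyticPotential.abs_le (hσ : 0 < σ) (hV : IsAnalyticPotential A c σ V)
    (r : EuclideanSpace ℝ (Fin d)) : |V r| ≤ c := by
  obtain ⟨F, -, hFc, -, hFV⟩ := hV
  have := hFc (toComplex r) (by simpa using toComplex_mem_strip r 0 (w := 0) (by simpa using hσ))
  rwa [hFV, Complex.norm_real] at this

theorem IsAnalyticPotential.periodic (hσ : 0 < σ) (hV : IsAnalyticPotential A c σ V)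
    (r : EuclideanSpace ℝ (Fin d)) (k : Fin d → ℤ) : V (r + latticeVec A k) = V r := by
  obtain ⟨F, -, -, hFp, hFV⟩ := hV
  have := hFp (toComplex r) (by simpa using toComplex_mem_strip r 0 (w := 0) (by simpa using hσ)) k
  have h1 := toComplex_add_smul r (latticeVec A k) 1
  rw [one_smul, Complex.ofReal_one, one_smul] at h1
  rw [← h1, hFV, hFV] at this
  exact_mod_cast this

theorem exp_inner_add_latticeVec (k l : Fin d → ℤ) (r : EuclideanSpace ℝ (Fin d)) :
    Complex.exp (-(Complex.I * ((inner ℝ (dualVec A k) (r + latticeVec A l) : ℝ) : ℂ))) =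
      Complex.exp (-(Complex.I * ((inner ℝ (dualVec A k) r : ℝ) : ℂ))) := by
  rw [inner_add_right, inner_dualVec_latticeMap,
    show -(Complex.I *
        ((inner ℝ (dualVec A k) r + 2 * Real.pi * ∑ i, (k i : ℝ) * (l i : ℝ) : ℝ) : ℂ))
      = -(Complex.I * ((inner ℝ (dualVec A k) r : ℝ) : ℂ)) +
        ((-∑ i, k i * l i : ℤ) : ℂ) * (2 * Real.pi * Complex.I) by push_cast; ring,
    Complex.exp_add, Complex.exp_int_mul_two_pi_mul_I, mul_one]

theorem norm_exp_neg_I_mul_ofReal (x : ℝ) : ‖Complex.exp (-(Complex.I * (x : ℂ)))‖ = 1 := by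
  rw [Complex.norm_exp]
  simp

theorem norm_cellFourier_le (hσ : 0 < σ) (hV : IsAnalyticPotential A c σ V) (k : Fin d → ℤ) :
    ‖cellFourier A V k‖ ≤ c := by
  have hv := cellVolume_pos A
  rw [cellFourier, norm_mul, norm_inv, Complex.norm_real, Real.norm_eq_abs, abs_of_pos hv,
    inv_mul_le_iff₀ hv, mul_comm]
  have h := norm_setIntegral_le_of_norm_le_const (μ := volume) (s := unitCell A) (C := c)
    (f := fun r => (V r : ℂ) *
      Complex.exp (-(Complex.I * ((inner ℝ (dualVec A k) r : ℝ) : ℂ)))) (by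
      rw [volume_unitCell]; exact ENNReal.ofReal_lt_top) (fun r _ => by
      rw [norm_mul, norm_exp_neg_I_mul_ofReal, mul_one, Complex.norm_real]
      exact hV.abs_le hσ r)
  rwa [volume_real_unitCell] at h

/-- Decay of the Fourier coefficients in the direction of the `i`-th lattice vector `a`: averaging
over the translates along `a` reduces the claim to one complex variable. -/
theorem norm_cellFourier_le_exp (hσ : 0 < σ) (hV : IsAnalyticPotential A c σ V) (k : Fin d → ℤ)
    (i : Fin d) {η τ : ℝ} (hη : η * ‖latticeVec A (Pi.single i 1)‖ < σ) (hτ0 : 0 ≤ τ)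
    (hτ : τ < η) :
    ‖cellFourier A V k‖ ≤ c * Real.exp (-(2 * Real.pi * |(k i : ℝ)| * τ)) := by
  set a := latticeVec A (Pi.single i 1) with ha
  set g : EuclideanSpace ℝ (Fin d) → ℂ := fun r => (V r : ℂ) *
    Complex.exp (-(Complex.I * ((inner ℝ (dualVec A k) r : ℝ) : ℂ))) with hg
  have hVc := hV.continuous hσ
  have hgc : Continuous g := by
    have : Continuous fun r : EuclideanSpace ℝ (Fin d) => (inner ℝ (dualVec A k) r : ℝ) := by
      fun_prop
    simp only [hg]
    fun_prop
  have hgb : ∀ r, ‖g r‖ ≤ c := fun r => by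
    rw [hg, norm_mul, norm_exp_neg_I_mul_ofReal, mul_one, Complex.norm_real]
    exact hV.abs_le hσ r
  have hgp : ∀ r l, g (r + latticeVec A l) = g r := fun r l => by
    simp only [hg]
    rw [hV.periodic hσ, exp_inner_add_latticeVec]
  have hka : inner ℝ (dualVec A k) a = 2 * Real.pi * k i := by
    rw [ha, inner_dualVec_latticeMap]
    simp [Pi.single_apply]
  -- the integral over one period in the direction `a`
  have hline : ∀ r, ‖∫ t in (0 : ℝ)..1, g (r + t • a)‖ ≤
      c * Real.exp (-(2 * Real.pi * |(k i : ℝ)| * τ)) := by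
    intro r
    obtain ⟨F, hF, hFc, hFp, hFV⟩ := hV
    have hstrip : ∀ w : ℂ, |w.im| < η → toComplex r + w • toComplex a ∈ strip d σ := fun w hw =>
      toComplex_mem_strip r a (lt_of_le_of_lt (by gcongr) hη)
    have h := norm_integral_mul_exp_le_of_strip (Φ := fun w => F (toComplex r + w • toComplex a))
      (η := η) (B := c) (hF.comp (by fun_prop) hstrip)
      (fun w hw => by
        have := hFp _ (hstrip w hw) (Pi.single i 1)
        rw [← this, add_smul, one_smul, add_assoc])
      (fun w hw => hFc _ (hstrip w hw)) (k i) hτ0 hτ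
    have e : ∫ t in (0 : ℝ)..1, g (r + t • a) =
        Complex.exp (-(Complex.I * ((inner ℝ (dualVec A k) r : ℝ) : ℂ))) *
        ∫ t in (0 : ℝ)..1, F (toComplex r + (t : ℂ) • toComplex a) *
          Complex.exp (-(2 * Real.pi * (k i : ℤ) * t * Complex.I)) := by
      rw [← intervalIntegral.integral_const_mul]
      refine intervalIntegral.integral_congr fun t _ => ?_
      simp only [hg]
      rw [← hFV, toComplex_add_smul, inner_add_right, inner_smul_right, hka,
        show -(Complex.I * ((inner ℝ (dualVec A k) r + t * (2 * Real.pi * (k i : ℝ)) : ℝ) : ℂ)) =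
          -(Complex.I * ((inner ℝ (dualVec A k) r : ℝ) : ℂ)) +
            -(2 * Real.pi * (k i : ℤ) * t * Complex.I) by push_cast; ring, Complex.exp_add]
      ring
    rw [e, norm_mul, norm_exp_neg_I_mul_ofReal, one_mul]
    exact h
  have hint : Integrable (Function.uncurry fun (t : ℝ) (r : EuclideanSpace ℝ (Fin d)) =>
      g (r + t • a)) ((volume.restrict (Set.Ioc (0 : ℝ) 1)).prod
        (volume.restrict (unitCell A))) := by
    have hc : Continuous (Function.uncurry fun (t : ℝ) (r : EuclideanSpace ℝ (Fin d)) =>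
        g (r + t • a)) := hgc.comp (by fun_prop)
    exact Integrable.of_bound hc.aestronglyMeasurable c (.of_forall fun x => hgb _)
  have hswap : ∫ r in unitCell A, g r =
      ∫ r in unitCell A, ∫ t in (0 : ℝ)..1, g (r + t • a) := by
    simp only [intervalIntegral.integral_of_le zero_le_one]
    rw [← integral_integral_swap hint]
    simp only [setIntegral_unitCell_add A hgp]
    simp
  have hv := cellVolume_pos A
  rw [cellFourier, norm_mul, norm_inv, Complex.norm_real, Real.norm_eq_abs, abs_of_pos hv,
    inv_mul_le_iff₀ hv, mul_comm]
  change ‖∫ r in unitCell A, g r‖ ≤ _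
  rw [hswap]
  have h := norm_setIntegral_le_of_norm_le_const (μ := volume) (s := unitCell A)
    (C := c * Real.exp (-(2 * Real.pi * |(k i : ℝ)| * τ)))
    (f := fun r => ∫ t in (0 : ℝ)..1, g (r + t • a)) (by
      rw [volume_unitCell]; exact ENNReal.ofReal_lt_top) (fun r _ => hline r)
  rwa [volume_real_unitCell] at h

variable (A) in
/-- The Fourier coefficients of a potential holomorphic in a strip decay exponentially in `|G|`, at
a rate given by the lattice and the width of the strip. -/
theorem exists_norm_cellFourier_le_exp (hσ : 0 < σ) :
    ∃ δ : ℝ, 0 < δ ∧ ∀ (c : ℝ) (V : EuclideanSpace ℝ (Fin d) → ℝ), IsAnalyticPotential A c σ V →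
      ∀ k, ‖cellFourier A V k‖ ≤ c * Real.exp (-(2 * δ * ‖dualVec A k‖)) := by
  set R : ℝ := 1 + ∑ i, ‖latticeVec A (Pi.single i 1)‖ with hR
  set Γ : ℝ := 1 + ∑ i, ‖dualBasis A i‖ with hΓ
  have hR0 : 0 < R := by positivity
  have hΓ0 : 0 < Γ := by positivity
  set η : ℝ := σ / R with hη
  have hη0 : 0 < η := by positivity
  refine ⟨Real.pi * (η / 2) / Γ, by positivity, fun c V hV k => ?_⟩
  have hc : 0 ≤ c := (abs_nonneg _).trans (hV.abs_le hσ 0)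
  rcases isEmpty_or_nonempty (Fin d) with hd | hd
  · have h0 : dualVec A k = 0 := by rw [dualVec_eq_sum]; simp
    rw [h0, norm_zero, mul_zero, neg_zero, Real.exp_zero, mul_one]
    exact norm_cellFourier_le hσ hV k
  · obtain ⟨i, hi⟩ := Finite.exists_max fun i => |(k i : ℝ)|
    have h1 : ‖dualVec A k‖ ≤ |(k i : ℝ)| * Γ := by
      rw [dualVec_eq_sum, hΓ, mul_add, mul_one, Finset.mul_sum]
      refine (norm_sum_le _ _).trans ((Finset.sum_le_sum fun j _ => ?_).trans
        (le_add_of_nonneg_left (abs_nonneg _)))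
      rw [norm_smul, Real.norm_eq_abs]
      exact mul_le_mul_of_nonneg_right (hi j) (norm_nonneg _)
    refine (norm_cellFourier_le_exp hσ hV k i (η := η) (τ := η / 2) ?_ (by positivity)
      (by linarith)).trans ?_
    · rw [hη, div_mul_eq_mul_div, div_lt_iff₀ hR0]
      refine mul_lt_mul_of_pos_left ?_ hσ
      have := Finset.single_le_sum (f := fun i => ‖latticeVec A (Pi.single i 1)‖)
        (fun i _ => norm_nonneg _) (Finset.mem_univ i)
      linarith
    · refine mul_le_mul_of_nonneg_left (Real.exp_le_exp.2 (neg_le_neg ?_)) hc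
      calc 2 * (Real.pi * (η / 2) / Γ) * ‖dualVec A k‖
          ≤ 2 * (Real.pi * (η / 2) / Γ) * (|(k i : ℝ)| * Γ) := by gcongr
        _ = _ := by field_simp

end DualLattice

/-! ### The Hamiltonian in the plane-wave basis -/

section KohnSham

open Matrix

variable {d : ℕ} {A : Matrix.GeneralLinearGroup (Fin d) ℝ}

theorem rdiag_apply {ι : Type*} [DecidableEq ι] (v : ι → ℝ) (i j : ι) :
    rdiag v i j = if i = j then (v i : ℂ) else 0 :=
  diagonal_apply _ i j

theorem laplacian_planeWave (k : Fin d → ℤ) (r : EuclideanSpace ℝ (Fin d)) :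
    Laplacian.laplacian (planeWave A k) r = -((‖dualVec A k‖ ^ 2 : ℝ) : ℂ) * planeWave A k r := by
  set L : EuclideanSpace ℝ (Fin d) →L[ℝ] ℂ :=
    Complex.I • Complex.ofRealCLM.comp (innerSL ℝ (dualVec A k)) with hL
  have hLv : ∀ v, L v = Complex.I * ((inner ℝ (dualVec A k) v : ℝ) : ℂ) := fun v => by
    simp [hL]
  have h1 : ∀ r, HasFDerivAt (planeWave A k) (planeWave A k r • L) r := fun r => by
    have h := (L.hasFDerivAt (x := r)).cexp.const_mul ((1 / √(cellVolume A) : ℝ) : ℂ)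
    rw [smul_smul] at h
    have e : planeWave A k = fun r => ((1 / √(cellVolume A) : ℝ) : ℂ) * Complex.exp (L r) := by
      ext r; rw [hLv]; rfl
    rw [e]
    exact h
  have h2 : fderiv ℝ (planeWave A k) = fun r => planeWave A k r • L :=
    funext fun r => (h1 r).fderiv
  have h3 : HasFDerivAt (fderiv ℝ (planeWave A k)) ((planeWave A k r • L).smulRight L) r := by
    rw [h2]
    exact (h1 r).smul_const L
  rw [InnerProductSpace.laplacian_eq_iteratedFDeriv_orthonormalBasis _
    (EuclideanSpace.basisFun (Fin d) ℝ)]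
  simp only [iteratedFDeriv_two_apply, h3.fderiv, Matrix.cons_val_zero, Matrix.cons_val_one,
    ContinuousLinearMap.smulRight_apply, _root_.smul_apply, hLv, smul_eq_mul]
  have h4 : ‖dualVec A k‖ ^ 2 =
      ∑ i, (inner ℝ (dualVec A k) (EuclideanSpace.basisFun (Fin d) ℝ i)) ^ 2 := by
    rw [EuclideanSpace.norm_sq_eq]
    refine Finset.sum_congr rfl fun i _ => ?_
    simp [EuclideanSpace.inner_single_right]
  rw [h4, Complex.ofReal_sum, neg_mul, Finset.sum_mul, ← Finset.sum_neg_distrib]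
  refine Finset.sum_congr rfl fun i _ => ?_
  push_cast
  linear_combination (planeWave A k r *
    ((inner ℝ (dualVec A k) (EuclideanSpace.basisFun (Fin d) ℝ i) : ℝ) : ℂ) ^ 2) * Complex.I_sq

theorem conj_planeWave_mul_planeWave (k l : Fin d → ℤ) (r : EuclideanSpace ℝ (Fin d)) :
    conj (planeWave A k r) * planeWave A l r = (cellVolume A : ℂ)⁻¹ *
      Complex.exp (-(Complex.I * ((inner ℝ (dualVec A (k - l)) r : ℝ) : ℂ))) := by
  have hv := cellVolume_pos A
  have h1 : ((1 / √(cellVolume A) : ℝ) : ℂ) * ((1 / √(cellVolume A) : ℝ) : ℂ) =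
      (cellVolume A : ℂ)⁻¹ := by
    rw [← Complex.ofReal_mul, ← Complex.ofReal_inv]
    congr 1
    rw [div_mul_div_comm, Real.mul_self_sqrt hv.le, one_mul, one_div]
  have h2 : Complex.exp (-(Complex.I * ((inner ℝ (dualVec A (k - l)) r : ℝ) : ℂ))) =
      conj (Complex.exp (Complex.I * ((inner ℝ (dualVec A k) r : ℝ) : ℂ))) *
        Complex.exp (Complex.I * ((inner ℝ (dualVec A l) r : ℝ) : ℂ)) := by
    rw [← Complex.exp_conj, ← Complex.exp_add, dualVec_sub, inner_sub_left, map_mul,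
      Complex.conj_I, Complex.conj_ofReal]
    push_cast
    ring_nf
  rw [planeWave, planeWave, map_mul, Complex.conj_ofReal, h2, ← h1]
  ring

theorem integral_exp_dualVec (k : Fin d → ℤ) :
    ∫ r in unitCell A, Complex.exp (-(Complex.I * ((inner ℝ (dualVec A k) r : ℝ) : ℂ))) =
      if k = 0 then (cellVolume A : ℂ) else 0 := by
  split_ifs with hk
  · subst hk
    have h0 : dualVec A (0 : Fin d → ℤ) = 0 := by simp [dualVec_eq_sum]
    simp [h0, volume_real_unitCell]
  · -- a translation by half a period changes the sign
    obtain ⟨i, hi⟩ := Function.ne_iff.1 hk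
    have hi' : (k i : ℝ) ≠ 0 := by exact_mod_cast hi
    set y := latticeMap A (Pi.single i (1 / (2 * (k i : ℝ)))) with hy
    have hky : inner ℝ (dualVec A k) y = Real.pi := by
      rw [hy, inner_dualVec_latticeMap]
      simp [Pi.single_apply]
      field_simp
    have h := setIntegral_unitCell_add A
      (g := fun r => Complex.exp (-(Complex.I * ((inner ℝ (dualVec A k) r : ℝ) : ℂ))))
      (fun r l => exp_inner_add_latticeVec k l r) y
    have h2 : ∀ r, Complex.exp (-(Complex.I * ((inner ℝ (dualVec A k) (r + y) : ℝ) : ℂ))) =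
        -Complex.exp (-(Complex.I * ((inner ℝ (dualVec A k) r : ℝ) : ℂ))) := fun r => by
      rw [inner_add_right, hky, show -(Complex.I * ((inner ℝ (dualVec A k) r + Real.pi : ℝ) : ℂ)) =
        -(Complex.I * ((inner ℝ (dualVec A k) r : ℝ) : ℂ)) - Real.pi * Complex.I by push_cast; ring,
        Complex.exp_sub_pi_mul_I]
    simp only [h2, integral_neg] at h
    exact self_eq_neg.1 h.symm

/-- In the plane-wave basis the kinetic energy is diagonal and the potential acts by convolution
with its Fourier coefficients. -/
theorem ksMatrix_eq {vext : EuclideanSpace ℝ (Fin d) → ℝ} {vxc : ℝ → ℝ}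
    {ρ : EuclideanSpace ℝ (Fin d) → ℝ} {c σ : ℝ} (hσ : 0 < σ)
    (hV : IsAnalyticPotential A c σ (totalPotential A vext vxc ρ)) (E : ℝ) :
    ksMatrix A vext vxc ρ E =
      rdiag (kinetic (fun k => ‖dualVec A k‖) (Subtype.val : PW A E → Fin d → ℤ)) +
        of fun G G' : PW A E => cellFourier A (totalPotential A vext vxc ρ) (G.1 - G'.1) := by
  set V := totalPotential A vext vxc ρ with hVdef
  have hVc : Continuous V := hV.continuous hσ
  have hv := cellVolume_pos A
  have hv' : (cellVolume A : ℂ) ≠ 0 := by exact_mod_cast hv.ne'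
  ext G G'
  set ex : EuclideanSpace ℝ (Fin d) → ℂ := fun r =>
    Complex.exp (-(Complex.I * ((inner ℝ (dualVec A (G.1 - G'.1)) r : ℝ) : ℂ))) with hex
  have hexc : Continuous ex := by
    have : Continuous fun r : EuclideanSpace ℝ (Fin d) =>
        (inner ℝ (dualVec A (G.1 - G'.1)) r : ℝ) := by fun_prop
    simp only [hex]
    fun_prop
  have hi1 : IntegrableOn ex (unitCell A) :=
    Integrable.of_bound hexc.aestronglyMeasurable 1
      (.of_forall fun r => (norm_exp_neg_I_mul_ofReal _).le)
  have hi2 : IntegrableOn (fun r => (V r : ℂ) * ex r) (unitCell A) := by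
    refine Integrable.of_bound
      ((Complex.continuous_ofReal.comp hVc).mul hexc).aestronglyMeasurable c
      (.of_forall fun r => ?_)
    rw [norm_mul, hex, norm_exp_neg_I_mul_ofReal, mul_one, Complex.norm_real]
    exact hV.abs_le hσ r
  have hpt : ∀ r, conj (planeWave A G.1 r) * ksOperator A vext vxc ρ (planeWave A G'.1) r =
      (((‖dualVec A G'.1‖ ^ 2 / 2 : ℝ) : ℂ) * (cellVolume A : ℂ)⁻¹) * ex r +
        (cellVolume A : ℂ)⁻¹ * ((V r : ℂ) * ex r) := fun r => by
    have h := conj_planeWave_mul_planeWave (A := A) G.1 G'.1 r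
    rw [ksOperator, laplacian_planeWave]
    push_cast
    linear_combination ((‖dualVec A G'.1‖ : ℂ) ^ 2 / 2 + V r) * h
  rw [ksMatrix]
  simp only [hpt]
  rw [integral_add (hi1.const_mul _) (hi2.const_mul _), integral_const_mul, integral_const_mul,
    integral_exp_dualVec, Matrix.add_apply, of_apply, cellFourier, rdiag_apply]
  congr 1
  by_cases h : G = G'
  · subst h
    simp only [sub_self, if_true, kinetic]
    field_simp
  · have h' : G.1 - G'.1 ≠ 0 := fun h0 => h (Subtype.ext (sub_eq_zero.1 h0))
    rw [if_neg h', if_neg h, mul_zero]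

end KohnSham

/-! ### Convergence of Chebyshev series -/

section Chebyshev

open Complex

/-- On this strip `1 + exp w` stays in the slit plane and is bounded away from zero, so that its
inverse square root is holomorphic and bounded by `1`. -/
theorem one_le_re_one_add_exp {w : ℂ} (hw : |w.im| ≤ Real.pi / 2) : 1 ≤ (1 + cexp w).re := by
  rw [add_re, one_re, exp_re]
  have h : 0 ≤ Real.cos w.im := Real.cos_nonneg_of_mem_Icc (abs_le.1 hw)
  linarith [mul_nonneg (Real.exp_pos w.re).le h]

/-- The Fourier coefficients of the even function `g ∘ cos` are, up to normalisation, the Chebyshev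
coefficients of `g`. -/
theorem chebCoeff_eq {g : ℝ → ℝ} (hg : Continuous g) (m : ℕ) :
    (chebCoeff g m : ℂ) = (if m = 0 then 1 else 2) *
      ∫ x in (0 : ℝ)..1, (g (Real.cos (2 * Real.pi * x)) : ℂ) *
        cexp (-(2 * Real.pi * (m : ℤ) * x * I)) := by
  set u : ℝ → ℂ := fun x => (g (Real.cos (2 * Real.pi * x)) : ℂ) *
        cexp (-(2 * Real.pi * (m : ℤ) * x * I)) with hu
  have huc : Continuous u := by simp only [hu]; fun_prop
  have huc' : Continuous fun x => u (1 - x) := huc.comp (by fun_prop)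
  have hrefl : ∀ x, u (1 - x) = (g (Real.cos (2 * Real.pi * x)) : ℂ) *
      cexp (2 * Real.pi * (m : ℤ) * x * I) := fun x => by
    simp only [hu]
    rw [show 2 * Real.pi * (1 - x) = 2 * Real.pi - 2 * Real.pi * x by ring, Real.cos_two_pi_sub,
      show -(2 * Real.pi * (m : ℤ) * ((1 - x : ℝ) : ℂ) * I) =
        2 * Real.pi * (m : ℤ) * x * I + ((-m : ℤ) : ℂ) * (2 * Real.pi * I) by push_cast; ring,
      Complex.exp_add, Complex.exp_int_mul_two_pi_mul_I, mul_one]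
  have hflip : ∫ x in (1 / 2 : ℝ)..1, u x = ∫ x in (0 : ℝ)..(1 / 2), u (1 - x) := by
    rw [intervalIntegral.integral_comp_sub_left u 1]
    norm_num
  have hsplit : ∫ x in (0 : ℝ)..1, u x = ∫ x in (0 : ℝ)..(1 / 2),
      ((2 * (g (Real.cos (2 * Real.pi * x)) * Real.cos (m * (2 * Real.pi * x))) : ℝ) : ℂ) := by
    rw [← intervalIntegral.integral_add_adjacent_intervals (b := 1 / 2)
      (huc.intervalIntegrable _ _) (huc.intervalIntegrable _ _), hflip,
      ← intervalIntegral.integral_add (huc.intervalIntegrable _ _)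
        (huc'.intervalIntegrable _ _)]
    refine intervalIntegral.integral_congr fun x _ => ?_
    simp only [hrefl]
    push_cast
    rw [Complex.cos, hu]
    simp only
    rw [show (m : ℂ) * (2 * Real.pi * x) * I = 2 * Real.pi * ((m : ℤ) : ℂ) * x * I by
        push_cast; ring,
      show -((m : ℂ) * (2 * Real.pi * x)) * I = -(2 * Real.pi * ((m : ℤ) : ℂ) * x * I) by
        push_cast; ring]
    push_cast
    ring
  rw [hsplit, intervalIntegral.integral_ofReal]
  have hsub := intervalIntegral.integral_comp_mul_left
    (fun θ => 2 * (g (Real.cos θ) * Real.cos (m * θ))) (a := 0) (b := 1 / 2)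
    (c := 2 * Real.pi) (by positivity)
  rw [hsub, chebCoeff, mul_zero, show 2 * Real.pi * (1 / 2) = Real.pi by ring,
    intervalIntegral.integral_const_mul]
  have hpi : (Real.pi : ℂ) ≠ 0 := by exact_mod_cast Real.pi_ne_zero
  push_cast
  simp only [smul_eq_mul, mul_inv]
  split_ifs <;> push_cast <;> field_simp

/-- A Chebyshev series with geometrically decaying coefficients converges geometrically, because it
is the Fourier series of `g ∘ cos`. -/
theorem abs_chebPoly_sub_le {g : ℝ → ℝ} (hg : Continuous g) {r : ℝ} (hr0 : 0 ≤ r) (hr1 : r < 1)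
    (hF : ∀ n : ℤ, ‖∫ x in (0 : ℝ)..1, (g (Real.cos (2 * Real.pi * x)) : ℂ) *
      cexp (-(2 * Real.pi * n * x * I))‖ ≤ r ^ n.natAbs) (M : ℕ) {x : ℝ}
    (hx : x ∈ Set.Icc (-1 : ℝ) 1) :
    |(chebPoly g M).eval x - g x| ≤ 2 * r ^ (M + 1) / (1 - r) := by
  set F : ℤ → ℂ := fun n => ∫ x in (0 : ℝ)..1, (g (Real.cos (2 * Real.pi * x)) : ℂ) *
      cexp (-(2 * Real.pi * n * x * I)) with hFdef
  have hper : Function.Periodic (fun x : ℝ => (g (Real.cos (2 * Real.pi * x)) : ℂ)) 1 := fun x => by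
    simp only [mul_add, mul_one, Real.cos_add_two_pi]
  have hcont : Continuous fun x : ℝ => (g (Real.cos (2 * Real.pi * x)) : ℂ) := by fun_prop
  set G : C(AddCircle (1 : ℝ), ℂ) := ⟨hper.lift, continuous_coinduced_dom.2 hcont⟩ with hG
  have hGx : ∀ x : ℝ, G (x : AddCircle (1 : ℝ)) = (g (Real.cos (2 * Real.pi * x)) : ℂ) :=
    fun x => rfl
  have hfc : ∀ n, fourierCoeff G n = F n := fun n => by
    rw [fourierCoeff_eq_intervalIntegral _ n 0, zero_add, div_one, one_smul]
    refine intervalIntegral.integral_congr fun x _ => ?_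
    simp only [hGx, fourier_coe_apply, smul_eq_mul]
    rw [mul_comm]
    congr 2
    push_cast
    ring
  have hF' : ∀ n : ℤ, ‖F n‖ ≤ r ^ n.natAbs := hF
  have hgeo := summable_geometric_of_lt_one hr0 hr1
  have hsummable : Summable (fourierCoeff G) := by
    rw [funext hfc]
    refine Summable.of_nat_of_neg ?_ ?_
    · exact Summable.of_norm_bounded hgeo fun n => by simpa only [Int.natAbs_natCast] using hF' n
    · exact Summable.of_norm_bounded hgeo fun n => by
        simpa only [Int.natAbs_neg, Int.natAbs_natCast] using hF' (-n)
  set y : ℝ := Real.arccos x / (2 * Real.pi) with hy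
  have hy' : 2 * Real.pi * y = Real.arccos x := by rw [hy]; field_simp
  have hcos : Real.cos (2 * Real.pi * y) = x := by rw [hy', Real.cos_arccos hx.1 hx.2]
  have hsum := (has_pointwise_sum_fourier_series_of_summable hsummable (y : AddCircle (1 : ℝ)))
  rw [hGx, hcos] at hsum
  have hnat := hsum.nat_add_neg
  have hneg : ∀ n : ℤ, F (-n) = conj (F n) := fun n => by
    simp only [hFdef]
    rw [← intervalIntegral.intervalIntegral_conj]
    refine intervalIntegral.integral_congr fun x _ => ?_
    simp only [map_mul, conj_ofReal, ← Complex.exp_conj, map_neg, conj_I, map_ofNat, map_intCast]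
    push_cast
    ring_nf
  have hreal : ∀ m : ℕ, (chebCoeff g m : ℂ) = (if m = 0 then 1 else 2) * F m := chebCoeff_eq hg
  have hFre : ∀ m : ℕ, F m = (((if m = 0 then 1 else 1 / 2) * chebCoeff g m : ℝ) : ℂ) := fun m => by
    push_cast
    rw [hreal]
    split_ifs <;> simp
  have hterm : ∀ m : ℕ, fourierCoeff G (m : ℤ) • fourier (m : ℤ) (y : AddCircle (1 : ℝ)) +
      fourierCoeff G (-(m : ℤ)) • fourier (-(m : ℤ)) (y : AddCircle (1 : ℝ)) =
      ((chebCoeff g m * Real.cos (m * (2 * Real.pi * y)) +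
        if m = 0 then chebCoeff g 0 else 0 : ℝ) : ℂ) := fun m => by
    rw [hfc, hfc, hneg, hFre, conj_ofReal, fourier_coe_apply, fourier_coe_apply]
    push_cast
    rw [Complex.cos]
    rw [show (m : ℂ) * (2 * Real.pi * y) * I = 2 * Real.pi * I * m * y / 1 by ring,
      show -((m : ℂ) * (2 * Real.pi * y)) * I = 2 * Real.pi * I * (-m) * y / 1 by ring]
    simp only [smul_eq_mul]
    rcases Nat.eq_zero_or_pos m with rfl | hm
    · simp
    · simp only [hm.ne', if_false]
      push_cast
      ring
  simp only [hterm] at hnat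
  have hF0 : fourierCoeff G 0 • fourier 0 (y : AddCircle (1 : ℝ)) = (chebCoeff g 0 : ℂ) := by
    have := hFre 0
    rw [hfc]
    simp only [Nat.cast_zero, if_true, one_mul] at this
    simp [this]
  rw [hF0, ← ofReal_add] at hnat
  have hnat' : HasSum (fun m : ℕ => chebCoeff g m * Real.cos (m * (2 * Real.pi * y)) +
      if m = 0 then chebCoeff g 0 else 0) (g x + chebCoeff g 0) := by
    exact_mod_cast hnat
  have hser : HasSum (fun m : ℕ => chebCoeff g m * Real.cos (m * (2 * Real.pi * y))) (g x) := by
    have := hnat'.sub (hasSum_ite_eq 0 (chebCoeff g 0))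
    simpa using this
  have hcoeff : ∀ m : ℕ, |chebCoeff g m| ≤ 2 * r ^ m := fun m => by
    have h1 : ‖(chebCoeff g m : ℂ)‖ ≤ 2 * r ^ m := by
      rw [hreal, norm_mul]
      have h2 : ‖F m‖ ≤ r ^ m := by simpa only [Int.natAbs_natCast] using hF' m
      gcongr
      split_ifs <;> simp
    rwa [Complex.norm_real] at h1
  have hbound : ∀ m : ℕ, ‖chebCoeff g m * Real.cos (m * (2 * Real.pi * y))‖ ≤ 2 * r ^ m :=
      fun m => by
    rw [norm_mul, Real.norm_eq_abs, Real.norm_eq_abs]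
    calc |chebCoeff g m| * |Real.cos (m * (2 * Real.pi * y))| ≤ |chebCoeff g m| * 1 := by
          gcongr
          exact Real.abs_cos_le_one _
      _ ≤ _ := by rw [mul_one]; exact hcoeff m
  have htail := norm_sub_le_of_geometric_bound_of_hasSum hr1 hbound hser (M + 1)
  have heval : (chebPoly g M).eval x =
      ∑ m ∈ Finset.range (M + 1), chebCoeff g m * Real.cos (m * (2 * Real.pi * y)) := by
    rw [chebPoly, Polynomial.eval_finsetSum]
    refine Finset.sum_congr rfl fun m _ => ?_
    rw [Polynomial.eval_mul, Polynomial.eval_C, ← hcos, Polynomial.Chebyshev.T_real_cos,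
      Int.cast_natCast]
  rw [heval]
  exact htail

theorem continuous_sqrtSmear (β μ a b : ℝ) : Continuous (sqrtSmear β μ a b) := by
  unfold sqrtSmear fermiDirac
  refine Real.continuous_sqrt.comp (continuous_const.div (by fun_prop) fun x => ?_)
  positivity

/-- The rate is uniform in `μ` and `b`: the square root of the Fermi-Dirac function is bounded by
`1` on the strip `|Im z| ≤ π / (2 β)`, whose position does not depend on the Fermi level. -/
theorem exists_chebRate_sqrtSmear {β : ℝ} (hβ : 0 < β) {a : ℝ} (ha : a ≠ 0) :
    ∃ κ α : ℝ, 0 < κ ∧ 0 < α ∧ ∀ μ b : ℝ, ChebRate (sqrtSmear β μ a b) κ α := by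
  have ha' : 0 < |a| := abs_pos.2 ha
  have hpi := Real.pi_pos
  -- `cos (2 π z)` stays in the strip `|Im| ≤ π |a| / (2 β)` as long as `|Im z| < η`
  set s : ℝ := Real.arsinh (Real.pi * |a| / (2 * β)) with hs
  have hs0 : 0 < s := Real.arsinh_pos_iff.2 (by positivity)
  set η : ℝ := s / (2 * Real.pi) with hη
  have hη0 : 0 < η := by positivity
  set α : ℝ := 2 * Real.pi * (η / 2) with hα
  have hα0 : 0 < α := by positivity
  set r : ℝ := Real.exp (-α) with hr
  have hr0 : 0 < r := Real.exp_pos _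
  have hr1 : r < 1 := Real.exp_lt_one_iff.2 (by linarith)
  have h1r : 0 < 1 - r := by linarith
  refine ⟨2 / (1 - r), α, by positivity, hα0, fun μ b M x hx => ?_⟩
  set W : ℂ → ℂ := fun z => β * (Complex.cos (2 * Real.pi * z) / a + b - μ) with hW
  have hWim : ∀ z : ℂ, |z.im| < η → |(W z).im| ≤ Real.pi / 2 := fun z hz => by
    have h1 : (W z).im = β * ((Complex.cos (2 * Real.pi * z)).im / a) := by
      simp [hW, Complex.div_ofReal_im]
    have h2 : (Complex.cos (2 * Real.pi * z)).im =
        -(Real.sin (2 * Real.pi * z.re) * Real.sinh (2 * Real.pi * z.im)) := by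
      have : 2 * Real.pi * z = ((2 * Real.pi * z.re : ℝ) : ℂ) +
          ((2 * Real.pi * z.im : ℝ) : ℂ) * I := by
        conv_lhs => rw [← Complex.re_add_im z]
        push_cast; ring
      rw [this, Complex.cos_add_mul_I, ← ofReal_cos, ← ofReal_cosh, ← ofReal_sin, ← ofReal_sinh,
        ← ofReal_mul, ← ofReal_mul, sub_im, ofReal_im, im_ofReal_mul, I_im]
      ring
    have h3 : |(Complex.cos (2 * Real.pi * z)).im| ≤ Real.pi * |a| / (2 * β) := by
      rw [h2, abs_neg, abs_mul, ← Real.sinh_arsinh (Real.pi * |a| / (2 * β)), Real.abs_sinh,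
        abs_mul, abs_of_pos (by positivity : 0 < 2 * Real.pi)]
      have h4 : 2 * Real.pi * |z.im| ≤ s := by
        rw [hη, lt_div_iff₀ (by positivity)] at hz
        linarith
      have h5 : 0 ≤ Real.sinh (2 * Real.pi * |z.im|) := Real.sinh_nonneg_iff.2 (by positivity)
      calc |Real.sin (2 * Real.pi * z.re)| * Real.sinh (2 * Real.pi * |z.im|)
          ≤ 1 * Real.sinh (2 * Real.pi * |z.im|) := by
            gcongr
            exact Real.abs_sin_le_one _
        _ ≤ _ := by rw [one_mul]; exact Real.sinh_le_sinh.2 h4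
    rw [h1, abs_mul, abs_div, abs_of_pos hβ]
    calc β * (|(Complex.cos (2 * Real.pi * z)).im| / |a|)
        ≤ β * (Real.pi * |a| / (2 * β) / |a|) := by gcongr
      _ = _ := by field_simp
  set Φ : ℂ → ℂ := fun z => (1 + cexp (W z)) ^ ((-(1 / 2) : ℝ) : ℂ) with hΦ
  have hre : ∀ z : ℂ, |z.im| < η → 1 ≤ (1 + cexp (W z)).re := fun z hz =>
    one_le_re_one_add_exp (hWim z hz)
  have hΦreal : ∀ t : ℝ, Φ t = (sqrtSmear β μ a b (Real.cos (2 * Real.pi * t)) : ℂ) := fun t => by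
    have e : 1 + cexp (W t) =
        ((1 + Real.exp (β * (Real.cos (2 * Real.pi * t) / a + b - μ)) : ℝ) : ℂ) := by
      simp only [hW]; push_cast; rfl
    simp only [hΦ]
    rw [e, ← ofReal_cpow (by positivity), sqrtSmear, fermiDirac, Real.sqrt_eq_rpow,
      one_div (1 + _), Real.inv_rpow (by positivity), Real.rpow_neg (by positivity)]
  have hF : ∀ n : ℤ, ‖∫ t in (0 : ℝ)..1, (sqrtSmear β μ a b (Real.cos (2 * Real.pi * t)) : ℂ) *
      cexp (-(2 * Real.pi * n * t * I))‖ ≤ r ^ n.natAbs := fun n => by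
    have h := norm_integral_mul_exp_le_of_strip (Φ := Φ) (η := η) (B := 1)
      (fun z hz => by
        have h1 : DifferentiableAt ℂ (fun z => 1 + cexp (W z)) z := by
          simp only [hW]; fun_prop
        exact (h1.cpow_const
          (Or.inl (lt_of_lt_of_le one_pos (hre z hz)))).differentiableWithinAt)
      (fun z _ => by
        simp only [hΦ, hW]
        rw [show 2 * (Real.pi : ℂ) * (z + 1) = 2 * Real.pi * z + 2 * Real.pi by ring,
          Complex.cos_add_two_pi])
      (fun z hz => by
        have h1 : 1 ≤ ‖1 + cexp (W z)‖ := (hre z hz).trans (Complex.re_le_norm _)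
        simp only [hΦ]
        rw [Complex.norm_cpow_real]
        exact Real.rpow_le_one_of_one_le_of_nonpos h1 (by norm_num))
      n (τ := η / 2) (by positivity) (by linarith)
    simp only [hΦreal, one_mul] at h
    refine h.trans (le_of_eq ?_)
    rw [hr, ← Real.exp_nat_mul, Nat.cast_natAbs, Int.cast_abs]
    congr 1
    rw [hα]; ring
  refine (abs_chebPoly_sub_le (continuous_sqrtSmear β μ a b) hr0.le hr1 hF M hx).trans ?_
  have hexp : Real.exp (-α * M) = r ^ M := by
    rw [hr, ← Real.exp_nat_mul]; congr 1; ring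
  rw [hexp, pow_succ, div_mul_eq_mul_div]
  gcongr
  exact mul_le_of_le_one_right (by positivity) hr1.le

end Chebyshev

/-! ### Polynomials of Hermitian matrices and compressions -/

section Compression

open Matrix

/-- The isometry that includes the coordinate space of `κ` into that of `ι`. -/
noncomputable abbrev inclMat {ι κ : Type*} [DecidableEq ι] (e : κ → ι) : Matrix ι κ ℂ :=
  (1 : Matrix ι ι ℂ).submatrix id e

theorem inclMat_apply {ι κ : Type*} [DecidableEq ι] (e : κ → ι) (i : ι) (k : κ) :
    inclMat e i k = if i = e k then 1 else 0 :=
  one_apply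

variable {ι : Type*} [Fintype ι] [DecidableEq ι]

theorem inclMat_isometry {κ : Type*} [DecidableEq κ] {e : κ → ι} (he : Function.Injective e) :
    (inclMat e)ᴴ * inclMat e = 1 := by
  ext k l
  simp [mul_apply, one_apply, he.eq_iff, eq_comm]

theorem inclMat_compression {κ : Type*} (e : κ → ι) (K : Matrix ι ι ℂ) :
    (inclMat e)ᴴ * K * inclMat e = K.submatrix e e := by
  ext k l
  simp [mul_apply, one_apply]

theorem cfc_sub_cfc {K : Matrix ι ι ℂ} (hK : K.IsHermitian) (f g : ℝ → ℝ) :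
    hK.cfc f - hK.cfc g = hK.cfc fun x => f x - g x := by
  rw [cfc_eq_conj_rdiag, cfc_eq_conj_rdiag, cfc_eq_conj_rdiag, ← Matrix.sub_mul, ← Matrix.mul_sub]
  simp [rdiag, diagonal_sub]

/-- The polynomial `x ↦ a (x - b)`. -/
noncomputable def affinePoly (a b : ℝ) : ℝ[X] := Polynomial.C a * (Polynomial.X - Polynomial.C b)

theorem aeval_affinePoly (a b : ℝ) (K : Matrix ι ι ℂ) :
    Polynomial.aeval K (affinePoly a b) = rescale a b K := by
  ext i j
  simp [affinePoly, rescale, Algebra.algebraMap_eq_smul_one, one_apply]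

theorem aeval_rescale {K : Matrix ι ι ℂ} (hK : K.IsHermitian) (a b : ℝ) (q : ℝ[X]) :
    Polynomial.aeval (rescale a b K) q = hK.cfc fun x => q.eval (a * (x - b)) := by
  rw [← aeval_affinePoly, ← Polynomial.aeval_comp,
    ← cfc_polynomial (p := IsSelfAdjoint) _ K hK.isSelfAdjoint, hK.cfc_eq]
  simp [affinePoly, Polynomial.eval_comp]

theorem rescale_eigenvalues_mem {K : Matrix ι ι ℂ} (hK : K.IsHermitian) {a b : ℝ}
    {s : Set ℝ} (hs : spectrum ℝ (rescale a b K) ⊆ s) (i : ι) :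
    a * (hK.eigenvalues i - b) ∈ s := by
  refine hs ?_
  rw [← aeval_affinePoly]
  refine spectrum.subset_polynomial_aeval K (affinePoly a b)
    ⟨hK.eigenvalues i, hK.eigenvalues_mem_spectrum_real i, ?_⟩
  simp [affinePoly]

/-- The eigenvalues of a compression are convex combinations of the eigenvalues, by their
variational characterisation as Rayleigh quotients. -/
theorem eigenvalues_compression_mem {κ : Type*} [Fintype κ] [DecidableEq κ]
    {K : Matrix ι ι ℂ} (hK : K.IsHermitian) {B : Matrix κ κ ℂ} (hB : B.IsHermitian)
    {J : Matrix ι κ ℂ} (hJ : Jᴴ * J = 1) (hBK : Jᴴ * K * J = B)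
    {s : Set ℝ} (hs : Convex ℝ s) (hKs : ∀ i, hK.eigenvalues i ∈ s) (k : κ) :
    hB.eigenvalues k ∈ s := by
  set W := (eigMat hK)ᴴ * J * eigMat hB with hW
  have hWh : Wᴴ = (eigMat hB)ᴴ * Jᴴ * eigMat hK := by
    rw [hW, conjTranspose_mul, conjTranspose_mul, conjTranspose_conjTranspose, Matrix.mul_assoc]
  have h1 : Wᴴ * W = 1 := by
    calc Wᴴ * W = (eigMat hB)ᴴ * (Jᴴ * (eigMat hK * (eigMat hK)ᴴ) * J) * eigMat hB := by
          rw [hWh, hW]; simp only [Matrix.mul_assoc]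
      _ = 1 := by
          rw [eigMat_mul_conjTranspose_self, Matrix.mul_one, hJ, Matrix.mul_one,
            eigMat_conjTranspose_mul_self]
  have h2 : Wᴴ * rdiag hK.eigenvalues * W = rdiag hB.eigenvalues := by
    calc Wᴴ * rdiag hK.eigenvalues * W = (eigMat hB)ᴴ *
          (Jᴴ * (eigMat hK * rdiag hK.eigenvalues * (eigMat hK)ᴴ) * J) * eigMat hB := by
          rw [hWh, hW]; simp only [Matrix.mul_assoc]
      _ = _ := by rw [← eq_conj_rdiag hK, hBK, conj_eigMat_mul_mul_eigMat]
  have h3 : ∑ i, ‖W i k‖ ^ 2 = 1 := by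
    have := congrFun (congrFun h1 k) k
    rw [mul_apply, one_apply_eq] at this
    simp only [conjTranspose_apply, RCLike.star_def, Complex.conj_mul'] at this
    exact_mod_cast this
  have h4 : ∑ i, ‖W i k‖ ^ 2 • hK.eigenvalues i = hB.eigenvalues k := by
    have := congrFun (congrFun h2 k) k
    rw [Matrix.mul_assoc, mul_apply, rdiag_apply, if_pos rfl] at this
    simp only [diagonal_mul, conjTranspose_apply, RCLike.star_def, mul_left_comm (conj _),
      Complex.conj_mul'] at this
    have h5 : ((∑ i, hK.eigenvalues i * ‖W i k‖ ^ 2 : ℝ) : ℂ) = hB.eigenvalues k := by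
      rw [← this]; push_cast; rfl
    rw [← Complex.ofReal_injective h5]
    simp [mul_comm]
  rw [← h4]
  exact hs.sum_mem (fun i _ => sq_nonneg _) h3 fun i _ => hKs i

end Compression

/-! ### Zero padding -/

section Padding

open Matrix

variable {d : ℕ} {A : Matrix.GeneralLinearGroup (Fin d) ℝ} {E₀ E₁ E : ℝ}

theorem cutoffSet_mono (h : E₀ ≤ E₁) : cutoffSet A E₀ ⊆ cutoffSet A E₁ := fun k hk => by
  have : ‖dualVec A k‖ ^ 2 ≤ 2 * E₀ := hk
  change ‖dualVec A k‖ ^ 2 ≤ 2 * E₁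
  linarith

/-- The inclusion of plane-wave bases. -/
def inclPW (h : E₀ ≤ E₁) : PW A E₀ → PW A E₁ := fun G =>
  ⟨G.1, cutoffSet_mono h G.2⟩

theorem inclPW_injective (h : E₀ ≤ E₁) : Function.Injective (inclPW (A := A) h) :=
  fun _ _ hG => Subtype.ext (congrArg (fun G : PW A E₁ => G.1) hG)

theorem zeroPad_eq (h : E₀ ≤ E₁) (B : Matrix (PW A E₀) (PW A E₀) ℂ) :
    zeroPad A E₀ E₁ B = inclMat (inclPW (A := A) h) * B * (inclMat (inclPW (A := A) h))ᴴ := by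
  have hmem : ∀ (i : PW A E₁) (k : PW A E₀), i = inclPW h k ↔ i.1 = k.1 := fun i k =>
    Subtype.ext_iff
  ext i j
  have hentry : (inclMat (inclPW (A := A) h) * B * (inclMat (inclPW (A := A) h))ᴴ) i j =
      ∑ l, ∑ k, if i.1 = k.1 ∧ j.1 = l.1 then B k l else 0 := by
    rw [mul_apply]
    refine Finset.sum_congr rfl fun l _ => ?_
    rw [mul_apply, Finset.sum_mul]
    refine Finset.sum_congr rfl fun k _ => ?_
    rw [conjTranspose_apply, inclMat_apply, inclMat_apply]
    simp only [hmem]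
    by_cases h1 : i.1 = k.1 <;> by_cases h2 : j.1 = l.1 <;> simp [h1, h2]
  rw [hentry, zeroPad]
  split_ifs with hij
  · rw [Finset.sum_eq_single ⟨j.1, hij.2⟩, Finset.sum_eq_single ⟨i.1, hij.1⟩]
    · simp
    · intro k _ hk
      exact if_neg fun h => hk (Subtype.ext h.1.symm)
    · simp
    · intro l _ hl
      exact Finset.sum_eq_zero fun k _ => if_neg fun h => hl (Subtype.ext h.2.symm)
    · simp
  · refine (Finset.sum_eq_zero fun l _ => Finset.sum_eq_zero fun k _ => if_neg fun h => hij ?_).symm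
    exact ⟨h.1 ▸ k.2, h.2 ▸ l.2⟩

theorem frobSq_zeroPad (h : E₀ ≤ E₁) (B : Matrix (PW A E₀) (PW A E₀) ℂ) :
    frobSq (zeroPad A E₀ E₁ B) = frobSq B := by
  have hJ := inclMat_isometry (inclPW_injective (A := A) h)
  rw [zeroPad_eq h, frobSq_mul_conjTranspose_isometry hJ, frobSq_isometry_mul hJ]

theorem zeroPad_sub (B C : Matrix (PW A E₀) (PW A E₀) ℂ) :
    zeroPad A E₀ E₁ B - zeroPad A E₀ E₁ C = zeroPad A E₀ E₁ (B - C) := by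
  ext i j
  simp only [zeroPad, Matrix.sub_apply]
  split_ifs <;> simp

theorem zeroPad_zeroPad (h : E₀ ≤ E₁) (B : Matrix (PW A E₀) (PW A E₀) ℂ) :
    zeroPad A E₁ E (zeroPad A E₀ E₁ B) = zeroPad A E₀ E B := by
  ext i j
  simp only [zeroPad]
  by_cases h0 : i.1 ∈ cutoffSet A E₀ ∧ j.1 ∈ cutoffSet A E₀
  · have h1 : i.1 ∈ cutoffSet A E₁ ∧ j.1 ∈ cutoffSet A E₁ :=
      ⟨cutoffSet_mono h h0.1, cutoffSet_mono h h0.2⟩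
    rw [dif_pos h1, dif_pos h0]
  · rw [dif_neg h0]
    split_ifs <;> rfl

theorem card_PW_mono (h : E₀ ≤ E₁) : Fintype.card (PW A E₀) ≤ Fintype.card (PW A E₁) :=
  Fintype.card_le_of_injective _ (inclPW_injective h)

variable (A) in
/-- A bound on the `m` lowest kinetic energies that does not depend on the cutoff. -/
theorem exists_kinetic_le (m : ℕ) : ∃ Es : ℝ, ∀ E, m ≤ Fintype.card (PW A E) →
    ∃ s : Finset (PW A E), s.card = m ∧
      ∀ G ∈ s, kinetic (fun k => ‖dualVec A k‖) Subtype.val G ≤ Es := by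
  by_cases hm : ∃ E', m ≤ Fintype.card (PW A E')
  · obtain ⟨E', hE'⟩ := hm
    have hkin : ∀ {E} (G : PW A E), kinetic (fun k => ‖dualVec A k‖) Subtype.val G ≤ E :=
      fun {E} G => by
        have : ‖dualVec A G.1‖ ^ 2 ≤ 2 * E := G.2
        rw [kinetic]; linarith
    refine ⟨E', fun E hE => ?_⟩
    rcases le_total E E' with h | h
    · obtain ⟨s, -, hs⟩ := Finset.exists_subset_card_eq (s := (Finset.univ : Finset (PW A E))) hE
      exact ⟨s, hs, fun G _ => (hkin G).trans h⟩
    · obtain ⟨s, -, hs⟩ := Finset.exists_subset_card_eq (s := (Finset.univ : Finset (PW A E'))) hE'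
      refine ⟨s.map ⟨inclPW h, inclPW_injective h⟩, by rwa [Finset.card_map], fun G hG => ?_⟩
      obtain ⟨G', -, rfl⟩ := Finset.mem_map.1 hG
      exact hkin G'
  · exact ⟨0, fun E hE => absurd ⟨E, hE⟩ hm⟩

end Padding

/-! ### The level variance -/

section Levels

open Matrix

variable {d : ℕ} {A : Matrix.GeneralLinearGroup (Fin d) ℝ} {V : EuclideanSpace ℝ (Fin d) → ℝ}
  {c δ β : ℝ}

/-- The matrix of a potential in the plane-wave basis. -/
noncomputable def potMat (A : Matrix.GeneralLinearGroup (Fin d) ℝ)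
    (V : EuclideanSpace ℝ (Fin d) → ℝ) (E : ℝ) : Matrix (PW A E) (PW A E) ℂ :=
  of fun G G' => cellFourier A V (G.1 - G'.1)

theorem potMat_isHermitian (E : ℝ) : (potMat A V E).IsHermitian := by
  ext G G'
  rw [conjTranspose_apply, potMat, of_apply, of_apply, ← neg_sub, cellFourier_neg, RCLike.star_def,
    Complex.conj_conj]

/-- The norm of a dual lattice vector, as a function of its coordinates. -/
noncomputable abbrev dualNorm (A : Matrix.GeneralLinearGroup (Fin d) ℝ) (k : Fin d → ℤ) : ℝ :=
  ‖dualVec A k‖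

/-- The Hamiltonian matrix as kinetic energy plus potential. -/
noncomputable abbrev hamMat (A : Matrix.GeneralLinearGroup (Fin d) ℝ)
    (V : EuclideanSpace ℝ (Fin d) → ℝ) (E : ℝ) : Matrix (PW A E) (PW A E) ℂ :=
  rdiag (kinetic (dualNorm A) Subtype.val) + potMat A V E

theorem hamMat_apply (E : ℝ) (G G' : PW A E) :
    hamMat A V E G G' = (if G = G' then (kinetic (dualNorm A) Subtype.val G : ℂ) else 0) +
      cellFourier A V (G.1 - G'.1) := by
  rw [← rdiag_apply]
  rfl

theorem hamMat_isHermitian (E : ℝ) : (hamMat A V E).IsHermitian :=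
  (isHermitian_rdiag _).add (potMat_isHermitian E)

theorem hamMat_compression {E₀ E₁ : ℝ} (h : E₀ ≤ E₁) :
    (inclMat (inclPW (A := A) h))ᴴ * hamMat A V E₁ * inclMat (inclPW (A := A) h) =
      hamMat A V E₀ := by
  rw [inclMat_compression]
  ext k l
  simp only [submatrix_apply, hamMat_apply, (inclPW_injective h).eq_iff]
  rfl

/-- Interlacing: a decreasing spectral function has a smaller trace on a smaller basis. -/
theorem frobSq_cfc_sqrt_fermiDirac_le (hβ : 0 < β) (μ : ℝ) {E₀ E₁ : ℝ} (h : E₀ ≤ E₁) :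
    frobSq ((hamMat_isHermitian (A := A) (V := V) E₀).cfc fun x => √(fermiDirac β μ x)) ≤
      ∑ j, fermiDirac β μ ((hamMat_isHermitian (A := A) (V := V) E₁).eigenvalues j) := by
  rw [frobSq_cfc]
  simp only [Real.sq_sqrt (fermiDirac_pos μ β _).le]
  obtain ⟨f, hf, hle⟩ := exists_injective_eigenvalues_le
    (hamMat_isHermitian (A := A) (V := V) E₁) (hamMat_isHermitian (A := A) (V := V) E₀)
    (inclMat_isometry (inclPW_injective h)) (by
      rw [hamMat_compression h, sub_self]; exact PosSemidef.zero)
  exact sum_le_sum_of_injective_le hf hle (fermiDirac_antitone μ hβ)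
    fun x => (fermiDirac_pos μ β x).le

/-- The Fermi level is bounded above: the basis has at least `N + 1` elements, the lowest `N + 1`
kinetic energies are bounded, and not all of the corresponding states can be nearly filled. -/
theorem exp_mul_fermiLevel_le (hβ : 0 < β) (hδ : 0 < δ) (hc : 0 ≤ c) {E : ℝ}
    (hV : ∀ k, ‖cellFourier A V k‖ ≤ c * Real.exp (-(2 * δ * dualNorm A k))) {N : ℕ} {Es μ : ℝ}
    (hEs : N + 1 ≤ Fintype.card (PW A E) → ∃ s : Finset (PW A E), s.card = N + 1 ∧
      ∀ G ∈ s, kinetic (dualNorm A) Subtype.val G ≤ Es)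
    (hE : 0 < E)
    (hμ : ∑ j, fermiDirac β μ ((hamMat_isHermitian (A := A) (V := V) E).eigenvalues j) = N) :
    1 ≤ N ∧ Real.exp (β * μ) ≤ N * Real.exp (β * (Es + kernelBound (dualNorm A) δ c)) := by
  set cb := kernelBound (dualNorm A) δ c with hcb
  have hne : Nonempty (PW A E) := ⟨⟨0, by
    change ‖dualVec A 0‖ ^ 2 ≤ 2 * E
    have : dualVec A (0 : Fin d → ℤ) = 0 := by simp [dualVec_eq_sum]
    rw [this, norm_zero]
    nlinarith⟩⟩
  have hNpos : (0 : ℝ) < N := by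
    rw [← hμ]
    exact Finset.sum_pos (fun j _ => fermiDirac_pos μ β _) Finset.univ_nonempty
  have hcard : N + 1 ≤ Fintype.card (PW A E) := by
    have : (N : ℝ) < Fintype.card (PW A E) := by
      rw [← hμ]
      calc _ < ∑ _j : PW A E, (1 : ℝ) :=
            Finset.sum_lt_sum_of_nonempty Finset.univ_nonempty fun j _ => fermiDirac_lt_one μ β _
        _ = _ := by simp
    exact_mod_cast this
  obtain ⟨s, hs, hsE⟩ := hEs hcard
  obtain ⟨f, hf, hle⟩ := exists_injective_eigenvalues_le_of_rdiag
    (hamMat_isHermitian (A := A) (V := V) E)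
    (posSemidef_kinetic_comparison (summable_exp_neg_mul_norm_dualVec A hδ)
      (fun k => norm_nonneg _) hδ.le hc Subtype.val_injective (potMat_isHermitian E)
      (fun i j => hV _)).1
  have h1 : (N + 1) * fermiDirac β μ (Es + cb) ≤ N := by
    calc (N + 1) * fermiDirac β μ (Es + cb) = ∑ G ∈ s, fermiDirac β μ (Es + cb) := by
          rw [Finset.sum_const, hs]; simp
      _ ≤ ∑ G ∈ s, fermiDirac β μ (kinetic (dualNorm A) Subtype.val G + cb) :=
          Finset.sum_le_sum fun G hG => fermiDirac_antitone μ hβ (by linarith [hsE G hG])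
      _ ≤ ∑ G, fermiDirac β μ (kinetic (dualNorm A) Subtype.val G + cb) :=
          Finset.sum_le_sum_of_subset_of_nonneg (Finset.subset_univ _)
            fun G _ _ => (fermiDirac_pos μ β _).le
      _ ≤ N := by
          rw [← hμ]
          exact sum_le_sum_of_injective_le hf hle (fermiDirac_antitone μ hβ)
            fun x => (fermiDirac_pos μ β x).le
  refine ⟨by exact_mod_cast hNpos, ?_⟩
  unfold fermiDirac at h1
  rw [mul_one_div, div_le_iff₀ (by positivity)] at h1
  have h2 : 1 ≤ N * Real.exp (β * (Es + cb - μ)) := by linarith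
  calc Real.exp (β * μ) = 1 * Real.exp (β * μ) := (one_mul _).symm
    _ ≤ (N * Real.exp (β * (Es + cb - μ))) * Real.exp (β * μ) := by gcongr
    _ = N * Real.exp (β * (Es + cb)) := by
        rw [mul_assoc, ← Real.exp_add]
        congr 2
        ring

/-- Comparison of the exact spectral functions on two levels: the weight is at least
`exp (δ √(2 E₀))` outside of the smaller basis. -/
theorem frobSq_cfc_sub_zeroPad_cfc_le (hβ : 0 < β) (hδ : 0 < δ) (hc : 0 ≤ c)
    (hV : ∀ k, ‖cellFourier A V k‖ ≤ c * Real.exp (-(2 * δ * dualNorm A k))) {E₀ E₁ : ℝ}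
    (hE₀ : 0 ≤ E₀) (h : E₀ ≤ E₁) {μ B : ℝ}
    (hB : 2 * Real.exp (3 / 2 * β * kernelBound (dualNorm A) δ c + 5 * δ ^ 2 / β) *
        (∑' k, Real.exp (-(δ * dualNorm A k))) * Real.exp (β * μ) ≤ B) :
    frobSq ((hamMat_isHermitian (A := A) (V := V) E₁).cfc (fun x => √(fermiDirac β μ x)) -
        zeroPad A E₀ E₁
          ((hamMat_isHermitian (A := A) (V := V) E₀).cfc fun x => √(fermiDirac β μ x))) ≤
      (8 * (β / 2) ^ 2 * kernelBound (dualNorm A) δ c ^ 2 + 2) * B *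
        Real.exp (-2 * δ * √E₀) := by
  have hsum := summable_exp_neg_mul_norm_dualVec A hδ
  have hsub : ∀ k l, dualNorm A k ≤ dualNorm A (k - l) + dualNorm A l := fun k l => by
    have : dualVec A k = dualVec A (k - l) + dualVec A l := by rw [dualVec_sub, sub_add_cancel]
    rw [dualNorm, this]
    exact norm_add_le _ _
  have hw : ∀ E, frobSq (rdiag (fun i : PW A E => Real.exp (δ * dualNorm A i.1)) *
      (hamMat_isHermitian (A := A) (V := V) E).cfc fun x => √(fermiDirac β μ x)) ≤ B := fun E =>
    (frobSq_weight_mul_cfc_le hβ hsum (fun k => norm_nonneg _) hsub hδ.le hc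
      Subtype.val_injective (potMat_isHermitian E) (fun i j => hV _) _ μ).trans hB
  have hB0 : 0 ≤ B := (frobSq_nonneg _).trans (hw E₀)
  rw [zeroPad_eq h]
  refine (frobSq_cfc_sub_pad_cfc_le (nm := dualNorm A) (δ := δ) (a := c) (b := β / 2) (B := B)
    (r := √(2 * E₀)) hsum (fun k => norm_nonneg _) hsub hδ.le hc Subtype.val_injective
    (potMat_isHermitian E₁) (fun i j => hV _) (hamMat_isHermitian E₁) (inclPW_injective h)
    (hamMat_isHermitian E₀) (fun x y => abs_sqrt_fermiDirac_sub_le μ hβ x y) (hw E₁) (hw E₀)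
    fun i hi => ?_).trans ?_
  · by_contra! hlt
    refine hi ⟨⟨i.1, ?_⟩, Subtype.ext rfl⟩
    exact ((Real.lt_sqrt (norm_nonneg _)).1 hlt).le
  · refine mul_le_mul_of_nonneg_left ?_ (by positivity)
    rw [← Real.exp_nat_mul]
    refine Real.exp_le_exp.2 ?_
    have : √E₀ ≤ √(2 * E₀) := Real.sqrt_le_sqrt (by linarith)
    push_cast
    nlinarith [mul_le_mul_of_nonneg_left this hδ.le]

/-- On a smaller basis the rescaled spectrum stays in `[-1, 1]`, so that the Chebyshev error carries
over to the matrices. -/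
theorem frobSq_chebPoly_sub_le {E₀ E : ℝ} (h : E₀ ≤ E) {μ a b κ α : ℝ} (ha : a ≠ 0)
    (hspec : spectrum ℝ (rescale a b (hamMat A V E)) ⊆ Set.Icc (-1) 1)
    (hrate : ChebRate (sqrtSmear β μ a b) κ α) (M : ℕ) :
    frobSq (Polynomial.aeval (rescale a b (hamMat A V E₀)) (chebPoly (sqrtSmear β μ a b) M) -
        (hamMat_isHermitian (A := A) (V := V) E₀).cfc fun x => √(fermiDirac β μ x)) ≤
      Fintype.card (PW A E) * (κ * Real.exp (-α * M)) ^ 2 := by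
  have hconv : Convex ℝ {x : ℝ | a * (x - b) ∈ Set.Icc (-1 : ℝ) 1} := by
    have := (convex_Icc (-1 : ℝ) 1).affine_preimage
      ((a : ℝ) • (AffineMap.id ℝ ℝ - AffineMap.const ℝ ℝ b))
    exact this
  have hmem := eigenvalues_compression_mem (hamMat_isHermitian (A := A) (V := V) E)
    (hamMat_isHermitian (A := A) (V := V) E₀) (inclMat_isometry (inclPW_injective h))
    (hamMat_compression h) hconv
    (rescale_eigenvalues_mem (hamMat_isHermitian (A := A) (V := V) E) hspec)
  rw [aeval_rescale (hamMat_isHermitian E₀), cfc_sub_cfc, frobSq_cfc]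
  have hκ : 0 ≤ κ * Real.exp (-α * M) :=
    (abs_nonneg _).trans (hrate M 0 (by norm_num))
  calc _ ≤ ∑ _j : PW A E₀, (κ * Real.exp (-α * M)) ^ 2 := by
        refine Finset.sum_le_sum fun j _ => sq_le_sq' ?_ ?_
        all_goals
          have h1 := hrate M _ (hmem j)
          have h2 : a * ((hamMat_isHermitian (A := A) (V := V) E₀).eigenvalues j - b) / a + b =
              (hamMat_isHermitian (A := A) (V := V) E₀).eigenvalues j := by field_simp; ring
          rw [sqrtSmear, h2] at h1
          have h3 := abs_le.1 h1
        · exact h3.1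
        · exact h3.2
    _ = Fintype.card (PW A E₀) * (κ * Real.exp (-α * M)) ^ 2 := by simp
    _ ≤ _ := by
        gcongr
        exact_mod_cast card_PW_mono h

/-- Both level approximations split into an exact spectral function and a Chebyshev error. -/
theorem frobSq_zeroPad_sub_zeroPad_le {E₀ E₁ E : ℝ} (h₀ : E₀ ≤ E₁) (h₁ : E₁ ≤ E)
    {Q₀ F₀ : Matrix (PW A E₀) (PW A E₀) ℂ} {Q₁ F₁ : Matrix (PW A E₁) (PW A E₁) ℂ} {ε D : ℝ}
    (hQ₀ : frobSq (Q₀ - F₀) ≤ ε) (hQ₁ : frobSq (Q₁ - F₁) ≤ ε)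
    (hF : frobSq (F₁ - zeroPad A E₀ E₁ F₀) ≤ D) :
    frobSq (zeroPad A E₁ E Q₁ - zeroPad A E₀ E Q₀) ≤ 4 * D + 6 * ε := by
  rw [← zeroPad_zeroPad h₀, zeroPad_sub, frobSq_zeroPad h₁]
  have hsplit : Q₁ - zeroPad A E₀ E₁ Q₀ =
      (Q₁ - F₁) + ((F₁ - zeroPad A E₀ E₁ F₀) - zeroPad A E₀ E₁ (Q₀ - F₀)) := by
    rw [← zeroPad_sub]
    abel
  have h1 := frobSq_add_le (Q₁ - F₁) ((F₁ - zeroPad A E₀ E₁ F₀) - zeroPad A E₀ E₁ (Q₀ - F₀))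
  have h2 := frobSq_sub_le (F₁ - zeroPad A E₀ E₁ F₀) (zeroPad A E₀ E₁ (Q₀ - F₀))
  rw [frobSq_zeroPad h₀] at h2
  rw [hsplit]
  linarith

theorem frobSq_zeroPad_le {E₀ E : ℝ} (h : E₀ ≤ E) {Q F : Matrix (PW A E₀) (PW A E₀) ℂ}
    {ε n : ℝ} (hQ : frobSq (Q - F) ≤ ε) (hF : frobSq F ≤ n) :
    frobSq (zeroPad A E₀ E Q) ≤ 2 * n + 2 * ε := by
  rw [frobSq_zeroPad h]
  have h1 := frobSq_add_le (Q - F) F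
  rw [sub_add_cancel] at h1
  linarith

theorem level_bound_arith {C k x e N : ℝ} (hC : 0 ≤ C) (hk : 0 ≤ k) (hx : 0 ≤ x) (hx1 : x ≤ 1)
    (he : 0 ≤ e) (he1 : e ≤ 1) (hN : 1 ≤ N) :
    2 * (4 * (C * x) + 6 * (k * e)) * ((2 * N + 2 * (k * e)) + (2 * N + 2 * (k * e))) ≤
      16 * (2 * C + 3) * N * (x + k * (1 + k) * e) := by
  have hN0 : 0 ≤ N := zero_le_one.trans hN
  have h1 : x * (k * e) ≤ N * (k * e) := by gcongr; exact hx1.trans hN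
  have h2 : (k * e) * (k * e) ≤ N * (k * (k * e)) := by
    calc (k * e) * (k * e) = e * (k * (k * e)) := by ring
      _ ≤ N * (k * (k * e)) := by gcongr; exact he1.trans hN
  have h3 : 0 ≤ C * (N * (k * (k * e))) := by positivity
  have h4 : 0 ≤ N * x := by positivity
  calc _ = 16 * (2 * C * (x * N + x * (k * e)) +
        3 * (N * (k * e) + (k * e) * (k * e))) := by ring
    _ ≤ 16 * (2 * C * (x * N + N * (k * e)) + 3 * (N * (k * e) + N * (k * (k * e)))) := by gcongr
    _ ≤ _ := by linarith

/-- The variance of a level difference, in terms of a bound `B` on the weighted spectral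
functions. -/
theorem matrixVariance_zeroPad_sub_zeroPad_le (hβ : 0 < β) (hδ : 0 < δ) (hc : 0 ≤ c)
    (hV : ∀ k, ‖cellFourier A V k‖ ≤ c * Real.exp (-(2 * δ * dualNorm A k))) {E₀ E₁ E : ℝ}
    (hE₀ : 0 ≤ E₀) (h₀ : E₀ ≤ E₁) (h₁ : E₁ ≤ E) {μ B C₂ : ℝ}
    (hB : 2 * Real.exp (3 / 2 * β * kernelBound (dualNorm A) δ c + 5 * δ ^ 2 / β) *
        (∑' k, Real.exp (-(δ * dualNorm A k))) * Real.exp (β * μ) ≤ B)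
    (hC₂ : C₂ = (8 * (β / 2) ^ 2 * kernelBound (dualNorm A) δ c ^ 2 + 2) * B) (hC₂0 : 0 ≤ C₂)
    {N : ℕ} (hN : 1 ≤ N)
    (hμ : ∑ j, fermiDirac β μ ((hamMat_isHermitian (A := A) (V := V) E).eigenvalues j) = N)
    {a b κ α : ℝ} (ha : a ≠ 0) (hα : 0 ≤ α)
    (hspec : spectrum ℝ (rescale a b (hamMat A V E)) ⊆ Set.Icc (-1) 1)
    (hrate : ChebRate (sqrtSmear β μ a b) κ α) (M : ℕ)
    {S : Type*} [MeasurableSpace S] {Pr : Measure S} [IsProbabilityMeasure Pr]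
    {χ : PW A E → S → ℂ} (hχ : IsRandomOrbital Pr χ) (hm : HasOrbitalMoments Pr χ) :
    matrixVariance Pr (fun ω =>
      orbitalMatrix (zeroPad A E₁ E (Polynomial.aeval (rescale a b (hamMat A V E₁))
        (chebPoly (sqrtSmear β μ a b) M))) (fun G => χ G ω) -
      orbitalMatrix (zeroPad A E₀ E (Polynomial.aeval (rescale a b (hamMat A V E₀))
        (chebPoly (sqrtSmear β μ a b) M))) (fun G => χ G ω)) ≤
      16 * (2 * C₂ + 3) * N * (Real.exp (-2 * δ * √E₀) +
        κ ^ 2 * Fintype.card (PW A E) * (1 + κ ^ 2 * Fintype.card (PW A E)) *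
          Real.exp (-2 * α * M)) := by
  have h0E := h₀.trans h₁
  have he1 : Real.exp (-2 * α * M) ≤ 1 := Real.exp_le_one_iff.2 (by
    have : 0 ≤ α * M := by positivity
    linarith)
  have hx1 : Real.exp (-2 * δ * √E₀) ≤ 1 := Real.exp_le_one_iff.2 (by
    have : 0 ≤ δ * √E₀ := by positivity
    linarith)
  have hε : (Fintype.card (PW A E) : ℝ) * (κ * Real.exp (-α * M)) ^ 2 =
      κ ^ 2 * Fintype.card (PW A E) * Real.exp (-2 * α * M) := by
    have : Real.exp (-2 * α * M) = Real.exp (-α * M) ^ 2 := by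
      rw [← Real.exp_nat_mul]; congr 1; push_cast; ring
    rw [this]; ring
  have hk0 : 0 ≤ κ ^ 2 * (Fintype.card (PW A E) : ℝ) := by positivity
  have hcheb₀ := (frobSq_chebPoly_sub_le h0E ha hspec hrate M).trans_eq hε
  have hcheb₁ := (frobSq_chebPoly_sub_le h₁ ha hspec hrate M).trans_eq hε
  have hexact₀ := (frobSq_cfc_sqrt_fermiDirac_le (V := V) hβ μ h0E).trans_eq hμ
  have hexact₁ := (frobSq_cfc_sqrt_fermiDirac_le (V := V) hβ μ h₁).trans_eq hμ
  have hD := frobSq_cfc_sub_zeroPad_cfc_le hβ hδ hc hV hE₀ h₀ hB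
  rw [← hC₂] at hD
  have hdiff := frobSq_zeroPad_sub_zeroPad_le h₀ h₁ hcheb₀ hcheb₁ hD
  have hQ₁ := frobSq_zeroPad_le h₁ hcheb₁ hexact₁
  have hQ₀ := frobSq_zeroPad_le h0E hcheb₀ hexact₀
  refine (matrixVariance_orbitalMatrix_sub_le hχ hm _ _).trans ?_
  refine le_trans ?_ (level_bound_arith hC₂0 hk0 (Real.exp_pos _).le hx1 (Real.exp_pos _).le he1
    (by exact_mod_cast hN))
  refine mul_le_mul (mul_le_mul_of_nonneg_left hdiff (by norm_num)) (add_le_add hQ₁ hQ₀)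
    (add_nonneg (frobSq_nonneg _) (frobSq_nonneg _)) (by positivity)

end Levels

end StochDFT

open StochDFT in
theorem mainTheorem1 {d : ℕ} (A : Matrix.GeneralLinearGroup (Fin d) ℝ) (β : ℝ) (hβ : 0 < β) :
    -- the rate of the Chebyshev expansion is determined by the smearing and the scaling
    (∀ a : ℝ, a ≠ 0 → ∃ κ α : ℝ, 0 < κ ∧ 0 < α ∧
      ∀ μ b : ℝ, StochDFT.ChebRate (StochDFT.sqrtSmear β μ a b) κ α) ∧
    -- the level variance
    ∀ (N : ℕ) (c σ : ℝ), 0 < σ →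
      ∃ C γ : ℝ, 0 < C ∧ 0 < γ ∧
        ∀ (vext : EuclideanSpace ℝ (Fin d) → ℝ) (vxc : ℝ → ℝ)
          (L : ℕ) (Ec : Fin (L + 1) → ℝ), (∀ ℓ, 0 < Ec ℓ) → StrictMono Ec →
        ∀ P : Matrix (StochDFT.PW A (Ec (Fin.last L))) (StochDFT.PW A (Ec (Fin.last L))) ℂ,
          StochDFT.IsDensityMatrix N P →
          StochDFT.IsAnalyticPotential A c σ
            (StochDFT.totalPotential A vext vxc (StochDFT.density A P)) →
        ∀ μ : ℝ,
          (cfc (StochDFT.fermiDirac β μ)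
            (StochDFT.ksMatrix A vext vxc (StochDFT.density A P)
              (Ec (Fin.last L)))).trace = (N : ℂ) →
        ∀ a b : ℝ, a ≠ 0 →
          spectrum ℝ (StochDFT.rescale a b
            (StochDFT.ksMatrix A vext vxc (StochDFT.density A P) (Ec (Fin.last L)))) ⊆
              Set.Icc (-1) 1 →
        ∀ κ α : ℝ, 0 < α → StochDFT.ChebRate (StochDFT.sqrtSmear β μ a b) κ α →
        ∀ {S : Type*} [MeasurableSpace S] (Pr : MeasureTheory.Measure S)
          [MeasureTheory.IsProbabilityMeasure Pr]
          (χ : StochDFT.PW A (Ec (Fin.last L)) → S → ℂ),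
          StochDFT.IsRandomOrbital Pr χ → StochDFT.HasOrbitalMoments Pr χ →
        ∀ (M : ℕ) (ℓ : Fin L),
          StochDFT.levelVariance A vext vxc (StochDFT.density A P) β μ a b M
              (Ec ℓ.succ) (Ec ℓ.castSucc) (Ec (Fin.last L)) Pr χ ≤
            C * N * (Real.exp (-2 * γ * Real.sqrt (Ec ℓ.castSucc)) +
              κ ^ 2 * Fintype.card (StochDFT.PW A (Ec (Fin.last L))) *
                (1 + κ ^ 2 * Fintype.card (StochDFT.PW A (Ec (Fin.last L)))) *
                Real.exp (-2 * α * M)) := by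
  refine ⟨fun a ha => exists_chebRate_sqrtSmear hβ ha, fun N c σ hσ => ?_⟩
  obtain ⟨δ, hδ, hfour⟩ := exists_norm_cellFourier_le_exp (A := A) hσ
  obtain ⟨Es, hEs⟩ := exists_kinetic_le A (N + 1)
  -- `B` bounds the weighted spectral functions on all levels, because
  -- `exp (β μ) ≤ N exp (β (Es + cb))`
  set cb := kernelBound (dualNorm A) δ |c| with hcb
  set B := 2 * Real.exp (3 / 2 * β * cb + 5 * δ ^ 2 / β) *
    (∑' k, Real.exp (-(δ * dualNorm A k))) * (N * Real.exp (β * (Es + cb))) with hB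
  have hS : 0 ≤ ∑' k, Real.exp (-(δ * dualNorm A k)) := tsum_nonneg fun k => (Real.exp_pos _).le
  set C₂ := (8 * (β / 2) ^ 2 * cb ^ 2 + 2) * B with hC₂
  have hC₂0 : 0 ≤ C₂ := by positivity
  refine ⟨16 * (2 * C₂ + 3), δ, by positivity, hδ, ?_⟩
  intro vext vxc L Ec hEc hmono P _ hV μ htr a b ha hspec κ α hα hrate S _ Pr _ χ hχ hm M ℓ
  set V := totalPotential A vext vxc (density A P)
  have hks : ∀ E, ksMatrix A vext vxc (density A P) E = hamMat A V E := fun E =>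
    ksMatrix_eq hσ hV E
  have hV' : ∀ k, ‖cellFourier A V k‖ ≤ |c| * Real.exp (-(2 * δ * dualNorm A k)) := fun k =>
    (hfour c V hV k).trans (by gcongr; exact le_abs_self c)
  -- the trace condition, as a sum over the eigenvalues
  have hμ : ∑ j, fermiDirac β μ
      ((hamMat_isHermitian (A := A) (V := V) (Ec (Fin.last L))).eigenvalues j) = N := by
    rw [hks, (hamMat_isHermitian _).cfc_eq, trace_cfc] at htr
    exact_mod_cast htr
  obtain ⟨hN, hexp⟩ := exp_mul_fermiLevel_le hβ hδ (abs_nonneg c) hV' (hEs _) (hEc _) hμ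
  rw [hks] at hspec
  unfold levelVariance levelApprox
  rw [hks, hks]
  exact matrixVariance_zeroPad_sub_zeroPad_le hβ hδ (abs_nonneg c) hV' (hEc _).le
    (hmono.monotone ℓ.castSucc_lt_succ.le) (hmono.monotone (Fin.le_last _))
    (by rw [hB]; gcongr) hC₂ hC₂0 hN hμ ha hα.le hspec hrate M hχ hm
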